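/- **Setting.** For a finite set of letters $S$ let $\mathbb{Q}\langle e_a\mid a\in S\rangle$ be the free associative $\mathbb{Q}$-algebra, and let $\mathbin{\sqcup\!\sqcup} $ be the shuffle product on it (bilinear, $1\mathbin{\sqcup\!\sqcup} u=u\mathbin{\sqcup\!\sqcup} 1=u$, $e_au\mathbin{\sqcup\!\sqcup} e_bv=e_a(u\mathbin{\sqcup\!\sqcup} e_bv)+e_b(e_au\mathbin{\sqcup\!\sqcup} v)$). Let $\mathcal{A}=\mathbb{Q}\langle e_0,e_1,e_{-1}\rangle$, and let $\mathcal{A}^0\subset\mathcal{A}$ be the span of the words (including the empty one) that do not begin with $e_0$ and do not end with $e_1$; this is $\mathbb{Q}\otimes\mathcal{A}^0(\{0,1,-1\})$. Let $\mathcal{A}^0_{k,d}\subset\mathcal{A}^0$ be the span of those words of length $k$ that have at most $d$ letters different from $e_0$. Let $\mathrm{reg}_{\sqcup\!\sqcup}$ be the linear projection determined by $\mathrm{reg}_{\sqcup\!\sqcup}(e_0^n\mathbin{\sqcup\!\sqcup} e_1^m\mathbin{\sqcup\!\sqcup} u)=u$ if $n=m=0$ and $=0$ otherwise ($u$ in the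 span of the words not beginning with $e_0$ and not ending with $e_1$); it is used on $\mathcal{A}$ and on $\mathbb{Q}\langle e_0,e_1\rangle$. *The map $\wp$.* Let $\mathrm{dist}:\mathbb{Q}\langle e_0,e_1\rangle\to\mathcal{A}$ and $\varrho:\mathbb{Q}\langle e_0,e_1\rangle\to\mathbb{Q}\langle e_0,e_1\rangle$ be the ring homomorphisms with $\mathrm{dist}(e_0)=2e_0$, $\mathrm{dist}(e_1)=e_1+e_{-1}$, $\varrho(e_0)=e_0-e_1$, $\varrho(e_1)=-e_1$, and let $\varsigma$ be the anti-automorphism of $\mathbb{Q}\langle e_0,e_1\rangle$ with $\varsigma(e_0)=-e_1$, $\varsigma(e_1)=-e_0$. For positive integers $k_1,\dots,k_d$ put $\theta(\emptyset)=1$ and $$\theta(k_1,\dots,k_d)=-\sum_{j=1}^d e_1e_0^{k_j-1}\cdots e_1e_0^{k_1-1}\mathbin{\sqcup\!\sqcup} \theta(k_{j+1},\dots,k_d)\qquad(d>0),$$ put $\theta'=\mathrm{dist}\circ\mathrm{reg}_{\sqcup\!\sqcup}\circ\varsigma\circ\theta$ and $\theta_1(\Bbbk)=\theta'(\Bbbk)+2\sum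 e_{-1}e_0^{2m-1}\mathbin{\sqcup\!\sqcup} \theta'(\Bbbk')$, the sum being over all $m\ge1$ and $\Bbbk'$ with $\Bbbk=(\Bbbk',\{1\}^{2m})$. Put $w^\star(\emptyset)=1$ and $w^\star(k_1,\dots,k_d)=-e_1e_0^{k_1-1}(e_0-e_1)e_0^{k_2-1}\cdots(e_0-e_1)e_0^{k_d-1}$. The elements $\varrho(w^\star(\Bbbk))$ form a basis of $\mathcal{C}=\mathbb{Q}\oplus e_1\mathbb{Q}\langle e_0,e_1\rangle$; let $\wp:\mathcal{C}\to\mathcal{A}$ be the linear map with $\wp(\varrho(w^\star(\Bbbk)))=\theta_1(\Bbbk)$. *Regularized limit.* Let $\mathcal{B}\subset\mathbb{Q}\langle e_0,e_{-1},e_z,e_{-z^2}\rangle$ be the span of the words that do not begin with $e_0$ and do not end with $e_z$. The map $\mathrm{reg}_{z\to0}:\mathcal{B}\to\mathcal{A}^0$ kills the words containing $e_{-1}$. On the span of the other words it is determined by $\mathrm{reg}_{z\to0}(u_1\mathbin{\sqcup\!\sqcup} u_2)=\mathrm{dist}(\bar u_1)\mathbin{\sqcup\!\sqcup} \wp(\hat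 u_2)$ whenever $u_1\in\mathcal{B}$ is $1$ or a word beginning with $e_z$ (without $e_{-1}$), and $u_2\in\mathcal{B}$ is a word in $e_0,e_{-z^2}$ only; here $\bar{\ }$ is the substitution $e_0,e_{-z^2}\mapsto e_0$, $e_z\mapsto e_1$, and $\hat{\ }$ is $e_0\mapsto e_0$, $e_{-z^2}\mapsto e_1$. (These $u_1\otimes u_2\mapsto u_1\mathbin{\sqcup\!\sqcup} u_2$ define an isomorphism onto that span.) *Confluence relations.* For $c\in\{0,1,-1\}$ let $\partial_c:\mathcal{B}\to\mathcal{B}$ be the linear map $$\partial_c(e_{a_1}\cdots e_{a_k})=\sum_{i=1}^k\bigl(\mathrm{ord}_{z=c}(a_i-a_{i+1})-\mathrm{ord}_{z=c}(a_i-a_{i-1})\bigr)e_{a_1}\cdots e_{a_{i-1}}e_{a_{i+1}}\cdots e_{a_k},$$ with $a_0=0$, $a_{k+1}=z$ and $\mathrm{ord}_{z=c}(0):=0$. Put $$\varphi(u)=\sum_{l\ge0}\ \sum_{c_1,\dots,c_l\in\{0,1,-1\}}\mathrm{reg}_{z\to0}(\partial_{c_1}\cdots\partial_{c_l}u)\mathbin{\sqcup\!\sqcup}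 \mathrm{reg}_{\sqcup\!\sqcup}(e_{c_1}\cdots e_{c_l})\qquad(u\in\mathcal{B}),$$ let $u|_{z\to1}$ be obtained by $e_0\mapsto e_0$, $e_{-1}\mapsto e_{-1}$, $e_z\mapsto e_1$, $e_{-z^2}\mapsto e_{-1}$, and put $\mathcal{I}_{\mathrm{CF}}=\{u|_{z\to1}-\varphi(u)\mid u\in\mathcal{B}\}$ and $\mathcal{H}_{\mathrm{CF}}=\mathcal{A}^0/\mathcal{I}_{\mathrm{CF}}$. *Indices.* For $k,d\ge0$ let $\mathbb{I}(k,d)$ be the set of tuples $\Bbbk=(k_1,\dots,k_r)$ of nonzero integers with $r\le d$, $|k_1|+\dots+|k_r|=k$ and ($r=0$ or $k_r\ne1$). Let $\mathbb{I}^{\mathrm D}(k,d)$ be the set of those with $k_1,\dots,k_{r-1}>0$, $k_r<0$ and $k_2,\dots,k_r$ odd (the empty tuple is allowed). Put $\tilde w(\Bbbk)=2^r e_{\epsilon_1}e_0^{|k_1|-1}\cdots e_{\epsilon_r}e_0^{|k_r|-1}\in\mathcal{A}^0$ with $\epsilon_i=\mathrm{sgn}(k_i)\epsilon_{i+1}$,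 $\epsilon_{r+1}=1$. Let $\mathbb{Z}_{(2)}\subset\mathbb{Q}$ be the ring of fractions with odd denominator. **Theorem.** For all $k\ge0$ and $d\ge0$, in $\mathcal{H}_{\mathrm{CF}}$, $$\mathrm{span}_{\mathbb{Z}_{(2)}}\{\tilde w(\Bbbk)\bmod\mathcal{I}_{\mathrm{CF}}\mid\Bbbk\in\mathbb{I}(k,d)\}=\mathrm{span}_{\mathbb{Z}_{(2)}}\{\tilde w(\Bbbk)\bmod\mathcal{I}_{\mathrm{CF}}\mid\Bbbk\in\mathbb{I}^{\mathrm D}(k,d)\}.$$ Equivalently: for every $\mathbb{Q}$-vector space $R$ and every $\mathbb{Q}$-linear map $Z:\mathcal{A}^0_{k,d}\to R$ that vanishes on $\mathcal{A}^0_{k,d}\cap\mathcal{I}_{\mathrm{CF}}$, and for every $\Bbbk\in\mathbb{I}(k,d)$, the element $Z(\tilde w(\Bbbk))$ is a $\mathbb{Z}_{(2)}$-linear combination of the elements $Z(\tilde w(\Bbbk'))$ with $\Bbbk'\in\mathbb{I}^{\mathrm D}(k,d)$. -/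

import Mathlib

open scoped TensorProduct

noncomputable section

namespace Confluence

/-! ### Words and the shuffle product -/

section Words

variable {X : Type}

/-- The monomial `e_{x₁} ⋯ e_{xₙ}` of the free algebra attached to the word `[x₁, …, xₙ]`. -/
def word (w : List X) : FreeAlgebra ℚ X := (w.map (FreeAlgebra.ι ℚ)).prod

@[simp] theorem word_nil : word ([] : List X) = 1 := rfl

@[simp] theorem word_cons (a : X) (w : List X) :
    word (a :: w) = FreeAlgebra.ι ℚ a * word w := by
  simp [word]

theorem word_append (v w : List X) : word (v ++ w) = word v * word w := by
  simp [word]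

theorem basisFreeMonoid_eq_word (w : List X) :
    FreeAlgebra.basisFreeMonoid ℚ X (FreeMonoid.ofList w) = word w := by
  simp [FreeAlgebra.basisFreeMonoid, FreeAlgebra.equivMonoidAlgebraFreeMonoid, word,
    FreeMonoid.lift_apply]

/-- The linear map on the free algebra with prescribed values on the monomials. -/
def onWords {M : Type*} [AddCommGroup M] [Module ℚ M] (f : List X → M) :
    FreeAlgebra ℚ X →ₗ[ℚ] M :=
  (FreeAlgebra.basisFreeMonoid ℚ X).constr ℚ fun w => f (FreeMonoid.toList w)

@[simp] theorem onWords_word {M : Type*} [AddCommGroup M] [Module ℚ M] (f : List X → M)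
    (w : List X) : onWords f (word w) = f w := by
  rw [← basisFreeMonoid_eq_word, onWords, Module.Basis.constr_basis]
  rfl

theorem linearMap_ext_word {M : Type*} [AddCommGroup M] [Module ℚ M]
    {f g : FreeAlgebra ℚ X →ₗ[ℚ] M} (h : ∀ w, f (word w) = g (word w)) : f = g := by
  refine (FreeAlgebra.basisFreeMonoid ℚ X).ext fun w => ?_
  have := h (FreeMonoid.toList w)
  rwa [← basisFreeMonoid_eq_word] at this

/-- The shuffle product of two words:
`(e_a u) ⧢ (e_b v) = e_a (u ⧢ e_b v) + e_b (e_a u ⧢ v)` and `1 ⧢ u = u ⧢ 1 = u`. -/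
def shuffleWords : List X → List X → FreeAlgebra ℚ X
  | [], v => word v
  | a :: u, [] => word (a :: u)
  | a :: u, b :: v =>
    FreeAlgebra.ι ℚ a * shuffleWords u (b :: v) + FreeAlgebra.ι ℚ b * shuffleWords (a :: u) v
termination_by u v => u.length + v.length

/-- The shuffle product, as a bilinear map. -/
def sh : FreeAlgebra ℚ X →ₗ[ℚ] FreeAlgebra ℚ X →ₗ[ℚ] FreeAlgebra ℚ X :=
  onWords fun u => onWords fun v => shuffleWords u v

/-- Reversal of words. -/
def revWords : FreeAlgebra ℚ X →ₗ[ℚ] FreeAlgebra ℚ X := onWords fun w => word w.reverse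

theorem word_singleton (a : X) : word [a] = FreeAlgebra.ι ℚ a := by simp

theorem word_induction {p : FreeAlgebra ℚ X → Prop} (x : FreeAlgebra ℚ X)
    (hw : ∀ w, p (word w)) (hadd : ∀ x y, p x → p y → p (x + y))
    (hsmul : ∀ (c : ℚ) x, p x → p (c • x)) : p x := by
  have hx : x ∈ Submodule.span ℚ (Set.range (FreeAlgebra.basisFreeMonoid ℚ X)) := by
    rw [Module.Basis.span_eq]; trivial
  have h0 : p 0 := by simpa using hsmul 0 _ (hw [])
  induction hx using Submodule.span_induction with
  | mem y hy =>
    obtain ⟨w, rfl⟩ := hy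
    have := hw (FreeMonoid.toList w)
    rwa [← basisFreeMonoid_eq_word] at this
  | zero => exact h0
  | add _ _ _ _ h1 h2 => exact hadd _ _ h1 h2
  | smul c _ _ h => exact hsmul c _ h

theorem sh_word (u v : List X) : sh (word u) (word v) = shuffleWords u v := by
  simp [sh]

theorem sh_one_left (x : FreeAlgebra ℚ X) : sh 1 x = x := by
  induction x using word_induction with
  | hw w => rw [← word_nil, sh_word, shuffleWords]
  | hadd x y hx hy => rw [map_add, hx, hy]
  | hsmul c x hx => rw [map_smul, hx]

theorem sh_one_right (x : FreeAlgebra ℚ X) : sh x 1 = x := by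
  induction x using word_induction with
  | hw w => rw [← word_nil, sh_word]; cases w <;> rw [shuffleWords]
  | hadd x y hx hy => rw [map_add, LinearMap.add_apply, hx, hy]
  | hsmul c x hx => rw [map_smul, LinearMap.smul_apply, hx]

theorem sh_cons_cons (a b : X) (x y : FreeAlgebra ℚ X) :
    sh (FreeAlgebra.ι ℚ a * x) (FreeAlgebra.ι ℚ b * y) =
      FreeAlgebra.ι ℚ a * sh x (FreeAlgebra.ι ℚ b * y) +
        FreeAlgebra.ι ℚ b * sh (FreeAlgebra.ι ℚ a * x) y := by
  induction x using word_induction with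
  | hw u =>
    induction y using word_induction with
    | hw v => simp only [← word_cons, sh_word]; rw [shuffleWords]
    | hadd x y hx hy => simp only [mul_add, map_add, hx, hy]; abel
    | hsmul c x hx => simp only [mul_smul_comm, map_smul, hx, smul_add]
  | hadd x y hx hy => simp only [mul_add, map_add, LinearMap.add_apply, hx, hy]; abel
  | hsmul c x hx =>
    simp only [mul_smul_comm, map_smul, LinearMap.smul_apply, hx, smul_add]

theorem sh_comm (x y : FreeAlgebra ℚ X) : sh x y = sh y x := by
  have key : ∀ n, ∀ u v : List X, u.length + v.length = n →
      sh (word u) (word v) = sh (word v) (word u) := by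
    intro n
    induction n with
    | zero =>
      intro u v h
      have hu : u = [] := List.length_eq_zero_iff.1 (by omega)
      have hv : v = [] := List.length_eq_zero_iff.1 (by omega)
      rw [hu, hv]
    | succ n ih =>
      intro u v h
      match u, v with
      | [], v => rw [word_nil, sh_one_left, sh_one_right]
      | a :: u, [] => rw [word_nil, sh_one_left, sh_one_right]
      | a :: u, b :: v =>
        have h1 := ih u (b :: v) (by simp at h ⊢; omega)
        have h2 := ih (a :: u) v (by simp at h ⊢; omega)
        simp only [word_cons] at h1 h2 ⊢
        rw [sh_cons_cons, sh_cons_cons, h1, h2, add_comm]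
  induction x using word_induction with
  | hw u =>
    induction y using word_induction with
    | hw v => exact key _ u v rfl
    | hadd x y hx hy => simp only [map_add, LinearMap.add_apply, hx, hy]
    | hsmul c x hx => simp only [map_smul, LinearMap.smul_apply, hx]
  | hadd x y hx hy => simp only [map_add, LinearMap.add_apply, hx, hy]
  | hsmul c x hx => simp only [map_smul, LinearMap.smul_apply, hx]

theorem sh_assoc (x y z : FreeAlgebra ℚ X) : sh (sh x y) z = sh x (sh y z) := by
  have key : ∀ n, ∀ u v w : List X, u.length + v.length + w.length = n →
      sh (sh (word u) (word v)) (word w) = sh (word u) (sh (word v) (word w)) := by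
    intro n
    induction n with
    | zero =>
      intro u v w h
      have hu : u = [] := List.length_eq_zero_iff.1 (by omega)
      have hv : v = [] := List.length_eq_zero_iff.1 (by omega)
      rw [hu, hv, word_nil, sh_one_left, sh_one_left, sh_one_left]
    | succ n ih =>
      intro u v w h
      match u, v, w with
      | [], v, w => rw [word_nil, sh_one_left, sh_one_left]
      | a :: u, [], w => rw [word_nil, sh_one_left, sh_one_right]
      | a :: u, b :: v, [] => rw [word_nil, sh_one_right, sh_one_right]
      | a :: u, b :: v, c :: w =>
        have h1 := ih u (b :: v) (c :: w) (by simp at h ⊢; omega)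
        have h2 := ih (a :: u) v (c :: w) (by simp at h ⊢; omega)
        have h3 := ih (a :: u) (b :: v) w (by simp at h ⊢; omega)
        simp only [word_cons] at h1 h2 h3 ⊢
        simp only [sh_cons_cons, map_add, LinearMap.add_apply] at h1 h2 h3 ⊢
        rw [h1, h2]
        simp only [mul_add] at h1 h2 h3 ⊢
        have h4 := congrArg (fun t => FreeAlgebra.ι ℚ c * t) h3
        simp only [mul_add] at h4
        linear_combination (norm := abel) h4
  induction x using word_induction with
  | hw u =>
    induction y using word_induction with
    | hw v =>
      induction z using word_induction with
      | hw w => exact key _ u v w rfl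
      | hadd x y hx hy => simp only [map_add, hx, hy]
      | hsmul c x hx => simp only [map_smul, hx]
    | hadd x y hx hy => simp only [map_add, LinearMap.add_apply, hx, hy]
    | hsmul c x hx => simp only [map_smul, LinearMap.smul_apply, hx]
  | hadd x y hx hy => simp only [map_add, LinearMap.add_apply, hx, hy]
  | hsmul c x hx => simp only [map_smul, LinearMap.smul_apply, hx]

theorem sh_snoc_snoc (a b : X) (x y : FreeAlgebra ℚ X) :
    sh (x * FreeAlgebra.ι ℚ a) (y * FreeAlgebra.ι ℚ b) =
      sh x (y * FreeAlgebra.ι ℚ b) * FreeAlgebra.ι ℚ a +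
        sh (x * FreeAlgebra.ι ℚ a) y * FreeAlgebra.ι ℚ b := by
  have cons_one : ∀ (c d : X) (t : FreeAlgebra ℚ X),
      sh (FreeAlgebra.ι ℚ c) (FreeAlgebra.ι ℚ d * t) =
        FreeAlgebra.ι ℚ c * (FreeAlgebra.ι ℚ d * t) +
          FreeAlgebra.ι ℚ d * sh (FreeAlgebra.ι ℚ c) t := fun c d t => by
    have := sh_cons_cons c d 1 t
    rwa [mul_one, sh_one_left] at this
  have key : ∀ n, ∀ u v : List X, u.length + v.length = n →
      sh (word u * FreeAlgebra.ι ℚ a) (word v * FreeAlgebra.ι ℚ b) =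
        sh (word u) (word v * FreeAlgebra.ι ℚ b) * FreeAlgebra.ι ℚ a +
          sh (word u * FreeAlgebra.ι ℚ a) (word v) * FreeAlgebra.ι ℚ b := by
    intro n
    induction n with
    | zero =>
      intro u v h
      have hu : u = [] := List.length_eq_zero_iff.1 (by omega)
      have hv : v = [] := List.length_eq_zero_iff.1 (by omega)
      subst hu hv
      have := cons_one a b 1
      rw [mul_one, sh_one_right] at this
      simp only [word_nil, one_mul, sh_one_left, sh_one_right, this]
      abel
    | succ n ih =>
      intro u v h
      match u, v with
      | [], [] => simp at h
      | [], d :: v =>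
        have h1 := ih [] v (by simp at h ⊢; omega)
        simp only [word_cons, word_nil, one_mul, sh_one_left, mul_assoc] at h1 ⊢
        rw [cons_one, cons_one, h1]
        simp only [mul_add, add_mul, mul_assoc]
        abel
      | c :: u, [] =>
        have h1 := ih u [] (by simp at h ⊢; omega)
        simp only [word_cons, word_nil, one_mul, sh_one_right, mul_assoc] at h1 ⊢
        rw [sh_comm, cons_one, sh_comm (FreeAlgebra.ι ℚ b), h1,
          sh_comm (FreeAlgebra.ι ℚ c * word u), cons_one, sh_comm (FreeAlgebra.ι ℚ b) (word u)]
        simp only [mul_add, add_mul, mul_assoc]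
        abel
      | c :: u, d :: v =>
        have h1 := ih u (d :: v) (by simp at h ⊢; omega)
        have h2 := ih (c :: u) v (by simp at h ⊢; omega)
        simp only [word_cons, mul_assoc] at h1 h2 ⊢
        rw [sh_cons_cons, h1, h2, sh_cons_cons, sh_cons_cons]
        simp only [mul_add, add_mul, mul_assoc]
        abel
  induction x using word_induction with
  | hw u =>
    induction y using word_induction with
    | hw v => exact key _ u v rfl
    | hadd x y hx hy => simp only [add_mul, map_add, hx, hy]; abel
    | hsmul c x hx => simp only [smul_mul_assoc, map_smul, hx, smul_add]
  | hadd x y hx hy => simp only [add_mul, map_add, LinearMap.add_apply, hx, hy]; abel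
  | hsmul c x hx =>
    simp only [smul_mul_assoc, map_smul, LinearMap.smul_apply, hx, smul_add]

theorem revWords_word (w : List X) : revWords (word w) = word w.reverse := by
  simp [revWords]

theorem revWords_one : revWords (1 : FreeAlgebra ℚ X) = 1 := by
  rw [← word_nil, revWords_word, List.reverse_nil]

theorem revWords_cons (a : X) (x : FreeAlgebra ℚ X) :
    revWords (FreeAlgebra.ι ℚ a * x) = revWords x * FreeAlgebra.ι ℚ a := by
  induction x using word_induction with
  | hw w => rw [← word_cons, revWords_word, revWords_word]; simp [word_append]
  | hadd x y hx hy => simp only [mul_add, add_mul, map_add, hx, hy]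
  | hsmul c x hx => simp only [mul_smul_comm, smul_mul_assoc, map_smul, hx]

theorem revWords_revWords (x : FreeAlgebra ℚ X) : revWords (revWords x) = x := by
  induction x using word_induction with
  | hw w => simp [revWords_word]
  | hadd x y hx hy => simp only [map_add, hx, hy]
  | hsmul c x hx => simp only [map_smul, hx]

theorem revWords_sh (x y : FreeAlgebra ℚ X) :
    revWords (sh x y) = sh (revWords x) (revWords y) := by
  have key : ∀ n, ∀ u v : List X, u.length + v.length = n →
      revWords (sh (word u) (word v)) = sh (revWords (word u)) (revWords (word v)) := by
    intro n
    induction n with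
    | zero =>
      intro u v h
      have hu : u = [] := List.length_eq_zero_iff.1 (by omega)
      have hv : v = [] := List.length_eq_zero_iff.1 (by omega)
      subst hu hv
      rw [word_nil, revWords_one, sh_one_left, revWords_one]
    | succ n ih =>
      intro u v h
      match u, v with
      | [], v => simp only [revWords_one, word_nil, sh_one_left]
      | a :: u, [] => simp only [revWords_one, word_nil, sh_one_right]
      | a :: u, b :: v =>
        have h1 := ih u (b :: v) (by simp at h ⊢; omega)
        have h2 := ih (a :: u) v (by simp at h ⊢; omega)
        simp only [word_cons] at h1 h2 ⊢
        rw [sh_cons_cons, map_add, revWords_cons, revWords_cons, h1, h2, revWords_cons,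
          revWords_cons, sh_snoc_snoc]
  induction x using word_induction with
  | hw u =>
    induction y using word_induction with
    | hw v => exact key _ u v rfl
    | hadd x y hx hy => simp only [map_add, hx, hy]
    | hsmul c x hx => simp only [map_smul, hx]
  | hadd x y hx hy => simp only [map_add, LinearMap.add_apply, hx, hy]
  | hsmul c x hx => simp only [map_smul, LinearMap.smul_apply, hx]

theorem sh_letter_replicate (a : X) (n : ℕ) :
    sh (FreeAlgebra.ι ℚ a) (word (List.replicate n a)) =
      ((n : ℚ) + 1) • word (List.replicate (n + 1) a) := by
  induction n with
  | zero => simp [sh_one_right]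
  | succ n ih =>
    have h := sh_cons_cons a a 1 (word (List.replicate n a))
    rw [mul_one, sh_one_left, ih, ← word_cons, ← List.replicate_succ, mul_smul_comm, ← word_cons]
      at h
    rw [h, List.replicate_succ (n := n + 1)]
    push_cast
    module

/-- Splitting `p e_z v` along the deconcatenations `p = p₁ p₂`:
`∑ (-1)^{|p₂|} p₁ ⊗ p₂^{rev}` is a convolution inverse in the shuffle algebra. -/
theorem sum_take_sh_drop_reverse (p : List X) (hp : p ≠ []) :
    ∑ j ∈ Finset.range (p.length + 1),
      (-1 : ℚ) ^ (p.length - j) • sh (word (p.take j)) (word (p.drop j).reverse) = 0 := by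
  have key : ∀ n, n < p.length → ∑ j ∈ Finset.range (n + 1),
      (-1 : ℚ) ^ (p.length - j) • sh (word (p.take j)) (word (p.drop j).reverse) =
        (-1 : ℚ) ^ (p.length - n) • (sh (word (p.take n)) (word (p.drop (n + 1)).reverse) *
          FreeAlgebra.ι ℚ (p.getD n (p.head hp))) := by
    intro n
    induction n with
    | zero =>
      intro hn
      match p with
      | a :: p => simp [sh_one_left, word_append]
    | succ n ih =>
      intro hn
      rw [Finset.sum_range_succ, ih (by omega)]
      have h1 : p.take (n + 1) = p.take n ++ [p.getD n (p.head hp)] := by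
        rw [List.take_succ_eq_append_getElem (by omega), List.getD_eq_getElem]
      have h2 : (p.drop (n + 1)).reverse =
          (p.drop (n + 2)).reverse ++ [p.getD (n + 1) (p.head hp)] := by
        rw [List.drop_eq_getElem_cons hn, List.reverse_cons, List.getD_eq_getElem]
      simp only [h1, h2, word_append, word_singleton]
      rw [sh_snoc_snoc]
      have h3 : p.length - n = p.length - (n + 1) + 1 := by omega
      rw [h3, pow_succ]
      module
  have hl : 0 < p.length := List.length_pos_iff.2 hp
  obtain ⟨m, hm⟩ : ∃ m, p.length = m + 1 := ⟨p.length - 1, by omega⟩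
  rw [Finset.sum_range_succ]
  have h := key m (by omega)
  have hr : p.length = m + 1 := hm
  conv_lhs => rw [show Finset.range p.length = Finset.range (m + 1) by rw [hm]]
  rw [h]
  have h1 : p.take (m + 1) = p.take m ++ [p.getD m (p.head hp)] := by
    rw [List.take_succ_eq_append_getElem (by omega), List.getD_eq_getElem]
  rw [hm, List.drop_eq_nil_of_le (by omega : p.length ≤ m + 1), h1]
  simp [sh_one_right, word_append]

/-- The decomposition of `p e_z v` with respect to the prefixes of `p`. -/
theorem sum_sh_take (p : List X) (z : X) (y : FreeAlgebra ℚ X) :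
    ∑ j ∈ Finset.range (p.length + 1), (-1 : ℚ) ^ (p.length - j) •
      sh (FreeAlgebra.ι ℚ z * sh (word (p.drop j).reverse) y) (word (p.take j)) =
        word p * (FreeAlgebra.ι ℚ z * y) := by
  induction p with
  | nil => simp [sh_one_left, sh_one_right]
  | cons a p ih =>
    have h := sum_take_sh_drop_reverse (a :: p) (List.cons_ne_nil a p)
    rw [Finset.sum_range_succ'] at h ⊢
    simp only [List.take_succ_cons, List.drop_succ_cons, List.length_cons, Nat.add_sub_add_right,
      Nat.sub_zero, List.take_zero, List.drop_zero, word_nil, word_cons, sh_one_right,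
      sh_one_left] at h ⊢
    simp only [sh_cons_cons, smul_add, Finset.sum_add_distrib, ← mul_smul_comm, ← Finset.mul_sum,
      ih, mul_assoc]
    have h' := congrArg (fun t => FreeAlgebra.ι ℚ z * sh t y) h
    simp only [map_add, map_sum, LinearMap.add_apply, LinearMap.sum_apply, map_smul,
      LinearMap.smul_apply, map_zero, LinearMap.zero_apply, mul_zero, mul_add] at h'
    have e : ∀ j, sh (sh (word (p.drop j).reverse) y) (FreeAlgebra.ι ℚ a * word (p.take j)) =
        sh (sh (FreeAlgebra.ι ℚ a * word (p.take j)) (word (p.drop j).reverse)) y := fun j => by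
      rw [sh_comm, sh_assoc]
    simp only [e]
    linear_combination (norm := skip) h'
    abel

variable [DecidableEq X]

/-- Removal of a leading letter `e_a`: it maps `e_a w` to `w`, and every monomial which does not
begin with `e_a` to `0`. -/
def leftDel (a : X) : FreeAlgebra ℚ X →ₗ[ℚ] FreeAlgebra ℚ X :=
  onWords fun w =>
    match w with
    | [] => 0
    | x :: v => if x = a then word v else 0

/-- Shuffle regularization at the beginning of a word:
`w ↦ ∑ₙ (-1)ⁿ e_aⁿ ⧢ Dⁿ w`, where `D` removes a leading letter `e_a`. -/
def regLeft (a : X) : FreeAlgebra ℚ X →ₗ[ℚ] FreeAlgebra ℚ X :=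
  onWords fun w => ∑ n ∈ Finset.range (w.length + 1),
    (-1 : ℚ) ^ n • sh (word (List.replicate n a)) ((leftDel a ^ n) (word w))

/-- The shuffle regularization with respect to `e_a` at the beginning and `e_b` at the
end of a word. For `a ≠ b` it is the linear map characterized by `shReg_shuffle`: the element
`e_aⁿ ⧢ e_bᵐ ⧢ u` is mapped to `u` if `n = m = 0` and to `0` otherwise, for all `u` in the span of
the words which do not begin with `e_a` and do not end with `e_b`. -/
def shReg (a b : X) : FreeAlgebra ℚ X →ₗ[ℚ] FreeAlgebra ℚ X :=
  revWords ∘ₗ regLeft b ∘ₗ revWords ∘ₗ regLeft a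

theorem leftDel_one (a : X) : leftDel a 1 = 0 := by
  rw [← word_nil, leftDel, onWords_word]

theorem leftDel_cons (a b : X) (x : FreeAlgebra ℚ X) :
    leftDel a (FreeAlgebra.ι ℚ b * x) = if b = a then x else 0 := by
  induction x using word_induction with
  | hw w => rw [← word_cons, leftDel, onWords_word]
  | hadd x y hx hy => rw [mul_add, map_add, hx, hy]; split_ifs <;> simp
  | hsmul c x hx => rw [mul_smul_comm, map_smul, hx]; split_ifs <;> simp

theorem leftDel_sh (a : X) (x y : FreeAlgebra ℚ X) :
    leftDel a (sh x y) = sh (leftDel a x) y + sh x (leftDel a y) := by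
  induction x using word_induction with
  | hw u =>
    induction y using word_induction with
    | hw v =>
      match u, v with
      | [], v => simp [leftDel_one, sh_one_left]
      | b :: u, [] => simp [leftDel_one, sh_one_right]
      | b :: u, c :: v =>
        simp only [word_cons]
        rw [sh_cons_cons, map_add]
        simp only [leftDel_cons]
        split_ifs <;> simp
    | hadd x y hx hy => simp only [map_add, hx, hy]; abel
    | hsmul c x hx => simp only [map_smul, hx, smul_add]
  | hadd x y hx hy => simp only [map_add, LinearMap.add_apply, hx, hy]; abel
  | hsmul c x hx => simp only [map_smul, LinearMap.smul_apply, hx, smul_add]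

theorem leftDel_pow_word_eq_zero (a : X) (w : List X) (n : ℕ) (h : w.length < n) :
    (leftDel a ^ n) (word w) = 0 := by
  induction n generalizing w with
  | zero => omega
  | succ n ih =>
    rw [pow_succ, Module.End.mul_apply]
    match w with
    | [] => rw [word_nil, leftDel_one, map_zero]
    | b :: w =>
      rw [word_cons, leftDel_cons]
      split_ifs
      · exact ih w (by simp at h; omega)
      · exact map_zero _

/-- All sufficiently long truncations of the sum that defines `regLeft` agree with it. -/
theorem regLeft_eventually (a : X) (x : FreeAlgebra ℚ X) : ∃ N₀, ∀ N, N₀ ≤ N →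
    (leftDel a ^ N) x = 0 ∧ regLeft a x = ∑ n ∈ Finset.range (N + 1),
      (-1 : ℚ) ^ n • sh (word (List.replicate n a)) ((leftDel a ^ n) x) := by
  induction x using word_induction with
  | hw w =>
    refine ⟨w.length + 1, fun N hN => ⟨leftDel_pow_word_eq_zero a w N (by omega), ?_⟩⟩
    rw [regLeft, onWords_word]
    refine Finset.sum_subset (Finset.range_subset_range.2 (by omega)) fun n _ hn => ?_
    rw [leftDel_pow_word_eq_zero a w n (by simp at hn; omega), map_zero, smul_zero]
  | hadd x y hx hy =>
    obtain ⟨N₁, h₁⟩ := hx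
    obtain ⟨N₂, h₂⟩ := hy
    refine ⟨max N₁ N₂, fun N hN => ?_⟩
    obtain ⟨h1, h1'⟩ := h₁ N (le_trans (le_max_left _ _) hN)
    obtain ⟨h2, h2'⟩ := h₂ N (le_trans (le_max_right _ _) hN)
    refine ⟨by rw [map_add, h1, h2, add_zero], ?_⟩
    simp only [map_add, smul_add, Finset.sum_add_distrib, h1', h2']
  | hsmul c x hx =>
    obtain ⟨N₁, h₁⟩ := hx
    refine ⟨N₁, fun N hN => ?_⟩
    obtain ⟨h1, h1'⟩ := h₁ N hN
    refine ⟨by rw [map_smul, h1, smul_zero], ?_⟩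
    simp only [map_smul, Finset.smul_sum, h1', smul_comm c]

theorem regLeft_of_leftDel_eq_zero (a : X) (x : FreeAlgebra ℚ X) (h : leftDel a x = 0) :
    regLeft a x = x := by
  obtain ⟨N, hN⟩ := regLeft_eventually a x
  rw [(hN N le_rfl).2, Finset.sum_range_succ', Finset.sum_eq_zero]
  · simp [sh_one_left]
  · intro n _
    rw [pow_succ (leftDel a), Module.End.mul_apply, h, map_zero, map_zero, smul_zero]

theorem leftDel_pow_sh_letter (a : X) (n : ℕ) (x : FreeAlgebra ℚ X) :
    (leftDel a ^ (n + 1)) (sh (FreeAlgebra.ι ℚ a) x) =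
      sh (FreeAlgebra.ι ℚ a) ((leftDel a ^ (n + 1)) x) + ((n : ℚ) + 1) • (leftDel a ^ n) x := by
  have h1 : ∀ y : FreeAlgebra ℚ X, leftDel a (sh (FreeAlgebra.ι ℚ a) y) =
      sh (FreeAlgebra.ι ℚ a) (leftDel a y) + y := fun y => by
    have h := leftDel_cons a a 1
    rw [mul_one, if_pos rfl] at h
    rw [leftDel_sh, h, sh_one_left, add_comm]
  induction n with
  | zero => simp [h1]
  | succ n ih =>
    rw [pow_succ', Module.End.mul_apply, ih, map_add, h1, map_smul]
    simp only [← Module.End.mul_apply, ← pow_succ']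
    push_cast
    module

theorem regLeft_sh_letter (a : X) (x : FreeAlgebra ℚ X) :
    regLeft a (sh (FreeAlgebra.ι ℚ a) x) = 0 := by
  have key : ∀ N : ℕ, ∑ n ∈ Finset.range (N + 1), (-1 : ℚ) ^ n • sh (word (List.replicate n a))
      ((leftDel a ^ n) (sh (FreeAlgebra.ι ℚ a) x)) =
      ((-1 : ℚ) ^ N * ((N : ℚ) + 1)) • sh (word (List.replicate (N + 1) a))
        ((leftDel a ^ N) x) := by
    have hs : ∀ (n : ℕ) (y : FreeAlgebra ℚ X),
        sh (word (List.replicate n a)) (sh (FreeAlgebra.ι ℚ a) y) =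
          ((n : ℚ) + 1) • sh (word (List.replicate (n + 1) a)) y := fun n y => by
      rw [← sh_assoc, sh_comm (word _), sh_letter_replicate, map_smul, LinearMap.smul_apply]
    intro N
    induction N with
    | zero => simp [sh_one_left]
    | succ N ih =>
      rw [Finset.sum_range_succ, ih, leftDel_pow_sh_letter, map_add, hs, map_smul]
      push_cast
      module
  obtain ⟨N₁, h₁⟩ := regLeft_eventually a (sh (FreeAlgebra.ι ℚ a) x)
  obtain ⟨N₂, h₂⟩ := regLeft_eventually a x
  rw [(h₁ (max N₁ N₂) (le_max_left _ _)).2, key, (h₂ (max N₁ N₂) (le_max_right _ _)).1, map_zero,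
    smul_zero]

theorem regLeft_sh_replicate (a : X) (n : ℕ) (x : FreeAlgebra ℚ X) :
    regLeft a (sh (word (List.replicate (n + 1) a)) x) = 0 := by
  have h : word (List.replicate (n + 1) a) =
      ((n : ℚ) + 1)⁻¹ • sh (FreeAlgebra.ι ℚ a) (word (List.replicate n a)) := by
    rw [sh_letter_replicate, smul_smul, inv_mul_cancel₀ (by positivity), one_smul]
  rw [h, map_smul, LinearMap.smul_apply, sh_assoc, map_smul, regLeft_sh_letter, smul_zero]

theorem leftDel_word_eq_zero (a : X) (w : List X) (h : w.head? ≠ some a) :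
    leftDel a (word w) = 0 := by
  match w with
  | [] => rw [word_nil, leftDel_one]
  | b :: w => rw [word_cons, leftDel_cons, if_neg (by simpa using h)]

theorem shReg_shuffle (a b : X) (hab : a ≠ b) (n m : ℕ) (w : List X) (hw : w.head? ≠ some a)
    (hw' : w.getLast? ≠ some b) :
    shReg a b (sh (word (List.replicate n a)) (sh (word (List.replicate m b)) (word w))) =
      if n = 0 ∧ m = 0 then word w else 0 := by
  simp only [shReg, LinearMap.comp_apply]
  match n with
  | n + 1 => simp [regLeft_sh_replicate]
  | 0 =>
    have h0 : leftDel a (word (List.replicate m b)) = 0 := by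
      cases m with
      | zero => exact leftDel_one a
      | succ m => rw [List.replicate_succ, word_cons, leftDel_cons, if_neg hab.symm]
    rw [List.replicate_zero, word_nil, sh_one_left, regLeft_of_leftDel_eq_zero a _ (by
      rw [leftDel_sh, h0, leftDel_word_eq_zero a w hw]; simp), revWords_sh]
    match m with
    | m + 1 =>
      rw [revWords_word, List.reverse_replicate, regLeft_sh_replicate]
      simp
    | 0 =>
      rw [List.replicate_zero, word_nil, revWords_one, sh_one_left, revWords_word,
        regLeft_of_leftDel_eq_zero b _ (leftDel_word_eq_zero b _ (by simpa using hw')),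
        revWords_word]
      simp

end Words

/-! ### Alphabets and letter substitutions -/

/-- The alphabet `{0, 1}`. -/
inductive L2
  | zero
  | one
  deriving DecidableEq

/-- The alphabet `{0, 1, -1}`. -/
inductive L3
  | zero
  | one
  | neg
  deriving DecidableEq

/-- The alphabet `{0, -1, z, -z²}`. -/
inductive LB
  | zero
  | neg
  | z
  | negSq
  deriving DecidableEq

instance : Fintype L3 := ⟨{L3.zero, L3.one, L3.neg}, fun x => by cases x <;> decide⟩

/-- The letters of `{0, 1, -1}` as rational numbers. -/
def L3.val : L3 → ℚ
  | .zero => 0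
  | .one => 1
  | .neg => -1

/-- The letters of `{0, -1, z, -z²}` as polynomials in `z`. -/
def LB.poly : LB → Polynomial ℚ
  | .zero => 0
  | .neg => -1
  | .z => Polynomial.X
  | .negSq => -Polynomial.X ^ 2

/-- `ℚ ⊗ 𝒜({0,1})`. -/
abbrev A2 := FreeAlgebra ℚ L2

/-- `ℚ ⊗ 𝒜({0,1,-1})`. -/
abbrev A3 := FreeAlgebra ℚ L3

/-- `ℚ⟨e_0, e_{-1}, e_z, e_{-z²}⟩`. -/
abbrev AB := FreeAlgebra ℚ LB

/-- The ring homomorphism `dist`: `e_0 ↦ 2 e_0`, `e_1 ↦ e_1 + e_{-1}`. -/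
def dist : A2 →ₐ[ℚ] A3 := FreeAlgebra.lift ℚ fun
  | .zero => 2 * FreeAlgebra.ι ℚ L3.zero
  | .one => FreeAlgebra.ι ℚ L3.one + FreeAlgebra.ι ℚ L3.neg

/-- The automorphism `ϱ`: `e_0 ↦ e_0 - e_1`, `e_1 ↦ -e_1`. -/
def rho : A2 →ₐ[ℚ] A2 := FreeAlgebra.lift ℚ fun
  | .zero => FreeAlgebra.ι ℚ L2.zero - FreeAlgebra.ι ℚ L2.one
  | .one => -FreeAlgebra.ι ℚ L2.one

/-- The anti-automorphism `ς`: `e_0 ↦ -e_1`, `e_1 ↦ -e_0`. -/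
def sig : A2 →ₗ[ℚ] A2 :=
  (FreeAlgebra.lift ℚ fun
    | L2.zero => -FreeAlgebra.ι ℚ L2.one
    | L2.one => -FreeAlgebra.ι ℚ L2.zero).toLinearMap ∘ₗ revWords

/-! ### The map `℘` -/

/-- The word `e_1 e_0^{k₁-1} ⋯ e_1 e_0^{k_d-1}`, for positive integers `k₁, …, k_d`. -/
def posWord (ks : List ℕ) : List L2 :=
  ks.flatMap fun k => L2.one :: List.replicate (k - 1) L2.zero

/-- `θ(k₁,…,k_d) = -∑_{j=1}^d e_1 e_0^{k_j-1} ⋯ e_1 e_0^{k₁-1} ⧢ θ(k_{j+1},…,k_d)` for `d > 0`,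
and `θ(∅) = 1`. -/
def theta : List ℕ → A2
  | [] => 1
  | k :: ks => -∑ j : Fin (ks.length + 1),
      sh (word (posWord (k :: ks.take j).reverse)) (theta (ks.drop j))
termination_by ks => ks.length

/-- The composite `dist ∘ reg_⧢ ∘ ς ∘ θ`. -/
def thetaDist (ks : List ℕ) : A3 := dist (shReg L2.zero L2.one (sig (theta ks)))

/-- With `θ₀ = dist ∘ reg_⧢ ∘ ς ∘ θ`:
`θ₁(𝕜) = θ₀(𝕜) + 2 ∑ e_{-1} e_0^{2m-1} ⧢ θ₀(𝕜₀)`, the sum being over all `m ≥ 1` and `𝕜₀` such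
that `𝕜 = (𝕜₀, {1}^{2m})`. -/
def theta1 (ks : List ℕ) : A3 :=
  thetaDist ks + 2 * ∑ m ∈ (Finset.Icc 1 ks.length).filter
    (fun m => List.replicate (2 * m) 1 <:+ ks),
      sh (word (L3.neg :: List.replicate (2 * m - 1) L3.zero))
        (thetaDist (ks.take (ks.length - 2 * m)))

/-- `w⋆(k₁,…,k_d) = -e_1 e_0^{k₁-1} (e_0-e_1) e_0^{k₂-1} ⋯ (e_0-e_1) e_0^{k_d-1}`, `w⋆(∅) = 1`. -/
def wordStar : List ℕ → A2
  | [] => 1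
  | k :: ks => -FreeAlgebra.ι ℚ L2.one * FreeAlgebra.ι ℚ L2.zero ^ (k - 1) *
      (ks.map fun l => (FreeAlgebra.ι ℚ L2.zero - FreeAlgebra.ι ℚ L2.one) *
        FreeAlgebra.ι ℚ L2.zero ^ (l - 1)).prod

/-- The ring automorphism `e_0 ↦ e_0`, `e_1 ↦ e_0 - e_1`. -/
def flipTail : A2 →ₐ[ℚ] A2 := FreeAlgebra.lift ℚ fun
  | .zero => FreeAlgebra.ι ℚ L2.zero
  | .one => FreeAlgebra.ι ℚ L2.zero - FreeAlgebra.ι ℚ L2.one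

/-- The index `(k₁,…,k_d)`, `d ≥ 1`, such that the given word is
`e_1^{k₁-1} e_0 e_1^{k₂-1} ⋯ e_0 e_1^{k_d-1}`. -/
def runs : List L2 → List ℕ
  | [] => [1]
  | .one :: t => (runs t).modifyHead (· + 1)
  | .zero :: t => 1 :: runs t

/-- The linear map `℘` on `𝒞 = ℚ ⊕ e_1 ℚ⟨e_0,e_1⟩`, extended by `0` to the words which begin with
`e_0`. It is characterized by `℘(ϱ(w⋆(𝕜))) = θ₁(𝕜)` (see `wp_rho_wordStar`), where the elements
`ϱ(w⋆(k₁,…,k_d)) = e_1 (e_0-e_1)^{k₁-1} e_0 (e_0-e_1)^{k₂-1} ⋯ e_0 (e_0-e_1)^{k_d-1}`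
form a basis of `𝒞`: the coordinates of `e_1 t` in this basis are the coefficients of
`flipTail t`. -/
def wp : A2 →ₗ[ℚ] A3 := onWords fun
  | [] => 1
  | .one :: t => onWords (fun s => theta1 (runs s)) (flipTail (word t))
  | .zero :: _ => 0

theorem wp_one_mul (x : A2) : wp (FreeAlgebra.ι ℚ L2.one * x) =
    onWords (fun s => theta1 (runs s)) (flipTail x) := by
  induction x using word_induction with
  | hw w => rw [← word_cons, wp, onWords_word]
  | hadd x y hx hy => simp only [mul_add, map_add, hx, hy]
  | hsmul c x hx => simp only [mul_smul_comm, map_smul, hx]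

theorem runs_replicate_append (n : ℕ) (t : List L2) (k : ℕ) (ks : List ℕ) (h : runs t = k :: ks) :
    runs (List.replicate n L2.one ++ t) = (k + n) :: ks := by
  induction n with
  | zero => simpa using h
  | succ n ih => rw [List.replicate_succ, List.cons_append, runs, ih]; simp [add_assoc]

theorem runs_flatMap (ks : List ℕ) (hks : ∀ k ∈ ks, 1 ≤ k) :
    runs (ks.flatMap fun l => L2.zero :: List.replicate (l - 1) L2.one) = 1 :: ks := by
  induction ks with
  | nil => rfl
  | cons k ks ih =>
    rw [List.flatMap_cons, List.cons_append, runs, runs_replicate_append _ _ _ _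
      (ih fun l hl => hks l (List.mem_cons_of_mem _ hl))]
    have := hks k List.mem_cons_self
    rw [show 1 + (k - 1) = k by omega]

theorem wp_rho_wordStar (ks : List ℕ) (hks : ∀ k ∈ ks, 1 ≤ k) :
    wp (rho (wordStar ks)) = theta1 ks := by
  have ho : ∀ n, FreeAlgebra.ι ℚ L2.one ^ n = word (List.replicate n L2.one) := fun n => by
    simp [word]
  match ks with
  | [] =>
    have h1 : shReg L2.zero L2.one 1 = 1 := by
      have := shReg_shuffle L2.zero L2.one (by decide) 0 0 [] (by simp) (by simp)
      simpa [sh_one_left] using this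
    have h2 : wp 1 = 1 := by rw [← word_nil, wp, onWords_word]
    have h3 : theta [] = 1 := by rw [theta]
    have h4 : sig 1 = 1 := by rw [sig, LinearMap.comp_apply, revWords_one]; simp
    rw [wordStar, map_one, h2]
    simp [theta1, thetaDist, h1, h3, h4]
  | k :: ks =>
    have h : rho (wordStar (k :: ks)) = FreeAlgebra.ι ℚ L2.one *
        flipTail (word (List.replicate (k - 1) L2.one ++
          ks.flatMap fun l => L2.zero :: List.replicate (l - 1) L2.one)) := by
      have hz : rho (FreeAlgebra.ι ℚ L2.zero) = flipTail (FreeAlgebra.ι ℚ L2.one) := by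
        simp [rho, flipTail]
      have hzo : rho (FreeAlgebra.ι ℚ L2.zero - FreeAlgebra.ι ℚ L2.one) =
          flipTail (FreeAlgebra.ι ℚ L2.zero) := by
        simp [rho, flipTail]
      have hl : rho (ks.map fun l => (FreeAlgebra.ι ℚ L2.zero - FreeAlgebra.ι ℚ L2.one) *
          FreeAlgebra.ι ℚ L2.zero ^ (l - 1)).prod =
          flipTail (word (ks.flatMap fun l => L2.zero :: List.replicate (l - 1) L2.one)) := by
        clear hks
        induction ks with
        | nil => simp
        | cons l ks ih =>
          rw [List.map_cons, List.prod_cons, map_mul, ih, map_mul, map_pow, hzo, hz,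
            List.flatMap_cons, word_append, word_cons, ← ho, map_mul, map_mul, map_pow]
      have hone : rho (-FreeAlgebra.ι ℚ L2.one) = FreeAlgebra.ι ℚ L2.one := by simp [rho]
      rw [wordStar, map_mul, map_mul, map_pow, hz, hl, hone, word_append, ← ho, map_mul, map_pow,
        mul_assoc]
    have hf : ∀ x, flipTail (flipTail x) = x := fun x => by
      have : flipTail.comp flipTail = AlgHom.id ℚ A2 := by
        ext a
        cases a <;> simp [flipTail]
      exact congrArg (fun f : A2 →ₐ[ℚ] A2 => f x) this
    rw [h, wp_one_mul, hf, onWords_word, runs_replicate_append _ _ _ _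
      (runs_flatMap ks fun l hl => hks l (List.mem_cons_of_mem _ hl))]
    have := hks k List.mem_cons_self
    rw [show 1 + (k - 1) = k by omega]

/-! ### The regularized limit at `z = 0` -/

/-- The inverse of the isomorphism `ℬ₁ ⊗ ℬ₂ → ℬ₀`, `u₁ ⊗ u₂ ↦ u₁ ⧢ u₂` (see `shuffle_splitWord`).
Here `ℬ₀` is spanned by the words in `0, z, -z²` which do not begin with `0` and do not end with
`z`, `ℬ₁` by those among them which are empty or begin with `z`, and `ℬ₂` by those without the
letter `z`. For a word `p e_z v` with no `z` in `p` it is given by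
`∑_{p = p₁ p₂} (-1)^{|p₂|} e_z (p₂^{rev} ⧢ v) ⊗ p₁`. -/
def splitWord (w : List LB) : AB ⊗[ℚ] AB :=
  match w.dropWhile (· ≠ LB.z) with
  | [] => 1 ⊗ₜ word w
  | _ :: v => ∑ j ∈ Finset.range ((w.takeWhile (· ≠ LB.z)).length + 1),
      (-1 : ℚ) ^ ((w.takeWhile (· ≠ LB.z)).length - j) •
        ((FreeAlgebra.ι ℚ LB.z * sh (word ((w.takeWhile (· ≠ LB.z)).drop j).reverse) (word v)) ⊗ₜ
          word ((w.takeWhile (· ≠ LB.z)).take j))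

theorem shuffle_splitWord (w : List LB) : TensorProduct.lift sh (splitWord w) = word w := by
  have hw := List.takeWhile_append_dropWhile (p := fun x => decide (x ≠ LB.z)) (l := w)
  unfold splitWord
  split
  · rw [TensorProduct.lift.tmul, sh_one_left]
  · rename_i b v hb
    have hbz : b = LB.z := by
      have h := List.head?_dropWhile_not (fun x => decide (x ≠ LB.z)) w
      rw [hb] at h
      simpa using h
    simp only [map_sum, map_smul, TensorProduct.lift.tmul]
    rw [sum_sh_take]
    conv_rhs => rw [← hw, hb, word_append, word_cons, hbz]

/-- The ring homomorphism `e_0 ↦ e_0`, `e_{-z²} ↦ e_0`, `e_z ↦ e_1` (applied to elements without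
the letter `e_{-1}`). -/
def regBar : AB →ₐ[ℚ] A2 := FreeAlgebra.lift ℚ fun
  | .zero => FreeAlgebra.ι ℚ L2.zero
  | .neg => 0
  | .z => FreeAlgebra.ι ℚ L2.one
  | .negSq => FreeAlgebra.ι ℚ L2.zero

/-- The ring homomorphism `e_a ↦ e_{-a/z²}` for `a ∈ {0, -z²}` (applied to elements without
the letters `e_{-1}` and `e_z`). -/
def scale : AB →ₐ[ℚ] A2 := FreeAlgebra.lift ℚ fun
  | .zero => FreeAlgebra.ι ℚ L2.zero
  | .neg => 0
  | .z => 0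
  | .negSq => FreeAlgebra.ι ℚ L2.one

/-- The map `reg_{z→0}`: it annihilates the words which contain `e_{-1}`, and maps `u₁ ⧢ u₂`, with
`u₁ ∈ ℬ₁` and `u₂ ∈ ℬ₂` as in `splitWord`, to `dist(regBar(u₁)) ⧢ ℘(scale(u₂))`. -/
def regZero : AB →ₗ[ℚ] A3 := onWords fun w =>
  if LB.neg ∈ w then 0
  else TensorProduct.lift
    (sh.compl₁₂ (dist.toLinearMap ∘ₗ regBar.toLinearMap) (wp ∘ₗ scale.toLinearMap)) (splitWord w)

/-! ### Confluence relations -/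

/-- `ord_{z=c}(p)`, with the convention `ord_{z=c}(0) = 0`. -/
def ordAt (c : L3) (p : Polynomial ℚ) : ℤ := p.rootMultiplicity c.val

/-- Auxiliary recursion for `partialAt`: the sum over the letters of the given word, where `prev` is
the letter which precedes the word, and the letter `z` follows it. -/
def partialAux (c : L3) : LB → List LB → AB
  | _, [] => 0
  | prev, a :: w =>
    ((ordAt c (a.poly - (w.headD LB.z).poly) - ordAt c (a.poly - prev.poly) : ℤ) : ℚ) • word w +
      FreeAlgebra.ι ℚ a * partialAux c a w

/-- The operator `∂_c`:
`e_{a₁} ⋯ e_{a_k} ↦ ∑_i (ord_{z=c}(a_i - a_{i+1}) - ord_{z=c}(a_i - a_{i-1}))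
  e_{a₁} ⋯ e_{a_{i-1}} e_{a_{i+1}} ⋯ e_{a_k}`
with `a_0 = 0`, `a_{k+1} = z` and `ord(0) = 0`. -/
def partialAt (c : L3) : AB →ₗ[ℚ] AB := onWords (partialAux c LB.zero)

/-- `φ_⊗(u) = ∑_{l ≥ 0} ∑_{c₁,…,c_l} reg_{z→0}(∂_{c₁} ⋯ ∂_{c_l} u) ⊗ e_{c₁} ⋯ e_{c_l}`. As `∂_c`
removes one letter, the terms with `l` greater than the length of the word `u` vanish. -/
def phiTensor : AB →ₗ[ℚ] A3 ⊗[ℚ] A3 := onWords fun w =>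
  ∑ l ∈ Finset.range (w.length + 1), ∑ c : Fin l → L3,
    regZero ((List.ofFn c).foldr (fun c x => partialAt c x) (word w)) ⊗ₜ word (List.ofFn c)

/-- `φ = (⧢) ∘ (id ⊗ reg_⧢) ∘ φ_⊗`. -/
def phi : AB →ₗ[ℚ] A3 :=
  TensorProduct.lift sh ∘ₗ TensorProduct.map LinearMap.id (shReg L3.zero L3.one) ∘ₗ phiTensor

/-- The ring homomorphism `u ↦ u|_{z→1}`. -/
def evalOne : AB →ₐ[ℚ] A3 := FreeAlgebra.lift ℚ fun
  | .zero => FreeAlgebra.ι ℚ L3.zero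
  | .neg => FreeAlgebra.ι ℚ L3.neg
  | .z => FreeAlgebra.ι ℚ L3.one
  | .negSq => FreeAlgebra.ι ℚ L3.neg

/-- `ℚ ⊗ ℬ`: the span of the words in `0, -1, z, -z²` which do not begin with `0` and do not end
with `z`. -/
def B : Submodule ℚ AB :=
  Submodule.span ℚ (word '' {w : List LB | w.head? ≠ some LB.zero ∧ w.getLast? ≠ some LB.z})

/-- `ℚ ⊗ 𝒜⁰({0,1,-1})`: the span of the words in `0, 1, -1` which do not begin with `0` and do
not end with `1`. -/
def A0 : Submodule ℚ A3 :=
  Submodule.span ℚ (word '' {w : List L3 | w.head? ≠ some L3.zero ∧ w.getLast? ≠ some L3.one})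

/-- `ℚ ⊗ 𝒜⁰_{k,d}({0,1,-1})`: only words of length `k` with at most `d` letters different from
`0` are allowed. -/
def A0kd (k d : ℕ) : Submodule ℚ A3 :=
  Submodule.span ℚ (word '' {w : List L3 | (w.head? ≠ some L3.zero ∧ w.getLast? ≠ some L3.one) ∧
    w.length = k ∧ w.countP (· ≠ L3.zero) ≤ d})

/-- The space `ℐ_CF = {u|_{z→1} - φ(u) ∣ u ∈ ℚ ⊗ ℬ}` of confluence relations of level two. -/
def ICF : Submodule ℚ A3 := B.map (evalOne.toLinearMap - phi)

/-- `ℋ_CF = (ℚ ⊗ 𝒜⁰({0,1,-1})) / ℐ_CF`. -/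
abbrev HCF := A0 ⧸ ICF.submoduleOf A0

/-! ### Indices -/

/-- The set of indices `(k₁,…,k_d)` of nonzero integers with `d = 0` or `k_d ≠ 1`. -/
abbrev Index := {ks : List ℤ // (∀ k ∈ ks, k ≠ 0) ∧ ks.getLast? ≠ some 1}

/-- The indices of weight `k` and depth at most `d`. -/
def indexSet (k d : ℕ) : Set Index :=
  {ks | (ks.1.map Int.natAbs).sum = k ∧ ks.1.length ≤ d}

/-- The indices `(k₁,…,k_r)` of weight `k` and depth at most `d` with `k₁,…,k_{r-1} > 0`, `k_r < 0`
and `k₂,…,k_r` odd. (The empty index satisfies these conditions.) -/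
def indexSetD (k d : ℕ) : Set Index :=
  {ks | ks ∈ indexSet k d ∧ (∀ x ∈ ks.1.dropLast, 0 < x) ∧ (∀ x ∈ ks.1.getLast?, x < 0) ∧
    ∀ x ∈ ks.1.tail, Odd x}

/-- `ε_1 = sgn(k₁) ⋯ sgn(k_d)`, that is, `ε_i = sgn(k_i) ε_{i+1}` and `ε_{d+1} = 1`. -/
def eps : List ℤ → ℤ
  | [] => 1
  | k :: ks => k.sign * eps ks

/-- The word `w(𝕜) = e_{ε₁} e_0^{|k₁|-1} ⋯ e_{ε_d} e_0^{|k_d|-1}`. -/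
def eulerWord : List ℤ → List L3
  | [] => []
  | k :: ks => (if eps (k :: ks) = 1 then L3.one else L3.neg) ::
      (List.replicate (k.natAbs - 1) L3.zero ++ eulerWord ks)

/-- `w̃(𝕜) = 2^d w(𝕜)`, for `𝕜` of depth `d`. -/
def modWord (ks : List ℤ) : A3 := (2 : ℚ) ^ ks.length • word (eulerWord ks)

theorem eulerWord_head (ks : List ℤ) : (eulerWord ks).head? ≠ some L3.zero := by
  cases ks with
  | nil => simp [eulerWord]
  | cons k ks => simp only [eulerWord, List.head?_cons]; split_ifs <;> simp

theorem eulerWord_getLast (ks : List ℤ) (h : ks.getLast? ≠ some 1) :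
    (eulerWord ks).getLast? ≠ some L3.one := by
  induction ks with
  | nil => simp [eulerWord]
  | cons k ks ih =>
    match ks with
    | [] =>
      rw [eulerWord, eulerWord, List.append_nil]
      obtain hk | ⟨n, hn⟩ : k.natAbs - 1 = 0 ∨ ∃ n, k.natAbs - 1 = n + 1 := by
        cases k.natAbs - 1 with
        | zero => exact Or.inl rfl
        | succ n => exact Or.inr ⟨n, rfl⟩
      · have h1 : k ≠ 1 := by simpa using h
        have h2 : k.sign ≠ 1 := by
          rw [Ne, Int.sign_eq_one_iff_pos]
          omega
        rw [hk]
        simp [eps, h2]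
      · rw [hn, List.replicate_succ', ← List.cons_append, List.getLast?_concat]
        simp
    | l :: ks =>
      have h1 := ih (by simpa using h)
      rw [eulerWord, ← List.cons_append, List.getLast?_append]
      have h2 : (eulerWord (l :: ks)) ≠ [] := by simp [eulerWord]
      rw [List.getLast?_eq_some_getLast h2] at h1 ⊢
      simpa using h1

theorem eulerWord_length (ks : List ℤ) (h : ∀ k ∈ ks, k ≠ 0) :
    (eulerWord ks).length = (ks.map Int.natAbs).sum := by
  induction ks with
  | nil => rfl
  | cons k ks ih =>
    have h1 := ih fun l hl => h l (List.mem_cons_of_mem _ hl)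
    have h2 := h k List.mem_cons_self
    simp only [eulerWord, List.length_cons, List.length_append, List.length_replicate,
      List.map_cons, List.sum_cons, h1]
    omega

theorem eulerWord_countP (ks : List ℤ) :
    (eulerWord ks).countP (· ≠ L3.zero) = ks.length := by
  induction ks with
  | nil => rfl
  | cons k ks ih =>
    rw [eulerWord, List.countP_cons, List.countP_append, ih, List.countP_replicate]
    split_ifs <;> simp_all

theorem modWord_mem (ks : Index) : modWord ks.1 ∈ A0 :=
  Submodule.smul_mem _ _ (Submodule.subset_span
    ⟨_, ⟨eulerWord_head _, eulerWord_getLast _ ks.2.2⟩, rfl⟩)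

theorem modWord_mem_kd {k d : ℕ} (ks : Index) (h : ks ∈ indexSet k d) :
    modWord ks.1 ∈ A0kd k d :=
  Submodule.smul_mem _ _ (Submodule.subset_span
    ⟨_, ⟨⟨eulerWord_head _, eulerWord_getLast _ ks.2.2⟩,
      (eulerWord_length _ ks.2.1).trans h.1, (eulerWord_countP ks.1).trans_le h.2⟩, rfl⟩)

/-- The class of `w̃(𝕜)` in `ℋ_CF`. -/
def modClass (ks : Index) : HCF := Submodule.Quotient.mk ⟨modWord ks.1, modWord_mem ks⟩

/-- `w̃(𝕜)` as an element of `ℚ ⊗ 𝒜⁰_{k,d}({0,1,-1})`, for an index of weight `k` and depth at most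
`d`. -/
def modWordKD {k d : ℕ} (ks : indexSet k d) : A0kd k d := ⟨modWord ks.1.1, modWord_mem_kd ks.1 ks.2⟩

/-- The ring `ℤ_(2)` of rational numbers with odd denominator. -/
def Z2 : Subring ℚ where
  carrier := {x | ∃ p q : ℤ, Odd q ∧ x = p / q}
  mul_mem' := by
    rintro _ _ ⟨p, q, hq, rfl⟩ ⟨p', q', hq', rfl⟩
    exact ⟨p * p', q * q', hq.mul hq', by push_cast; rw [div_mul_div_comm]⟩
  one_mem' := ⟨1, 1, odd_one, by simp⟩
  add_mem' := by
    rintro _ _ ⟨p, q, hq, rfl⟩ ⟨p', q', hq', rfl⟩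
    have h : (q : ℚ) ≠ 0 := by rintro h; simp_all
    have h' : (q' : ℚ) ≠ 0 := by rintro h; simp_all
    exact ⟨p * q' + q * p', q * q', hq.mul hq', by push_cast; rw [div_add_div _ _ h h']⟩
  zero_mem' := ⟨0, 1, odd_one, by simp⟩
  neg_mem' := by
    rintro _ ⟨p, q, hq, rfl⟩
    exact ⟨-p, q, hq, by push_cast; rw [neg_div]⟩

/-- `X̃(k,d)`, the `ℤ_(2)`-span of the classes of `w̃(𝕜)` for the indices `𝕜` of weight `k` and
depth at most `d`. -/
def modX (k d : ℕ) : Submodule Z2 HCF := Submodule.span Z2 (modClass '' indexSet k d)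

/-- `X̃ᴰ(k,d)`, the `ℤ_(2)`-span of the classes of `w̃(𝕜)` for `𝕜` in `indexSetD k d`. -/
def modXD (k d : ℕ) : Submodule Z2 HCF := Submodule.span Z2 (modClass '' indexSetD k d)

end Confluence

end

/-!
A normalized word is `2 ^ dep(w) w`, where the depth `dep(w)` counts the letters of `w` different
from `e_0`; the elements `w̃(𝕜)` are the normalized words without a leading `e_0` and a final
`e_1`. The normalized words span a lattice, and the theorem says that, localized at `2` and modulo
the confluence relations, the lattice in length `k` and depth at most `d` is generated by the words
`e_{-1} e_0^{a₁} ⋯ e_{-1} e_0^{a_r}` with `a₂, …, a_r` even. By Nakayama's lemma over `ℤ_(2)` and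
induction on the depth it is enough to express a normalized word by these modulo twice the lattice
and words of smaller depth (`normSpan_le_blockSpan`).

The source of all divisibility is the regularized limit. In `dist` every letter `e_0` carries a
factor `2`, and `θ'` produces one such letter for each entry of an index, so that for a nonempty
word `u` the element `2 ^ dep(u) reg_{z→0}(u)` is twice an element of the lattice (`regZero_mem`),
and even four times one for most words in `0, -z²` (`wp_scale_mem`). In the recursion over the
operators `∂_c` (`relSum`), trading `∂_c` for the letter `e_c` never increases the depth, and a
loss of depth gives another factor `2`. This has three consequences for `φ`.

* A word of `𝒜⁰` lifts along `z → 1` to a word without the letter `-1`. On such words `∂_1`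
  vanishes, and all terms of `φ` except those with the empty word in `reg_{z→0}` are twice lattice
  elements. Hence the word becomes a combination of words in `e_0, e_{-1}`
  (`relSum_mem_of_neg_notMem`).
* On words without the letter `z`, `φ` agrees with the evaluation at `z = 1` modulo twice the
  lattice (`relSum_sub_mem`). This controls the terms below which carry a coefficient `2`.
* Let `w` be a word in `e_0, e_{-1}`, cut into two parts, and substitute `-1` for `e_{-1}` in the
  first part and `-z²` in the second. Then the leading term of `φ` is `± w`, and each `e_0` in the
  second part contributes a sign, because `ord_{z=0}` is `1` on the pair `(0, z)` and `2` on the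
  pair `(0, -z²)`, so that `∂_0` removes a final `e_0` of the word with total coefficient `1 - 2`
  (`relSum_split_mem`). If some `a_j` with `j ≥ 2` is odd, then the cut can be chosen so that the
  total sign is `-1` (`exists_split`), and the relation `w - φ` is `2w` plus four times the
  lattice, twice words of smaller depth and twice lexicographically smaller words. Half of it, with
  induction over the lexicographic order, eliminates `w` (`word_mem_of_one_notMem`).

The statement about linear maps `Z` follows by factoring `Z` through the image of `𝒜⁰_{k,d}` in
`ℋ_CF`.
-/

namespace Confluence

/-! ### Integral spans of words -/

section Lattices

variable {X Y : Type}

/-- The subgroup of integral linear combinations of the words in `S`. -/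
noncomputable def wordSpan (S : Set (List X)) : AddSubgroup (FreeAlgebra ℚ X) :=
  AddSubgroup.closure (word '' S)

theorem word_mem_wordSpan {S : Set (List X)} {w : List X} (h : w ∈ S) : word w ∈ wordSpan S :=
  AddSubgroup.subset_closure ⟨w, h, rfl⟩

theorem wordSpan_mono {S T : Set (List X)} (h : S ⊆ T) : wordSpan S ≤ wordSpan T :=
  AddSubgroup.closure_mono (Set.image_mono h)

theorem intCast_smul_mem {M : Type*} [AddCommGroup M] [Module ℚ M] (P : AddSubgroup M) (n : ℤ)
    {x : M} (hx : x ∈ P) : (n : ℚ) • x ∈ P := by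
  rw [Int.cast_smul_eq_zsmul]
  exact zsmul_mem hx n

theorem natPow_smul_mem {M : Type*} [AddCommGroup M] [Module ℚ M] (P : AddSubgroup M) (n : ℕ)
    {x : M} (hx : x ∈ P) : (2 : ℚ) ^ n • x ∈ P := by
  have := intCast_smul_mem P (2 ^ n) hx
  simpa using this

theorem neg_one_pow_smul_mem {M : Type*} [AddCommGroup M] [Module ℚ M] (P : AddSubgroup M) (n : ℕ)
    {x : M} (hx : x ∈ P) : (-1 : ℚ) ^ n • x ∈ P := by
  have := intCast_smul_mem P ((-1) ^ n) hx
  simpa using this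

theorem map_mem_of_wordSpan {M : Type*} [AddCommGroup M] [Module ℚ M]
    (f : FreeAlgebra ℚ X →ₗ[ℚ] M) (P : AddSubgroup M) {S : Set (List X)}
    (h : ∀ w ∈ S, f (word w) ∈ P) {x : FreeAlgebra ℚ X} (hx : x ∈ wordSpan S) : f x ∈ P := by
  have : wordSpan S ≤ P.comap f.toAddMonoidHom := by
    rw [wordSpan, AddSubgroup.closure_le]
    rintro _ ⟨w, hw, rfl⟩
    exact h w hw
  exact this hx

theorem map₂_mem_of_wordSpan {M : Type*} [AddCommGroup M] [Module ℚ M]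
    (f : FreeAlgebra ℚ X →ₗ[ℚ] FreeAlgebra ℚ Y →ₗ[ℚ] M) (P : AddSubgroup M) {S : Set (List X)}
    {T : Set (List Y)} (h : ∀ u ∈ S, ∀ v ∈ T, f (word u) (word v) ∈ P) {x : FreeAlgebra ℚ X}
    (hx : x ∈ wordSpan S) {y : FreeAlgebra ℚ Y} (hy : y ∈ wordSpan T) : f x y ∈ P :=
  map_mem_of_wordSpan (f.flip y) P (fun u hu => map_mem_of_wordSpan (f (word u)) P (h u hu) hy) hx

theorem ι_mul_mem_wordSpan {S T : Set (List X)} (a : X) (h : ∀ u ∈ S, a :: u ∈ T)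
    {x : FreeAlgebra ℚ X} (hx : x ∈ wordSpan S) : FreeAlgebra.ι ℚ a * x ∈ wordSpan T :=
  map_mem_of_wordSpan (LinearMap.mulLeft ℚ (FreeAlgebra.ι ℚ a)) _ (fun u hu => by
    rw [LinearMap.mulLeft_apply, ← word_cons]; exact word_mem_wordSpan (h u hu)) hx

/-- Words that have the letters of `u ++ v`, and whose first and last letters are first and last
letters of `u` or `v`. -/
noncomputable def shuffleSet (u v : List X) : Set (List X) :=
  {w | w.Perm (u ++ v) ∧ (∀ x, w.head? = some x → u.head? = some x ∨ v.head? = some x) ∧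
    ∀ x, w.getLast? = some x → u.getLast? = some x ∨ v.getLast? = some x}

theorem getLast?_cons_of_getLast? {a x : X} {u : List X} (h : u.getLast? = some x) :
    (a :: u).getLast? = some x := by
  rw [List.getLast?_cons, h]; rfl

theorem getLast?_of_getLast?_cons {a x : X} {u : List X} (h : (a :: u).getLast? = some x)
    (hu : u ≠ []) : u.getLast? = some x := by
  match u with
  | [] => exact absurd rfl hu
  | b :: u => simpa using h

theorem sh_word_mem (u v : List X) : sh (word u) (word v) ∈ wordSpan (shuffleSet u v) := by
  have key : ∀ n, ∀ u v : List X, u.length + v.length = n →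
      sh (word u) (word v) ∈ wordSpan (shuffleSet u v) := by
    intro n
    induction n with
    | zero =>
      intro u v h
      have hu : u = [] := List.length_eq_zero_iff.1 (by omega)
      have hv : v = [] := List.length_eq_zero_iff.1 (by omega)
      subst hu hv
      rw [word_nil, sh_one_left, ← word_nil]
      exact word_mem_wordSpan ⟨by simp, by simp, by simp⟩
    | succ n ih =>
      intro u v h
      match u, v with
      | [], v =>
        rw [word_nil, sh_one_left]
        exact word_mem_wordSpan ⟨by simp, by simp, by simp⟩
      | a :: u, [] =>
        rw [word_nil, sh_one_right]
        exact word_mem_wordSpan ⟨by simp, by simp, by simp⟩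
      | a :: u, b :: v =>
        have h1 := ih u (b :: v) (by simp at h ⊢; omega)
        have h2 := ih (a :: u) v (by simp at h ⊢; omega)
        rw [word_cons, word_cons, sh_cons_cons, ← word_cons, ← word_cons]
        refine add_mem (ι_mul_mem_wordSpan a ?_ h1) (ι_mul_mem_wordSpan b ?_ h2)
        · rintro w ⟨hp, -, hl⟩
          have hw : w ≠ [] := by rintro rfl; simpa using hp.length_eq
          refine ⟨hp.cons a, by simp, fun x hx => ?_⟩
          exact (hl x (getLast?_of_getLast?_cons hx hw)).imp_left getLast?_cons_of_getLast?
        · rintro w ⟨hp, -, hl⟩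
          have hw : w ≠ [] := by rintro rfl; simpa using hp.length_eq
          refine ⟨(hp.cons b).trans (List.perm_middle (l₁ := a :: u)).symm, by simp, fun x hx => ?_⟩
          exact (hl x (getLast?_of_getLast?_cons hx hw)).imp_right getLast?_cons_of_getLast?
  exact key _ u v rfl

theorem sh_mem_wordSpan {S T U : Set (List X)}
    (h : ∀ u ∈ S, ∀ v ∈ T, ∀ w, w.Perm (u ++ v) → w ∈ U) {x y : FreeAlgebra ℚ X}
    (hx : x ∈ wordSpan S) (hy : y ∈ wordSpan T) : sh x y ∈ wordSpan U :=
  map₂_mem_of_wordSpan sh _ (fun u hu v hv =>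
    wordSpan_mono (fun w hw => h u hu v hv w hw.1) (sh_word_mem u v)) hx hy

theorem revWords_mem_wordSpan {S T : Set (List X)} (h : ∀ u ∈ S, u.reverse ∈ T)
    {x : FreeAlgebra ℚ X} (hx : x ∈ wordSpan S) : revWords x ∈ wordSpan T :=
  map_mem_of_wordSpan revWords _ (fun u hu => by
    rw [revWords_word]; exact word_mem_wordSpan (h u hu)) hx

/-! ### Integrality and image of the shuffle regularization -/

variable [DecidableEq X]

theorem leftDel_pow_word (a : X) (n : ℕ) (w : List X) : (leftDel a ^ n) (word w) = 0 ∨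
    ∃ v, w = List.replicate n a ++ v ∧ (leftDel a ^ n) (word w) = word v := by
  induction n generalizing w with
  | zero => exact Or.inr ⟨w, rfl, rfl⟩
  | succ n ih =>
    rw [pow_succ, Module.End.mul_apply]
    match w with
    | [] => left; rw [word_nil, leftDel_one, map_zero]
    | b :: w =>
      rw [word_cons, leftDel_cons]
      split_ifs with h
      · subst h
        refine (ih w).imp_right ?_
        rintro ⟨v, rfl, hv⟩
        exact ⟨v, by rw [List.replicate_succ, List.cons_append], hv⟩
      · left; exact map_zero _

theorem regLeft_word_mem (a : X) (w : List X) : regLeft a (word w) ∈ wordSpan {v | v.Perm w} := by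
  rw [regLeft, onWords_word]
  refine sum_mem fun n _ => neg_one_pow_smul_mem _ _ ?_
  rcases leftDel_pow_word a n w with h | ⟨v, rfl, h⟩
  · rw [h, map_zero]; exact zero_mem _
  · rw [h]
    exact wordSpan_mono (fun w hw => hw.1) (sh_word_mem _ _)

theorem shReg_word_mem (a b : X) (w : List X) :
    shReg a b (word w) ∈ wordSpan {v | v.Perm w} := by
  have h1 : revWords (regLeft a (word w)) ∈ wordSpan {v | v.Perm w} :=
    revWords_mem_wordSpan (fun v (hv : v.Perm w) => (List.reverse_perm v).trans hv)
      (regLeft_word_mem a w)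
  have h2 : regLeft b (revWords (regLeft a (word w))) ∈ wordSpan {v | v.Perm w} :=
    map_mem_of_wordSpan (regLeft b) _ (fun v (hv : v.Perm w) =>
      wordSpan_mono (fun _ h => List.Perm.trans h hv) (regLeft_word_mem b v)) h1
  exact revWords_mem_wordSpan (fun v (hv : v.Perm w) => (List.reverse_perm v).trans hv) h2

theorem shReg_mem_wordSpan (a b : X) {S : Set (List X)}
    (h : ∀ u ∈ S, ∀ w, w.Perm u → w ∈ S) {x : FreeAlgebra ℚ X}
    (hx : x ∈ wordSpan S) : shReg a b x ∈ wordSpan S :=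
  map_mem_of_wordSpan (shReg a b) _ (fun u hu =>
    wordSpan_mono (fun w hw => h u hu w hw) (shReg_word_mem a b u)) hx

/-- The span of the words which do not begin with `a` and do not end with `b`, described by the
vanishing of the two letter removals. -/
noncomputable def regularSub (a b : X) : Submodule ℚ (FreeAlgebra ℚ X) :=
  LinearMap.ker (leftDel a) ⊓ LinearMap.ker (leftDel b ∘ₗ revWords)

theorem mem_regularSub {a b : X} {x : FreeAlgebra ℚ X} :
    x ∈ regularSub a b ↔ leftDel a x = 0 ∧ leftDel b (revWords x) = 0 := Iff.rfl

theorem word_mem_regularSub {a b : X} {w : List X} (h : w.head? ≠ some a)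
    (h' : w.getLast? ≠ some b) : word w ∈ regularSub a b :=
  mem_regularSub.2 ⟨leftDel_word_eq_zero a w h, by
    rw [revWords_word]; exact leftDel_word_eq_zero b _ (by simpa using h')⟩

theorem sh_mem_regularSub {a b : X} {x y : FreeAlgebra ℚ X} (hx : x ∈ regularSub a b)
    (hy : y ∈ regularSub a b) : sh x y ∈ regularSub a b := by
  rw [mem_regularSub] at *
  rw [revWords_sh, leftDel_sh, leftDel_sh, hx.1, hx.2, hy.1, hy.2]
  simp

theorem leftDel_replicate_of_ne {a b : X} (hab : a ≠ b) (n : ℕ) :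
    leftDel a (word (List.replicate n b)) = 0 := by
  cases n with
  | zero => exact leftDel_one a
  | succ n => rw [List.replicate_succ, word_cons, leftDel_cons, if_neg hab.symm]

theorem leftDel_replicate_succ (a : X) (n : ℕ) :
    leftDel a (word (List.replicate (n + 1) a)) = word (List.replicate n a) := by
  rw [List.replicate_succ, word_cons, leftDel_cons, if_pos rfl]

theorem leftDel_regLeft (a : X) (x : FreeAlgebra ℚ X) : leftDel a (regLeft a x) = 0 := by
  obtain ⟨N, hN⟩ := regLeft_eventually a x
  have key : ∀ N : ℕ, leftDel a (∑ n ∈ Finset.range (N + 1), (-1 : ℚ) ^ n •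
      sh (word (List.replicate n a)) ((leftDel a ^ n) x)) =
      (-1 : ℚ) ^ N • sh (word (List.replicate N a)) ((leftDel a ^ (N + 1)) x) := by
    intro N
    induction N with
    | zero => simp [sh_one_left]
    | succ N ih =>
      rw [Finset.sum_range_succ, map_add, ih, map_smul, leftDel_sh, leftDel_replicate_succ,
        pow_succ' (leftDel a) (N + 1), Module.End.mul_apply]
      module
  rw [(hN N le_rfl).2, key, (hN (N + 1) (by omega)).1, map_zero, smul_zero]

/-- Removing a first letter `a` commutes with removing a last letter `b ≠ a`. -/
theorem leftDel_comm_right {a b : X} (hab : a ≠ b) (x : FreeAlgebra ℚ X) :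
    leftDel a (revWords (leftDel b (revWords x))) =
      revWords (leftDel b (revWords (leftDel a x))) := by
  induction x using word_induction with
  | hw w =>
    match w with
    | [] => simp [leftDel_one, revWords_one]
    | c :: w =>
      rcases List.eq_nil_or_concat w with rfl | ⟨v, d, rfl⟩
      · rw [revWords_word, List.reverse_singleton, word_cons, leftDel_cons, leftDel_cons]
        split_ifs <;> simp_all [leftDel_one, revWords_one]
      · have h : ∀ u : List X, revWords (leftDel b (revWords (word (u ++ [d])))) =
            if d = b then word u else 0 := fun u => by
          rw [revWords_word, List.reverse_concat, word_cons, leftDel_cons]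
          split_ifs
          · rw [revWords_word, List.reverse_reverse]
          · exact map_zero _
        rw [List.concat_eq_append, ← List.cons_append, h, List.cons_append, word_cons c (v ++ [d]),
          leftDel_cons]
        by_cases hc : c = a
        · rw [if_pos hc, h]
          split_ifs
          · rw [word_cons, leftDel_cons, if_pos hc]
          · exact map_zero _
        · rw [if_neg hc]
          split_ifs
          · rw [word_cons, leftDel_cons, if_neg hc]; simp
          · simp
  | hadd x y hx hy => simp only [map_add, hx, hy]
  | hsmul c x hx => simp only [map_smul, hx]

theorem shReg_mem_regularSub {a b : X} (hab : a ≠ b) (x : FreeAlgebra ℚ X) :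
    shReg a b x ∈ regularSub a b := by
  rw [mem_regularSub]
  simp only [shReg, LinearMap.comp_apply]
  refine ⟨?_, by rw [revWords_revWords, leftDel_regLeft]⟩
  set y := regLeft a x with hy
  have hy0 : leftDel a y = 0 := leftDel_regLeft a x
  have hpow : ∀ n : ℕ, leftDel a (revWords ((leftDel b ^ n) (revWords y))) = 0 := by
    intro n
    induction n with
    | zero => simpa [revWords_revWords] using hy0
    | succ n ih =>
      rw [pow_succ', Module.End.mul_apply]
      have := leftDel_comm_right hab (revWords ((leftDel b ^ n) (revWords y)))
      rw [revWords_revWords] at this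
      rw [this, ih, map_zero, map_zero, map_zero]
  obtain ⟨N, hN⟩ := regLeft_eventually b (revWords y)
  rw [(hN N le_rfl).2, map_sum, map_sum]
  refine Finset.sum_eq_zero fun n _ => ?_
  rw [map_smul, map_smul, revWords_sh, leftDel_sh, hpow, revWords_word, List.reverse_replicate,
    leftDel_replicate_of_ne hab]
  simp

theorem shReg_of_mem_regularSub {a b : X} {x : FreeAlgebra ℚ X} (hx : x ∈ regularSub a b) :
    shReg a b x = x := by
  rw [mem_regularSub] at hx
  simp only [shReg, LinearMap.comp_apply]
  rw [regLeft_of_leftDel_eq_zero a x hx.1, regLeft_of_leftDel_eq_zero b _ hx.2, revWords_revWords]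

/-- The projection onto `regularSub a b` that annihilates the words which begin with `a` or end
with `b` (for `a ≠ b`). -/
noncomputable def truncate (a b : X) : FreeAlgebra ℚ X →ₗ[ℚ] FreeAlgebra ℚ X :=
  onWords fun w => if w.head? ≠ some a ∧ w.getLast? ≠ some b then word w else 0

theorem truncate_word_of_regular {a b : X} {w : List X} (h : w.head? ≠ some a)
    (h' : w.getLast? ≠ some b) : truncate a b (word w) = word w := by
  rw [truncate, onWords_word, if_pos ⟨h, h'⟩]

theorem truncate_of_mem_regularSub {a b : X} {x : FreeAlgebra ℚ X} (hx : x ∈ regularSub a b) :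
    truncate a b x = x := by
  -- removing from `x` the words which begin with `a` and those which end with `b` changes neither
  -- an element of `regularSub a b` nor the value of `truncate`
  have h3 : ∀ y : FreeAlgebra ℚ X, truncate a b y =
      (y - FreeAlgebra.ι ℚ a * leftDel a y) - revWords (FreeAlgebra.ι ℚ b * leftDel b (revWords
        (y - FreeAlgebra.ι ℚ a * leftDel a y))) := by
    intro y
    induction y using word_induction with
    | hw w =>
      have ha : word w - FreeAlgebra.ι ℚ a * leftDel a (word w) =
          if w.head? = some a then 0 else word w := by
        match w with
        | [] => simp [leftDel_one]
        | c :: w =>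
          rw [word_cons, leftDel_cons]
          by_cases hc : c = a <;> simp [hc]
      have hb : word w - revWords (FreeAlgebra.ι ℚ b * leftDel b (revWords (word w))) =
          if w.getLast? = some b then 0 else word w := by
        rcases List.eq_nil_or_concat w with rfl | ⟨v, d, rfl⟩
        · simp [leftDel_one, revWords_one]
        · rw [List.concat_eq_append, revWords_word, List.reverse_concat, word_cons, leftDel_cons]
          by_cases hd : d = b
          · subst hd
            rw [if_pos rfl, ← word_cons, revWords_word]
            simp
          · simp [hd]
      rw [ha, truncate, onWords_word]
      by_cases h : w.head? = some a
      · simp [h]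
      · rw [if_neg h, hb]
        by_cases h' : w.getLast? = some b <;> simp [h, h']
    | hadd x y hx hy =>
      rw [map_add, hx, hy]
      simp only [map_add, mul_add, map_sub, mul_sub]
      abel
    | hsmul c x hx =>
      rw [map_smul, hx]
      simp only [map_smul, mul_smul_comm, map_sub, mul_sub, smul_sub]
  rw [mem_regularSub] at hx
  rw [h3, hx.1, mul_zero, sub_zero, hx.2, mul_zero, map_zero, sub_zero]

end Lattices

/-! ### Integrality of the regularized limit -/

section Integrality

/-- The number of letters different from `e_0`. -/
abbrev dep (w : List L3) : ℕ := w.countP (· ≠ L3.zero)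

/-- The number of letters different from `e_0`. -/
abbrev depB (w : List LB) : ℕ := w.countP (· ≠ LB.zero)

/-- The words in `e_0, e_1` with `m` letters `e_0` and `n` letters `e_1`. -/
def bidegree (m n : ℕ) : Set (List L2) := {w | w.count L2.zero = m ∧ w.count L2.one = n}

/-- The words in `e_0, e_1, e_{-1}` of length `k` and depth `b`. -/
def lengthDepth (k b : ℕ) : Set (List L3) := {w | w.length = k ∧ dep w = b}

/-- The integral combinations of the elements `2 ^ (dep w + e) w`, for words `w` of length `k` and
depth less than `D`. For `e = 0` it is spanned by the normalized words `2 ^ (dep w) w`. -/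
noncomputable def lattice (k D e : ℕ) : AddSubgroup A3 :=
  AddSubgroup.closure {x | ∃ w : List L3, w.length = k ∧ dep w < D ∧
    x = (2 : ℚ) ^ (dep w + e) • word w}

theorem two_pow_smul_word_mem_lattice {k D e n : ℕ} {w : List L3} (hk : w.length = k)
    (hD : dep w < D) (hn : dep w + e ≤ n) : (2 : ℚ) ^ n • word w ∈ lattice k D e := by
  obtain ⟨i, rfl⟩ := Nat.exists_eq_add_of_le hn
  rw [add_comm, pow_add, mul_smul]
  exact natPow_smul_mem _ _ (AddSubgroup.subset_closure ⟨w, hk, hD, rfl⟩)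

theorem map_mem_of_lattice {M : Type*} [AddCommGroup M] [Module ℚ M] (f : A3 →ₗ[ℚ] M)
    (P : AddSubgroup M) {k D e : ℕ}
    (h : ∀ w : List L3, w.length = k → dep w < D → (2 : ℚ) ^ (dep w + e) • f (word w) ∈ P)
    {x : A3} (hx : x ∈ lattice k D e) : f x ∈ P := by
  have : lattice k D e ≤ P.comap f.toAddMonoidHom := by
    rw [lattice, AddSubgroup.closure_le]
    rintro _ ⟨w, hk, hD, rfl⟩
    have := h w hk hD
    rw [← map_smul] at this
    exact this
  exact this hx

theorem two_pow_smul_mem_lattice {k D e e' n : ℕ} {D' : ℕ} (hD : D ≤ D') (he : e' ≤ e + n)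
    {x : A3} (hx : x ∈ lattice k D e) : (2 : ℚ) ^ n • x ∈ lattice k D' e' :=
  map_mem_of_lattice ((2 : ℚ) ^ n • LinearMap.id) _ (fun w hk hw => by
    rw [LinearMap.smul_apply, LinearMap.id_apply, smul_smul, ← pow_add]
    exact two_pow_smul_word_mem_lattice hk (by omega) (by omega)) hx

theorem lattice_mono {k D e D' e' : ℕ} (hD : D ≤ D') (he : e' ≤ e) :
    lattice k D e ≤ lattice k D' e' := fun x hx => by
  have := two_pow_smul_mem_lattice (n := 0) hD (by omega : e' ≤ e + 0) hx
  simpa using this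

theorem two_pow_smul_mem_of_wordSpan {k b D e n : ℕ} (hD : b < D) (hn : b + e ≤ n) {x : A3}
    (hx : x ∈ wordSpan (lengthDepth k b)) : (2 : ℚ) ^ n • x ∈ lattice k D e :=
  map_mem_of_wordSpan ((2 : ℚ) ^ n • LinearMap.id) _ (fun w hw => by
    rw [LinearMap.smul_apply, LinearMap.id_apply]
    exact two_pow_smul_word_mem_lattice hw.1 (hw.2.trans_lt hD) (by rw [hw.2]; exact hn)) hx

theorem sh_mem_lattice {k D e k' D' e' : ℕ} {x y : A3} (hx : x ∈ lattice k (D + 1) e)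
    (hy : y ∈ lattice k' (D' + 1) e') :
    sh x y ∈ lattice (k + k') (D + D' + 1) (e + e') := by
  refine map_mem_of_lattice (sh.flip y) _ (fun u hk hD => ?_) hx
  rw [LinearMap.flip_apply, ← map_smul]
  refine map_mem_of_lattice (sh (word u)) _ (fun v hk' hD' => ?_)
    (two_pow_smul_mem_lattice (n := dep u + e) le_rfl le_rfl hy)
  refine two_pow_smul_mem_of_wordSpan (b := dep u + dep v) (by omega) (by omega)
    (wordSpan_mono (fun w hw => ?_) (sh_word_mem u v))
  refine ⟨by rw [hw.1.length_eq, List.length_append, hk, hk'], ?_⟩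
  rw [dep, hw.1.countP_eq, List.countP_append]

theorem shReg_mem_lattice {c : List L3} {D e n : ℕ} (hD : dep c < D) (hn : dep c + e ≤ n) :
    (2 : ℚ) ^ n • shReg L3.zero L3.one (word c) ∈ lattice c.length D e :=
  two_pow_smul_mem_of_wordSpan hD hn (wordSpan_mono
    (fun _ hw => by exact ⟨List.Perm.length_eq hw, List.Perm.countP_eq _ hw⟩)
    (shReg_word_mem _ _ c))

theorem lift_word {X A : Type} [Ring A] [Algebra ℚ A] (f : X → A) (w : List X) :
    FreeAlgebra.lift ℚ f (word w) = (w.map f).prod := by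
  induction w with
  | nil => simp
  | cons a w ih => rw [word_cons, map_mul, ih, FreeAlgebra.lift_ι_apply, List.map_cons,
      List.prod_cons]

theorem one_mem_wordSpan {X : Type} {S : Set (List X)} (h : [] ∈ S) :
    (1 : FreeAlgebra ℚ X) ∈ wordSpan S :=
  word_mem_wordSpan h

theorem dist_word (w : List L2) : ∃ y ∈ wordSpan (lengthDepth w.length (w.count L2.one)),
    dist (word w) = (2 : ℚ) ^ w.count L2.zero • y := by
  induction w with
  | nil => exact ⟨1, one_mem_wordSpan ⟨rfl, rfl⟩, by simp⟩
  | cons a w ih =>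
    obtain ⟨y, hy, h⟩ := ih
    rw [word_cons, map_mul, h]
    cases a with
    | zero =>
      refine ⟨FreeAlgebra.ι ℚ L3.zero * y, ι_mul_mem_wordSpan _ (fun u hu => ?_) hy, ?_⟩
      · exact ⟨by simp [hu.1], by simpa [dep] using hu.2⟩
      · have : dist (FreeAlgebra.ι ℚ L2.zero) = (2 : ℚ) • FreeAlgebra.ι ℚ L3.zero := by
          simp [dist, two_smul, two_mul]
        rw [this, List.count_cons_self, pow_succ, mul_smul_comm, smul_mul_assoc, smul_smul]
    | one =>
      refine ⟨FreeAlgebra.ι ℚ L3.one * y + FreeAlgebra.ι ℚ L3.neg * y,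
        add_mem (ι_mul_mem_wordSpan _ (fun u hu => ?_) hy)
          (ι_mul_mem_wordSpan _ (fun u hu => ?_) hy), ?_⟩
      · exact ⟨by simp [hu.1], by simpa [dep] using hu.2⟩
      · exact ⟨by simp [hu.1], by simpa [dep] using hu.2⟩
      · have : dist (FreeAlgebra.ι ℚ L2.one) = FreeAlgebra.ι ℚ L3.one + FreeAlgebra.ι ℚ L3.neg := by
          simp [dist]
        rw [this, mul_smul_comm, add_mul]
        rfl

theorem length_eq_count_add_count (w : List L2) :
    w.length = w.count L2.zero + w.count L2.one := by
  induction w with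
  | nil => rfl
  | cons a w ih => cases a <;> simp [ih] <;> omega

/-- `dist` doubles each letter `e_0` and expands each letter `e_1` into `e_1 + e_{-1}`. -/
theorem dist_mem {m n : ℕ} {x : A2} (hx : x ∈ wordSpan (bidegree m n)) :
    ((2 : ℚ) ^ m)⁻¹ • dist x ∈ wordSpan (lengthDepth (m + n) n) :=
  map_mem_of_wordSpan (((2 : ℚ) ^ m)⁻¹ • dist.toLinearMap) _ (fun w hw => by
    obtain ⟨y, hy, h⟩ := dist_word w
    rw [length_eq_count_add_count, hw.1, hw.2] at hy
    rw [LinearMap.smul_apply, AlgHom.toLinearMap_apply, h, hw.1, smul_smul,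
      inv_mul_cancel₀ (by positivity), one_smul]
    exact hy) hx

/-- The excess `(k₁ - 1) + ⋯ + (k_d - 1)` of an index. -/
def excess (ks : List ℕ) : ℕ := (ks.map (· - 1)).sum

theorem excess_append (ks ls : List ℕ) : excess (ks ++ ls) = excess ks + excess ls := by
  simp [excess]

theorem excess_reverse (ks : List ℕ) : excess ks.reverse = excess ks := by
  rw [excess, List.map_reverse, List.sum_reverse, excess]

theorem posWord_mem (ks : List ℕ) : posWord ks ∈ bidegree (excess ks) ks.length := by
  induction ks with
  | nil => exact ⟨rfl, rfl⟩
  | cons k ks ih =>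
    have h : posWord (k :: ks) = L2.one :: (List.replicate (k - 1) L2.zero ++ posWord ks) := rfl
    have h1 := ih.1
    have h2 := ih.2
    refine ⟨?_, ?_⟩
    · rw [h, List.count_cons, List.count_append, h1, List.count_replicate]
      simp [excess]
    · rw [h, List.count_cons, List.count_append, h2, List.count_replicate]
      simp

theorem theta_mem (ks : List ℕ) : theta ks ∈ wordSpan (bidegree (excess ks) ks.length) := by
  induction h : ks.length using Nat.strong_induction_on generalizing ks with
  | _ n ih =>
    match ks with
    | [] =>
      subst h
      rw [theta]
      exact one_mem_wordSpan ⟨rfl, rfl⟩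
    | k :: ks =>
      rw [theta]
      refine neg_mem (sum_mem fun j _ => ?_)
      have hj : (ks.drop j).length < n := by rw [← h]; simp
      refine sh_mem_wordSpan (fun u hu v hv w hw => ?_)
        (word_mem_wordSpan (posWord_mem (k :: ks.take j).reverse)) (ih _ hj (ks.drop j) rfl)
      have he : excess (k :: ks) = excess (k :: ks.take j).reverse + excess (ks.drop j) := by
        rw [excess_reverse, ← excess_append, List.cons_append, List.take_append_drop]
      refine ⟨by rw [hw.count_eq, List.count_append, hu.1, hv.1, he], ?_⟩
      rw [hw.count_eq, List.count_append, hu.2, hv.2]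
      simp at h ⊢
      omega

theorem swap_word_mem (w : List L2) :
    (w.map fun
      | L2.zero => -FreeAlgebra.ι ℚ L2.one
      | L2.one => -FreeAlgebra.ι ℚ L2.zero).prod ∈
      wordSpan (bidegree (w.count L2.one) (w.count L2.zero)) := by
  induction w with
  | nil => exact one_mem_wordSpan ⟨rfl, rfl⟩
  | cons a w ih =>
    rw [List.map_cons, List.prod_cons]
    cases a with
    | zero =>
      rw [neg_mul]
      exact neg_mem (ι_mul_mem_wordSpan _ (fun v hv => by
        exact ⟨by simp [hv.1], by simp [hv.2]⟩) ih)
    | one =>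
      rw [neg_mul]
      exact neg_mem (ι_mul_mem_wordSpan _ (fun v hv => by
        exact ⟨by simp [hv.1], by simp [hv.2]⟩) ih)

theorem sig_mem {m n : ℕ} {x : A2} (hx : x ∈ wordSpan (bidegree m n)) :
    sig x ∈ wordSpan (bidegree n m) := by
  refine map_mem_of_wordSpan sig _ (fun w hw => ?_) hx
  rw [sig, LinearMap.comp_apply, revWords_word, AlgHom.toLinearMap_apply, lift_word]
  refine wordSpan_mono (fun v hv => ?_) (swap_word_mem w.reverse)
  exact ⟨hv.1.trans (by simpa using hw.2), hv.2.trans (by simpa using hw.1)⟩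

theorem thetaDist_mem (ks : List ℕ) : ((2 : ℚ) ^ ks.length)⁻¹ • thetaDist ks ∈
    wordSpan (lengthDepth (ks.length + excess ks) (excess ks)) :=
  dist_mem (shReg_mem_wordSpan _ _ (fun _ hu _ hw => by
    exact ⟨by rw [hw.count_eq, hu.1], by rw [hw.count_eq, hu.2]⟩) (sig_mem (theta_mem ks)))

theorem two_pow_smul_thetaDist {n : ℕ} (ks : List ℕ) : (2 : ℚ) ^ n • thetaDist ks =
    (2 : ℚ) ^ (n + ks.length) • (((2 : ℚ) ^ ks.length)⁻¹ • thetaDist ks) := by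
  rw [smul_smul, pow_add, mul_assoc, mul_inv_cancel₀ (by positivity), mul_one]

/-- After multiplication with `2ⁿ`, where `n` is the depth of the source, `θ₁(𝕜)` is divisible by
`2` in the lattice of normalized words: `dist` contributes a factor `2` for each of the letters
`e_0`, which `ς` produces from the letters `e_1` of `θ(𝕜)`. The summand `2 e_{-1} e_0^{2m-1}` coming
from `𝕜 = ({1}^{2m})` is the reason why for `n = 1` divisibility by `4` fails. -/
theorem theta1_mem {n : ℕ} (ks : List ℕ) (hks : 1 ≤ ks.length) (hn : excess ks < n) :
    (2 : ℚ) ^ n • theta1 ks ∈ lattice (ks.length + excess ks) (n + 1) 1 ∧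
      (2 ≤ n ∨ ks.length = 1 →
        (2 : ℚ) ^ n • theta1 ks ∈ lattice (ks.length + excess ks) (n + 1) 2) := by
  have key : ∀ e ≤ 2, (e ≤ 1 ∨ 2 ≤ n ∨ ks.length = 1) →
      (2 : ℚ) ^ n • theta1 ks ∈ lattice (ks.length + excess ks) (n + 1) e := by
    intro e he2 he
    rw [theta1, smul_add]
    refine add_mem ?_ ?_
    · rw [two_pow_smul_thetaDist]
      exact two_pow_smul_mem_of_wordSpan (by omega) (by omega) (thetaDist_mem ks)
    · rw [Finset.mul_sum, Finset.smul_sum]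
      refine sum_mem fun m hm => ?_
      obtain ⟨hm1, t, ht⟩ := Finset.mem_filter.1 hm
      have hm0 : 1 ≤ m := (Finset.mem_Icc.1 hm1).1
      have hl : ks.length = t.length + 2 * m := by rw [← ht]; simp
      have htake : ks.take (ks.length - 2 * m) = t := by
        rw [hl, Nat.add_sub_cancel, ← ht, List.take_left']; rfl
      have hx : excess t = excess ks := by rw [← ht]; simp [excess]
      rw [htake]
      have e1 : (2 : ℚ) ^ n • (2 * sh (word (L3.neg :: List.replicate (2 * m - 1) L3.zero))
          (thetaDist t)) = (2 : ℚ) ^ (n + 1 + t.length) •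
            sh (word (L3.neg :: List.replicate (2 * m - 1) L3.zero))
              (((2 : ℚ) ^ t.length)⁻¹ • thetaDist t) := by
        rw [← map_smul, ← two_pow_smul_thetaDist, map_smul, pow_succ, mul_smul, two_smul ℚ, two_mul]
      rw [e1]
      have h2 : sh (word (L3.neg :: List.replicate (2 * m - 1) L3.zero))
              (((2 : ℚ) ^ t.length)⁻¹ • thetaDist t) ∈
          wordSpan (lengthDepth (ks.length + excess ks) (excess ks + 1)) := by
        refine sh_mem_wordSpan (fun u hu v hv w hw => ?_)
          (word_mem_wordSpan (Set.mem_singleton _)) (thetaDist_mem t)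
        rw [Set.mem_singleton_iff.1 hu] at hw
        refine ⟨?_, ?_⟩
        · rw [hw.length_eq, List.length_append, hv.1, List.length_cons, List.length_replicate, hl,
            hx]
          omega
        · rw [dep, hw.countP_eq, List.countP_append, List.countP_cons, List.countP_replicate]
          have := hv.2
          rw [dep] at this
          rw [this, hx]
          simp
          omega
      refine two_pow_smul_mem_of_wordSpan (by omega) ?_ h2
      by_cases h0 : t = []
      · have : excess ks = 0 := by rw [← hx, h0]; rfl
        omega
      · have := List.length_pos_iff.2 h0
        omega
  exact ⟨key 1 (by omega) (by omega), fun h => key 2 le_rfl (Or.inr h)⟩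

theorem runs_spec (s : List L2) : ∃ k ks, runs s = k :: ks ∧ 1 ≤ k ∧
    ks.length = s.count L2.zero ∧ excess (k :: ks) = s.count L2.one := by
  induction s with
  | nil => exact ⟨1, [], rfl, le_rfl, rfl, rfl⟩
  | cons a s ih =>
    obtain ⟨k, ks, h, hk, hl, he⟩ := ih
    cases a with
    | zero =>
      refine ⟨1, k :: ks, by rw [runs, h], le_rfl, by simp [hl], ?_⟩
      simpa [excess] using he
    | one =>
      refine ⟨k + 1, ks, by rw [runs, h]; rfl, by omega, by simp [hl], ?_⟩
      simp [excess] at he ⊢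
      omega

theorem flipTail_word_mem (t : List L2) : flipTail (word t) ∈
    wordSpan {s | s.length = t.length ∧ s.count L2.one ≤ t.count L2.one} := by
  induction t with
  | nil =>
    rw [word_nil, map_one]
    exact one_mem_wordSpan ⟨rfl, le_rfl⟩
  | cons a t ih =>
    rw [word_cons, map_mul]
    cases a with
    | zero =>
      have : flipTail (FreeAlgebra.ι ℚ L2.zero) = FreeAlgebra.ι ℚ L2.zero := by simp [flipTail]
      rw [this]
      refine ι_mul_mem_wordSpan _ (fun u hu => ?_) ih
      exact ⟨by simp [hu.1], by simpa using hu.2⟩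
    | one =>
      have : flipTail (FreeAlgebra.ι ℚ L2.one) =
          FreeAlgebra.ι ℚ L2.zero - FreeAlgebra.ι ℚ L2.one := by simp [flipTail]
      rw [this, sub_mul]
      refine sub_mem (ι_mul_mem_wordSpan _ (fun u hu => ?_) ih)
        (ι_mul_mem_wordSpan _ (fun u hu => ?_) ih)
      · exact ⟨by simp [hu.1], by have := hu.2; simp; omega⟩
      · exact ⟨by simp [hu.1], by simpa using hu.2⟩

theorem wp_one_word_mem (t : List L2) (n : ℕ) (hn : t.count L2.one < n) :
    (2 : ℚ) ^ n • wp (word (L2.one :: t)) ∈ lattice (t.length + 1) (n + 1) 1 ∧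
      (2 ≤ n ∨ t = [] → (2 : ℚ) ^ n • wp (word (L2.one :: t)) ∈
        lattice (t.length + 1) (n + 1) 2) := by
  rw [word_cons, wp_one_mul]
  have key : ∀ e, (∀ s : List L2, s.length = t.length → s.count L2.one ≤ t.count L2.one →
      (2 : ℚ) ^ n • theta1 (runs s) ∈ lattice (t.length + 1) (n + 1) e) →
      (2 : ℚ) ^ n • onWords (fun s => theta1 (runs s)) (flipTail (word t)) ∈
        lattice (t.length + 1) (n + 1) e := fun e h =>
    map_mem_of_wordSpan ((2 : ℚ) ^ n • onWords (fun s => theta1 (runs s))) _ (fun s hs => by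
      rw [LinearMap.smul_apply, onWords_word]
      exact h s hs.1 hs.2) (flipTail_word_mem t)
  refine ⟨key 1 fun s hs1 hs2 => ?_, fun h => key 2 fun s hs1 hs2 => ?_⟩
  · obtain ⟨k, ks, hr, hk, hl, he⟩ := runs_spec s
    have h1 := (theta1_mem (n := n) (k :: ks) (by simp) (by omega)).1
    have h2 := length_eq_count_add_count s
    rw [hr]
    rwa [he, List.length_cons, hl, show s.count L2.zero + 1 + s.count L2.one = t.length + 1 by
      omega] at h1
  · obtain ⟨k, ks, hr, hk, hl, he⟩ := runs_spec s
    have h2 := length_eq_count_add_count s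
    have h1 := (theta1_mem (n := n) (k :: ks) (by simp) (by omega)).2 (by
      refine h.imp_right ?_
      rintro rfl
      rw [List.length_cons, hl]
      simp at hs1
      simp [hs1])
    rw [hr]
    rwa [he, List.length_cons, hl, show s.count L2.zero + 1 + s.count L2.one = t.length + 1 by
      omega] at h1

/-- Substituting letters in a word: if every letter of `w` that does not become `0` becomes a
letter, then `w` becomes `0` or a word. -/
theorem lift_word_eq {X Y : Type} (f : X → FreeAlgebra ℚ Y) (g : X → Y) (w : List X)
    (h : ∀ x, f x = 0 ∨ f x = FreeAlgebra.ι ℚ (g x)) :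
    FreeAlgebra.lift ℚ f (word w) = 0 ∨ ((∀ x ∈ w, f x = FreeAlgebra.ι ℚ (g x)) ∧
      FreeAlgebra.lift ℚ f (word w) = word (w.map g)) := by
  induction w with
  | nil => right; simp
  | cons a w ih =>
    rw [word_cons, map_mul, FreeAlgebra.lift_ι_apply]
    rcases h a with ha | ha
    · left; rw [ha, zero_mul]
    · rcases ih with h' | ⟨h1, h'⟩
      · left; rw [h', mul_zero]
      · right
        refine ⟨by simpa using ⟨ha, h1⟩, by rw [h', ha, List.map_cons, word_cons]⟩

theorem scale_word (w : List LB) : scale (word w) = 0 ∨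
    ((∀ x ∈ w, x = LB.zero ∨ x = LB.negSq) ∧
      scale (word w) = word (w.map fun | .negSq => L2.one | _ => L2.zero)) := by
  refine (lift_word_eq _ (fun | .negSq => L2.one | _ => L2.zero) w ?_).imp_right ?_
  · rintro (_ | _ | _ | _) <;> simp
  · rintro ⟨h1, h2⟩
    refine ⟨fun x hx => ?_, h2⟩
    have := h1 x hx
    cases x <;> simp_all [eq_comm]

theorem regBar_word (w : List LB) : regBar (word w) = 0 ∨
    regBar (word w) = word (w.map fun | .z => L2.one | _ => L2.zero) := by
  refine (lift_word_eq _ (fun | .z => L2.one | _ => L2.zero) w ?_).imp_right And.right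
  rintro (_ | _ | _ | _) <;> simp

/-- The regularized limit of a word in `0, -z²` is divisible by `2` in the lattice of normalized
words, and by `4` unless the word is `e_{-z²} e_0^n` with `n > 0`. -/
theorem wp_scale_mem (w : List LB) (hw : w.head? = some LB.negSq) :
    (2 : ℚ) ^ depB w • wp (scale (word w)) ∈ lattice w.length (depB w + 1) 1 ∧
      (2 ≤ depB w ∨ w.length = 1 →
        (2 : ℚ) ^ depB w • wp (scale (word w)) ∈ lattice w.length (depB w + 1) 2) := by
  rcases scale_word w with h | ⟨hl, h⟩
  · rw [h, map_zero, smul_zero]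
    exact ⟨zero_mem _, fun _ => zero_mem _⟩
  · match w with
    | [] => simp at hw
    | a :: t =>
      obtain rfl : a = LB.negSq := by simpa using hw
      rw [h, List.map_cons]
      have hc : (t.map fun | .negSq => L2.one | _ => L2.zero).count L2.one = depB t := by
        clear h hw
        induction t with
        | nil => rfl
        | cons b t ih =>
          have := ih (fun x hx => hl x (by simp at hx ⊢; tauto))
          have hb := hl b (by simp)
          rcases hb with rfl | rfl <;> simp [depB] at this ⊢ <;> exact this
      have := wp_one_word_mem (t.map fun | .negSq => L2.one | _ => L2.zero)
        (depB (LB.negSq :: t)) (by rw [hc, depB, depB, List.countP_cons]; simp)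
      simpa using this

/-- The last letter of the word becomes `e_0`, which `dist` doubles. -/
theorem dist_regBar_mem (w : List LB) (hw : w ≠ []) (hl : w.getLast? ≠ some LB.z) :
    (2 : ℚ) ^ depB w • dist (regBar (word w)) ∈ lattice w.length (depB w + 1) 1 := by
  rcases regBar_word w with h | h
  · rw [h, map_zero, smul_zero]
    exact zero_mem _
  · rw [h]
    obtain ⟨y, hy, h'⟩ := dist_word (w.map fun | .z => L2.one | _ => L2.zero)
    rw [h', smul_smul, ← pow_add]
    have h1 : (w.map fun | .z => L2.one | _ => L2.zero).count L2.one ≤ depB w := by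
      clear hw hl h hy h'
      induction w with
      | nil => simp
      | cons a w ih => cases a <;> simp [depB] at ih ⊢ <;> omega
    have h2 : 1 ≤ (w.map fun | .z => L2.one | _ => L2.zero).count L2.zero := by
      obtain ⟨v, x, rfl⟩ := (List.eq_nil_or_concat w).resolve_left hw
      have hx : x ≠ LB.z := by simpa using hl
      cases x <;> simp_all
    rw [List.length_map] at hy
    exact two_pow_smul_mem_of_wordSpan (by omega) (by omega) hy

/-- The words in `0, -1, z, -z²` which do not begin with `0` and do not end with `z`. -/
def regularB : Set (List LB) := {w | w.head? ≠ some LB.zero ∧ w.getLast? ≠ some LB.z}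

theorem regZero_of_mem {w : List LB} (h : LB.neg ∈ w) : regZero (word w) = 0 := by
  rw [regZero, onWords_word, if_pos h]

theorem regZero_of_notMem {w : List LB} (h : LB.neg ∉ w) : regZero (word w) =
    TensorProduct.lift (sh.compl₁₂ (dist.toLinearMap ∘ₗ regBar.toLinearMap)
      (wp ∘ₗ scale.toLinearMap)) (splitWord w) := by
  rw [regZero, onWords_word, if_neg h]

theorem wp_one : wp 1 = 1 := by rw [← word_nil, wp, onWords_word]

theorem regZero_one : regZero 1 = 1 := by
  rw [← word_nil, regZero_of_notMem (by simp), splitWord, List.dropWhile_nil]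
  simp [wp_one, sh_one_left]

theorem regZero_of_letters {w : List LB} (h : ∀ x ∈ w, x = LB.zero ∨ x = LB.negSq) :
    regZero (word w) = wp (scale (word w)) := by
  have h1 : w.dropWhile (· ≠ LB.z) = [] := by
    rw [List.dropWhile_eq_nil_iff]
    intro x hx
    rcases h x hx with rfl | rfl <;> decide
  rw [regZero_of_notMem (fun hn => by simpa using h _ hn), splitWord, h1]
  simp [sh_one_left]

/-- The left tensor factors of `splitWord w` are regular words beginning with `z`. -/
theorem splitWord_left_mem {q v : List LB} (hv : v ≠ []) (hl : v.getLast? ≠ some LB.z)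
    (hq : LB.z ∉ q) : FreeAlgebra.ι ℚ LB.z * sh (word q) (word v) ∈
      wordSpan {u | u.head? = some LB.z ∧ u.Perm (LB.z :: (q ++ v)) ∧
        u.getLast? ≠ some LB.z} := by
  refine ι_mul_mem_wordSpan _ ?_ (sh_word_mem q v)
  rintro u ⟨hp, -, hu⟩
  refine ⟨rfl, hp.cons _, fun h => ?_⟩
  have hu0 : u ≠ [] := by rintro rfl; simp [hv] at hp
  rcases hu _ (getLast?_of_getLast?_cons h hu0) with h | h
  · exact hq (List.mem_of_getLast? h)
  · exact hl h

/-- The regularized limit of a nonempty word is divisible by `2` in the lattice of normalized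
words. -/
theorem regZero_mem (w : List LB) (hw : w ∈ regularB) (h0 : w ≠ []) :
    (2 : ℚ) ^ depB w • regZero (word w) ∈ lattice w.length (depB w + 1) 1 := by
  by_cases hneg : LB.neg ∈ w
  · rw [regZero_of_mem hneg, smul_zero]
    exact zero_mem _
  · by_cases hz : LB.z ∈ w
    · rw [regZero_of_notMem hneg, splitWord]
      have hw' := List.takeWhile_append_dropWhile (p := fun x => decide (x ≠ LB.z)) (l := w)
      split
      · rename_i hd
        rw [List.dropWhile_eq_nil_iff] at hd
        simpa using hd _ hz
      · rename_i b v hd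
        have hbz : b = LB.z := by
          have h := List.head?_dropWhile_not (fun x => decide (x ≠ LB.z)) w
          rw [hd] at h
          simpa using h
        subst hbz
        rw [hd] at hw'
        set p := w.takeWhile (fun x => decide (x ≠ LB.z)) with hp
        have hpz : LB.z ∉ p := fun h => by simpa using List.mem_takeWhile_imp h
        have hvl : v ≠ [] ∧ v.getLast? ≠ some LB.z := by
          have h := hw.2
          rw [← hw'] at h
          rcases List.eq_nil_or_concat v with rfl | ⟨v', x, rfl⟩
          · simp at h
          · rw [List.concat_eq_append, ← List.cons_append, ← List.append_assoc,
              List.getLast?_concat] at h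
            exact ⟨by simp, by simpa using h⟩
        rw [map_sum, Finset.smul_sum]
        refine sum_mem fun j hj => ?_
        rw [map_smul, smul_comm]
        refine neg_one_pow_smul_mem _ _ ?_
        rw [TensorProduct.lift.tmul, LinearMap.compl₁₂_apply]
        simp only [LinearMap.comp_apply, AlgHom.toLinearMap_apply]
        set p₁ := p.take j
        set p₂ := p.drop j
        have hpp : p₁ ++ p₂ = p := List.take_append_drop j p
        have hdep : depB w = depB (LB.z :: (p₂.reverse ++ v)) + depB p₁ := by
          rw [← hw', ← hpp]
          simp [depB, List.countP_append]
          omega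
        have hlen : w.length = (LB.z :: (p₂.reverse ++ v)).length + p₁.length := by
          rw [← hw', ← hpp]
          simp
          omega
        have h1 : (2 : ℚ) ^ depB p₁ • wp (scale (word p₁)) ∈
            lattice p₁.length (depB p₁ + 1) 0 := by
          by_cases hp1 : p₁ = []
          · rw [hp1, word_nil, map_one, wp_one, ← word_nil]
            exact two_pow_smul_word_mem_lattice rfl (by simp) (by simp)
          · refine lattice_mono le_rfl (by omega) (wp_scale_mem p₁ ?_).1
            obtain ⟨a, t, ht⟩ := List.exists_cons_of_ne_nil hp1
            have hwa : w = a :: (t ++ p₂ ++ LB.z :: v) := by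
              rw [← hw', ← hpp, ht]; simp
            have ha1 : a ≠ LB.zero := by
              have := hw.1
              rw [hwa] at this
              simpa using this
            have ha2 : a ≠ LB.z := by
              rintro rfl
              exact hpz (by rw [← hpp, ht]; simp)
            have ha3 : a ≠ LB.neg := by
              rintro rfl
              exact hneg (by rw [hwa]; simp)
            rw [ht]
            cases a <;> simp_all
        have h2 := splitWord_left_mem (q := p₂.reverse) hvl.1 hvl.2 (fun h =>
          hpz (by rw [← hpp]; simp at h ⊢; exact Or.inr h))
        have h3 : (2 : ℚ) ^ depB (LB.z :: (p₂.reverse ++ v)) •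
            dist (regBar (FreeAlgebra.ι ℚ LB.z * sh (word p₂.reverse) (word v))) ∈
            lattice (LB.z :: (p₂.reverse ++ v)).length
              (depB (LB.z :: (p₂.reverse ++ v)) + 1) 1 := by
          refine map_mem_of_wordSpan ((2 : ℚ) ^ depB (LB.z :: (p₂.reverse ++ v)) •
            (dist.toLinearMap ∘ₗ regBar.toLinearMap)) _ ?_ h2
          rintro u ⟨hu, hup, hul⟩
          have := dist_regBar_mem u (by rintro rfl; simp at hu) hul
          rw [depB, hup.countP_eq, hup.length_eq] at this
          exact this
        have h4 := sh_mem_lattice h3 h1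
        rw [map_smul, map_smul, LinearMap.smul_apply, smul_smul, ← pow_add] at h4
        rw [hdep, hlen, add_comm (depB (LB.z :: (p₂.reverse ++ v))) (depB p₁)]
        rw [add_comm (depB (LB.z :: (p₂.reverse ++ v))) (depB p₁)] at h4
        exact h4
    · have hlet : ∀ x ∈ w, x = LB.zero ∨ x = LB.negSq := by
        rintro (_ | _ | _ | _) hx <;> simp_all
      rw [regZero_of_letters hlet]
      refine (wp_scale_mem w ?_).1
      obtain ⟨a, t, rfl⟩ := List.exists_cons_of_ne_nil h0
      have h1 := hw.1
      have h2 := hlet a (by simp)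
      simp_all

end Integrality

/-! ### The operators `∂_c` on words -/

section Operators

/-- The values of `ord_{z=c}(a - b)` for `a, b ∈ {0, -1, z, -z²}`. -/
def ordTable : L3 → LB → LB → ℤ
  | .zero, .zero, .z | .zero, .z, .zero | .zero, .z, .negSq | .zero, .negSq, .z => 1
  | .zero, .zero, .negSq | .zero, .negSq, .zero => 2
  | .neg, .neg, .z | .neg, .z, .neg | .neg, .neg, .negSq | .neg, .negSq, .neg => 1
  | .neg, .z, .negSq | .neg, .negSq, .z => 1
  | .one, .neg, .negSq | .one, .negSq, .neg => 1
  | _, _, _ => 0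

theorem ordAt_of_factor (c : L3) (p q : Polynomial ℚ) (n : ℕ)
    (h : p = q * (Polynomial.X - Polynomial.C c.val) ^ n) (hq : q.eval c.val ≠ 0) :
    ordAt c p = n := by
  have hq0 : q ≠ 0 := by rintro rfl; simp at hq
  rw [ordAt, h, Polynomial.rootMultiplicity_mul_X_sub_C_pow hq0,
    Polynomial.rootMultiplicity_eq_zero hq, zero_add]

theorem ordAt_sub_comm (c : L3) (p q : Polynomial ℚ) : ordAt c (p - q) = ordAt c (q - p) := by
  have h : p - q = Polynomial.C (-1) * (q - p) := by simp
  by_cases h0 : q - p = 0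
  · rw [h, h0, mul_zero]
  · rw [ordAt, h, Polynomial.rootMultiplicity_mul (mul_ne_zero (by simp) h0),
      Polynomial.rootMultiplicity_C, zero_add, ordAt]

theorem ordAt_poly (c : L3) (a b : LB) : ordAt c (a.poly - b.poly) = ordTable c a b := by
  open Polynomial in
  have h1 : ordAt c (LB.zero.poly - LB.neg.poly) = ordTable c .zero .neg := by
    cases c <;> exact ordAt_of_factor _ _ 1 0 (by simp [LB.poly]) (by simp)
  have h2 : ordAt c (LB.zero.poly - LB.z.poly) = ordTable c .zero .z := by
    cases c
    · exact ordAt_of_factor _ _ (-1) 1 (by simp [LB.poly, L3.val]) (by simp)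
    · exact ordAt_of_factor _ _ (-X) 0 (by simp [LB.poly]) (by simp [L3.val])
    · exact ordAt_of_factor _ _ (-X) 0 (by simp [LB.poly]) (by simp [L3.val])
  have h3 : ordAt c (LB.zero.poly - LB.negSq.poly) = ordTable c .zero .negSq := by
    cases c
    · exact ordAt_of_factor _ _ 1 2 (by simp [LB.poly, L3.val]) (by simp)
    · exact ordAt_of_factor _ _ (X ^ 2) 0 (by simp [LB.poly]) (by simp [L3.val])
    · exact ordAt_of_factor _ _ (X ^ 2) 0 (by simp [LB.poly]) (by simp [L3.val])
  have h4 : ordAt c (LB.neg.poly - LB.z.poly) = ordTable c .neg .z := by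
    cases c
    · exact ordAt_of_factor _ _ (-1 - X) 0 (by simp [LB.poly]) (by simp [L3.val])
    · exact ordAt_of_factor _ _ (-1 - X) 0 (by simp [LB.poly]) (by norm_num [L3.val])
    · exact ordAt_of_factor _ _ (-1) 1 (by simp [LB.poly, L3.val]; ring) (by simp)
  have h5 : ordAt c (LB.neg.poly - LB.negSq.poly) = ordTable c .neg .negSq := by
    cases c
    · exact ordAt_of_factor _ _ (-1 + X ^ 2) 0 (by simp [LB.poly]) (by simp [L3.val])
    · exact ordAt_of_factor _ _ (X + 1) 1 (by simp [LB.poly, L3.val]; ring) (by norm_num [L3.val])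
    · exact ordAt_of_factor _ _ (X - 1) 1 (by simp [LB.poly, L3.val]; ring) (by norm_num [L3.val])
  have h6 : ordAt c (LB.z.poly - LB.negSq.poly) = ordTable c .z .negSq := by
    cases c
    · exact ordAt_of_factor _ _ (1 + X) 1 (by simp [LB.poly, L3.val]; ring) (by simp [L3.val])
    · exact ordAt_of_factor _ _ (X + X ^ 2) 0 (by simp [LB.poly]) (by norm_num [L3.val])
    · exact ordAt_of_factor _ _ X 1 (by simp [LB.poly, L3.val]; ring) (by simp [L3.val])
  have h0 : ordAt c 0 = 0 := by simp [ordAt]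
  cases a <;> cases b <;> first
    | (rw [sub_self, h0]; cases c <;> rfl)
    | assumption
    | (rw [ordAt_sub_comm]; first
        | (rw [h1]; cases c <;> rfl) | (rw [h2]; cases c <;> rfl) | (rw [h3]; cases c <;> rfl)
        | (rw [h4]; cases c <;> rfl) | (rw [h5]; cases c <;> rfl) | (rw [h6]; cases c <;> rfl))

theorem partialAux_cons (c : L3) (prev a : LB) (w : List LB) : partialAux c prev (a :: w) =
    ((ordTable c a (w.headD LB.z) - ordTable c a prev : ℤ) : ℚ) • word w +
      FreeAlgebra.ι ℚ a * partialAux c a w := by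
  rw [partialAux, ordAt_poly, ordAt_poly]

theorem partialAt_word (c : L3) (w : List LB) : partialAt c (word w) = partialAux c LB.zero w := by
  rw [partialAt, onWords_word]

/-- The words obtained from `w` by removing one letter. -/
def deletions (w : List LB) : Set (List LB) := {v | v.Sublist w ∧ v.length + 1 = w.length}

/-- For `c ≠ 0` the operator `∂_c` removes only letters different from `e_0`, because the two
orders which belong to a letter `e_0` vanish. -/
theorem partialAux_mem (c : L3) (prev : LB) (w : List LB) : partialAux c prev w ∈
    wordSpan {v | v ∈ deletions w ∧ (c ≠ L3.zero → depB v + 1 = depB w) ∧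
      ((prev :: w).getLast? ≠ some LB.z → (prev :: v).getLast? ≠ some LB.z) ∧
      (prev = LB.zero → v.head? = some LB.zero → w.head? = some LB.zero)} := by
  induction w generalizing prev with
  | nil => rw [partialAux]; exact zero_mem _
  | cons a w ih =>
    rw [partialAux_cons]
    refine add_mem ?_ (ι_mul_mem_wordSpan a ?_ (ih a))
    · by_cases h : ordTable c a (w.headD LB.z) - ordTable c a prev = 0
      · rw [h, Int.cast_zero, zero_smul]; exact zero_mem _
      · refine intCast_smul_mem _ _ (word_mem_wordSpan ?_)
        refine ⟨⟨List.sublist_cons_self a w, rfl⟩, fun hc => ?_, fun hl => ?_, ?_⟩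
        · have ha : a ≠ LB.zero := by
            rintro rfl
            apply h
            cases c
            · exact absurd rfl hc
            · cases w.headD LB.z <;> cases prev <;> rfl
            · cases w.headD LB.z <;> cases prev <;> rfl
          simp [depB, ha]
        · match w with
          | [] =>
            simp only [List.getLast?_singleton]
            rintro ⟨⟩
            exact h (sub_self _)
          | b :: w => simpa using hl
        · rintro rfl hw
          match w with
          | [] => simp at hw
          | b :: w =>
            obtain rfl : b = LB.zero := by simpa using hw
            exact absurd (sub_self _) h
    · rintro v ⟨⟨hs, hlen⟩, hd, hl, -⟩
      refine ⟨⟨hs.cons_cons a, by simp [hlen]⟩, fun hc => ?_, fun h => ?_, fun _ => id⟩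
      · have := hd hc
        simp only [depB, List.countP_cons] at this ⊢
        omega
      · have := hl (by simpa using h)
        simpa using this

theorem partialAt_mem (c : L3) {w : List LB} (hw : w ∈ regularB) : partialAt c (word w) ∈
    wordSpan {v | v ∈ deletions w ∧ v ∈ regularB ∧ (c ≠ L3.zero → depB v + 1 = depB w)} := by
  rw [partialAt_word]
  refine wordSpan_mono ?_ (partialAux_mem c LB.zero w)
  rintro v ⟨hv, hd, hl, hh⟩
  refine ⟨hv, ⟨fun h => hw.1 (hh rfl h), fun h => ?_⟩, hd⟩
  refine hl ?_ (getLast?_cons_of_getLast? h)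
  rcases List.eq_nil_or_concat w with rfl | ⟨t, x, rfl⟩
  · simp
  · have h2 := hw.2
    rw [List.concat_eq_append, List.getLast?_concat] at h2
    rw [List.concat_eq_append, ← List.cons_append, List.getLast?_concat]
    exact h2

/-- If `ord_{z=c}` vanishes on all pairs of consecutive letters, then only the pair formed by the
last letter and the letter `z` that follows the word contributes to `∂_c`. -/
theorem partialAux_of_isChain (c : L3) (prev : LB) (u : List LB) (a : LB)
    (h : List.IsChain (fun x y => ordTable c y x = 0 ∧ ordTable c x y = 0) (prev :: (u ++ [a]))) :
    partialAux c prev (u ++ [a]) = (ordTable c a LB.z : ℚ) • word u := by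
  induction u generalizing prev with
  | nil =>
    rw [List.nil_append, List.isChain_cons_cons] at h
    rw [List.nil_append, partialAux_cons, h.1.1]
    simp [partialAux]
  | cons b u ih =>
    rw [List.cons_append, List.isChain_cons_cons] at h
    have hn : ordTable c b ((u ++ [a]).headD LB.z) = 0 := by
      match u with
      | [] => exact ((List.isChain_cons_cons.1 h.2).1).2
      | d :: u => exact ((List.isChain_cons_cons.1 h.2).1).2
    rw [List.cons_append, partialAux_cons, h.1.1, hn, ih b h.2]
    simp

theorem partialAux_eq_zero_of_isChain (c : L3) (prev : LB) (u : List LB)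
    (h : List.IsChain (fun x y => ordTable c y x = 0 ∧ ordTable c x y = 0)
      (prev :: (u ++ [LB.z]))) : partialAux c prev u = 0 := by
  induction u generalizing prev with
  | nil => rfl
  | cons b u ih =>
    rw [List.cons_append, List.isChain_cons_cons] at h
    have hn : ordTable c b (u.headD LB.z) = 0 := by
      match u with
      | [] => exact ((List.isChain_cons_cons.1 h.2).1).2
      | d :: u => exact ((List.isChain_cons_cons.1 h.2).1).2
    rw [partialAux_cons, h.1.1, hn, ih b h.2]
    simp

/-- The letter substitution `u ↦ u|_{z→1}`. -/
def LB.atOne : LB → L3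
  | .zero => .zero
  | .neg => .neg
  | .z => .one
  | .negSq => .neg

theorem evalOne_word (w : List LB) : evalOne (word w) = word (w.map LB.atOne) := by
  rw [evalOne, lift_word, word, List.map_map]
  congr 2
  funext x
  cases x <;> rfl

theorem dep_map_atOne (w : List LB) : dep (w.map LB.atOne) = depB w := by
  rw [dep, List.countP_map]
  congr 1
  funext x
  cases x <;> rfl

/-- Under `z → 1` the letters `-1` and `-z²` become equal, so that for `c ≠ 0` the two deletions
belonging to a pair of consecutive letters cancel. -/
theorem evalOne_partialAux (c : L3) (hc : c ≠ L3.zero) (prev : LB) (u : List LB) (a : LB)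
    (hu : LB.z ∉ u ++ [a]) :
    evalOne (partialAux c prev (u ++ [a])) +
      (ordTable c ((u ++ [a]).headD LB.z) prev : ℚ) • word ((u ++ [a]).tail.map LB.atOne) =
      (ordTable c a LB.z : ℚ) • word (u.map LB.atOne) := by
  induction u generalizing prev with
  | nil =>
    rw [List.nil_append, partialAux_cons, map_add, map_smul, map_mul]
    simp [partialAux, sub_smul]
  | cons b u ih =>
    have hu' : LB.z ∉ u ++ [a] := fun h => hu (by simp at h ⊢; tauto)
    have h1 := ih b hu'
    obtain ⟨d, t, hd⟩ : ∃ d t, u ++ [a] = d :: t := by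
      cases u with
      | nil => exact ⟨a, [], rfl⟩
      | cons d u => exact ⟨d, u ++ [a], rfl⟩
    rw [List.cons_append, partialAux_cons, map_add, map_smul, map_mul, evalOne_word]
    have h2 : evalOne (FreeAlgebra.ι ℚ b) = FreeAlgebra.ι ℚ b.atOne := by
      rw [← word_singleton, evalOne_word]; simp
    rw [h2, List.map_cons, word_cons, ← mul_smul_comm, ← h1, mul_add, mul_smul_comm, ← word_cons]
    rw [List.cons_append] at hu
    rw [hd] at hu hu' ⊢
    simp only [List.headD_cons, List.tail_cons, List.map_cons]
    have h3 : (ordTable c b d : ℚ) • word (d.atOne :: t.map LB.atOne) =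
        (ordTable c d b : ℚ) • word (b.atOne :: t.map LB.atOne) := by
      have hdz : d ≠ LB.z := fun h => hu' (by simp [h])
      have hbz : b ≠ LB.z := fun h => hu (by simp [h])
      cases c <;> cases b <;> cases d <;> simp_all [ordTable, LB.atOne]
    push_cast
    rw [sub_smul, h3]
    abel

end Operators

/-! ### The recursion for `φ` -/

section Recursion

/-- The partial sums of `φ` in recursive form: `x` is the element to which operators `∂_c` are still
to be applied (at most `N` times), and `r` is the word of the operators applied so far. -/
noncomputable def relSum : ℕ → List L3 → AB →ₗ[ℚ] A3
  | 0, r => sh.flip (shReg L3.zero L3.one (word r)) ∘ₗ regZero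
  | N + 1, r => sh.flip (shReg L3.zero L3.one (word r)) ∘ₗ regZero +
      ∑ c : L3, relSum N (c :: r) ∘ₗ partialAt c

theorem relSum_zero (r : List L3) (x : AB) :
    relSum 0 r x = sh (regZero x) (shReg L3.zero L3.one (word r)) := rfl

theorem relSum_succ (N : ℕ) (r : List L3) (x : AB) : relSum (N + 1) r x =
    sh (regZero x) (shReg L3.zero L3.one (word r)) +
      ∑ c : L3, relSum N (c :: r) (partialAt c x) := by
  simp [relSum]

theorem sum_letters {M : Type*} [AddCommMonoid M] (f : L3 → M) :
    ∑ c : L3, f c = f L3.zero + (f L3.one + f L3.neg) := by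
  have : (Finset.univ : Finset L3) = {L3.zero, L3.one, L3.neg} := by
    ext x; cases x <;> simp
  rw [this, Finset.sum_insert (by decide), Finset.sum_insert (by decide), Finset.sum_singleton]

theorem sum_foldr_eq_relSum (N : ℕ) (r : List L3) (x : AB) :
    ∑ l ∈ Finset.range (N + 1), ∑ c : Fin l → L3,
      sh (regZero ((List.ofFn c).foldr (fun c x => partialAt c x) x))
        (shReg L3.zero L3.one (word (List.ofFn c ++ r))) = relSum N r x := by
  induction N generalizing r x with
  | zero => simp [relSum_zero]
  | succ N ih =>
    rw [Finset.sum_range_succ', relSum_succ, add_comm]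
    congr 1
    · simp
    · simp only [← ih]
      rw [Finset.sum_comm]
      refine Finset.sum_congr rfl fun l _ => ?_
      rw [← Fintype.sum_prod_type']
      refine (Fintype.sum_equiv (Fin.snocEquiv fun _ => L3) _ _ ?_).symm
      rintro ⟨a, c⟩
      have h : List.ofFn (Fin.snocEquiv (fun _ => L3) (a, c)) = List.ofFn c ++ [a] := by
        rw [List.ofFn_succ']
        simp [Fin.snocEquiv]
      rw [h, List.foldr_append, List.append_assoc]
      rfl

theorem phi_word (w : List LB) : phi (word w) = relSum w.length [] (word w) := by
  rw [← sum_foldr_eq_relSum, phi, LinearMap.comp_apply, LinearMap.comp_apply, phiTensor,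
    onWords_word]
  simp [map_sum]

theorem leftDel_dist_zero (x : A2) :
    leftDel L3.zero (dist x) = (2 : ℚ) • dist (leftDel L2.zero x) := by
  induction x using word_induction with
  | hw w =>
    match w with
    | [] => simp [leftDel_one]
    | .zero :: w =>
      have : dist (FreeAlgebra.ι ℚ L2.zero) = (2 : ℚ) • FreeAlgebra.ι ℚ L3.zero := by
        simp [dist, two_smul, two_mul]
      rw [word_cons, map_mul, this, smul_mul_assoc, map_smul, leftDel_cons, leftDel_cons]
      simp
    | .one :: w =>
      have : dist (FreeAlgebra.ι ℚ L2.one) = FreeAlgebra.ι ℚ L3.one + FreeAlgebra.ι ℚ L3.neg := by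
        simp [dist]
      rw [word_cons, map_mul, this, add_mul, map_add, leftDel_cons, leftDel_cons, leftDel_cons]
      simp
  | hadd x y hx hy => simp only [map_add, hx, hy, smul_add]
  | hsmul c x hx => simp only [map_smul, hx, smul_comm c]

theorem leftDel_dist_one (x : A2) :
    leftDel L3.one (dist x) = dist (leftDel L2.one x) := by
  induction x using word_induction with
  | hw w =>
    match w with
    | [] => simp [leftDel_one]
    | .zero :: w =>
      have : dist (FreeAlgebra.ι ℚ L2.zero) = (2 : ℚ) • FreeAlgebra.ι ℚ L3.zero := by
        simp [dist, two_smul, two_mul]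
      rw [word_cons, map_mul, this, smul_mul_assoc, map_smul, leftDel_cons, leftDel_cons]
      simp
    | .one :: w =>
      have : dist (FreeAlgebra.ι ℚ L2.one) = FreeAlgebra.ι ℚ L3.one + FreeAlgebra.ι ℚ L3.neg := by
        simp [dist]
      rw [word_cons, map_mul, this, add_mul, map_add, leftDel_cons, leftDel_cons, leftDel_cons]
      simp
  | hadd x y hx hy => simp only [map_add, hx, hy]
  | hsmul c x hx => simp only [map_smul, hx]

theorem revWords_dist (x : A2) : revWords (dist x) = dist (revWords x) := by
  have hz : dist (FreeAlgebra.ι ℚ L2.zero) = (2 : ℚ) • FreeAlgebra.ι ℚ L3.zero := by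
    simp [dist, two_smul, two_mul]
  have ho : dist (FreeAlgebra.ι ℚ L2.one) = FreeAlgebra.ι ℚ L3.one + FreeAlgebra.ι ℚ L3.neg := by
    simp [dist]
  induction x using word_induction with
  | hw w =>
    induction w with
    | nil => simp [revWords_one]
    | cons a w ih =>
      rw [word_cons, map_mul dist, revWords_cons, map_mul dist, ← ih]
      cases a with
      | zero => rw [hz, smul_mul_assoc, map_smul, revWords_cons, mul_smul_comm]
      | one => rw [ho, add_mul, map_add, revWords_cons, revWords_cons, mul_add]
  | hadd x y hx hy => simp only [map_add, hx, hy]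
  | hsmul c x hx => simp only [map_smul, hx]

theorem dist_mem_regularSub {x : A2} (hx : x ∈ regularSub L2.zero L2.one) :
    dist x ∈ regularSub L3.zero L3.one := by
  rw [mem_regularSub] at *
  rw [leftDel_dist_zero, hx.1, revWords_dist, leftDel_dist_one, hx.2]
  simp

theorem wp_mem_regularSub (x : A2) : wp x ∈ regularSub L3.zero L3.one := by
  have h0 : ∀ ks, thetaDist ks ∈ regularSub L3.zero L3.one := fun ks =>
    dist_mem_regularSub (shReg_mem_regularSub (by decide) _)
  have h1 : ∀ ks, theta1 ks ∈ regularSub L3.zero L3.one := by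
    intro ks
    rw [theta1, two_mul]
    refine add_mem (h0 ks) ?_
    have : ∀ m ∈ (Finset.Icc 1 ks.length).filter (fun m => List.replicate (2 * m) 1 <:+ ks),
      sh (word (L3.neg :: List.replicate (2 * m - 1) L3.zero))
        (thetaDist (ks.take (ks.length - 2 * m))) ∈ regularSub L3.zero L3.one := by
      intro m hm
      refine sh_mem_regularSub (word_mem_regularSub (by simp) (fun h => ?_)) (h0 _)
      simpa using List.mem_of_getLast? h
    exact add_mem (sum_mem this) (sum_mem this)
  induction x using word_induction with
  | hw w =>
    match w with
    | [] =>
      rw [word_nil, wp_one, ← word_nil]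
      exact word_mem_regularSub (by simp) (by simp)
    | .zero :: w => rw [wp, onWords_word]; exact zero_mem _
    | .one :: w =>
      rw [word_cons, wp_one_mul]
      induction flipTail (word w) using word_induction with
      | hw w => rw [onWords_word]; exact h1 _
      | hadd x y hx hy => rw [map_add]; exact add_mem hx hy
      | hsmul c x hx => rw [map_smul]; exact Submodule.smul_mem _ _ hx
  | hadd x y hx hy => rw [map_add]; exact add_mem hx hy
  | hsmul c x hx => rw [map_smul]; exact Submodule.smul_mem _ _ hx

theorem regZero_mem_regularSub {w : List LB} (hw : w ∈ regularB) :
    regZero (word w) ∈ regularSub L3.zero L3.one := by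
  by_cases hneg : LB.neg ∈ w
  · rw [regZero_of_mem hneg]
    exact zero_mem _
  · rw [regZero_of_notMem hneg, splitWord]
    have hw' := List.takeWhile_append_dropWhile (p := fun x => decide (x ≠ LB.z)) (l := w)
    split
    · rw [TensorProduct.lift.tmul, LinearMap.compl₁₂_apply]
      simp only [LinearMap.comp_apply, AlgHom.toLinearMap_apply, map_one, sh_one_left]
      exact wp_mem_regularSub _
    · rename_i b v hd
      set p := w.takeWhile (fun x => decide (x ≠ LB.z)) with hp
      have hpz : LB.z ∉ p := fun h => by simpa using List.mem_takeWhile_imp h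
      have hbz : b = LB.z := by
        have h := List.head?_dropWhile_not (fun x => decide (x ≠ LB.z)) w
        rw [hd] at h
        simpa using h
      have hvl : v ≠ [] ∧ v.getLast? ≠ some LB.z := by
        have h := hw.2
        rw [← hw', hd] at h
        rcases List.eq_nil_or_concat v with rfl | ⟨v', x, rfl⟩
        · simp [hbz] at h
        · rw [List.concat_eq_append, ← List.cons_append, ← List.append_assoc,
            List.getLast?_concat] at h
          exact ⟨by simp, by simpa using h⟩
      rw [map_sum]
      refine sum_mem fun j hj => ?_
      rw [map_smul, TensorProduct.lift.tmul, LinearMap.compl₁₂_apply]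
      simp only [LinearMap.comp_apply, AlgHom.toLinearMap_apply]
      refine Submodule.smul_mem _ _ (sh_mem_regularSub (dist_mem_regularSub ?_)
        (wp_mem_regularSub _))
      refine map_mem_of_wordSpan regBar.toLinearMap
        (regularSub L2.zero L2.one).toAddSubgroup ?_
        (splitWord_left_mem (q := (p.drop j).reverse) hvl.1 hvl.2 (fun h =>
          hpz (List.mem_of_mem_drop (List.mem_reverse.1 h))))
      rintro u ⟨hu, -, hul⟩
      change regBar (word u) ∈ regularSub L2.zero L2.one
      rcases regBar_word u with h | h
      · rw [h]; exact zero_mem _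
      · rw [h]
        refine word_mem_regularSub ?_ ?_
        · rw [List.head?_map, hu]; simp
        · rw [List.getLast?_map]
          intro h
          obtain ⟨x, hx, hx'⟩ := Option.map_eq_some_iff.1 h
          cases x <;> simp_all

theorem relSum_mem_regularSub (N : ℕ) (r : List L3) {u : List LB} (hu : u ∈ regularB) :
    relSum N r (word u) ∈ regularSub L3.zero L3.one := by
  induction N generalizing r u with
  | zero =>
    exact sh_mem_regularSub (regZero_mem_regularSub hu) (shReg_mem_regularSub (by decide) _)
  | succ N ih =>
    rw [relSum_succ]
    refine add_mem (sh_mem_regularSub (regZero_mem_regularSub hu)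
      (shReg_mem_regularSub (by decide) _)) (sum_mem fun c _ => ?_)
    exact map_mem_of_wordSpan (relSum N (c :: r)) (regularSub L3.zero L3.one).toAddSubgroup
      (fun v hv => ih (c :: r) hv.2.1) (partialAt_mem c hu)

/-! ### Integrality of `φ` -/

theorem relSum_base_mem (r : List L3) {u : List LB} (hu : u ∈ regularB) (h0 : u ≠ []) :
    (2 : ℚ) ^ (depB u + dep r) • sh (regZero (word u)) (shReg L3.zero L3.one (word r)) ∈
      lattice (u.length + r.length) (depB u + dep r + 1) 1 := by
  have h1 := regZero_mem u hu h0
  have h2 : (2 : ℚ) ^ dep r • shReg L3.zero L3.one (word r) ∈ lattice r.length (dep r + 1) 0 :=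
    shReg_mem_lattice (by omega) (by omega)
  have := sh_mem_lattice h1 h2
  rwa [map_smul, map_smul, LinearMap.smul_apply, smul_smul, ← pow_add, add_comm (dep r)] at this

theorem relSum_nil (r : List L3) :
    sh (regZero (word [])) (shReg L3.zero L3.one (word r)) = shReg L3.zero L3.one (word r) := by
  rw [word_nil, regZero_one, sh_one_left]

theorem relSum_base_mem' (r : List L3) {u : List LB} (hu : u ∈ regularB) :
    (2 : ℚ) ^ (depB u + dep r) • sh (regZero (word u)) (shReg L3.zero L3.one (word r)) ∈
      lattice (u.length + r.length) (depB u + dep r + 1) 0 := by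
  by_cases h0 : u = []
  · rw [h0, relSum_nil, List.length_nil, zero_add]
    exact shReg_mem_lattice (by simp) (by simp)
  · exact lattice_mono le_rfl (by omega) (relSum_base_mem r hu h0)

theorem depB_le_of_sublist {u v : List LB} (h : v.Sublist u) : depB v ≤ depB u :=
  h.countP_le

/-- Depth never increases when `∂_c` is traded for the letter `e_c`. -/
theorem depB_add_dep_le {c : L3} {u v : List LB} (r : List L3) (h : v ∈ deletions u)
    (hc : c ≠ L3.zero → depB v + 1 = depB u) : depB v + dep (c :: r) ≤ depB u + dep r := by
  have := depB_le_of_sublist h.1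
  rw [dep, List.countP_cons, ← dep]
  by_cases h0 : c = L3.zero
  · rw [if_neg (by simp [h0])]; omega
  · have := hc h0
    rw [if_pos (by simp [h0])]; omega

/-- `φ` preserves integral combinations of normalized words. -/
theorem relSum_mem_lattice (N : ℕ) (r : List L3) {u : List LB} (hu : u ∈ regularB)
    (hN : u.length = N) : (2 : ℚ) ^ (depB u + dep r) • relSum N r (word u) ∈
      lattice (N + r.length) (depB u + dep r + 1) 0 := by
  induction N generalizing r u with
  | zero =>
    have := relSum_base_mem' r hu
    rwa [hN] at this
  | succ N ih =>
    rw [relSum_succ, smul_add, Finset.smul_sum]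
    refine add_mem (by have := relSum_base_mem' r hu; rwa [hN] at this) (sum_mem fun c _ => ?_)
    refine map_mem_of_wordSpan ((2 : ℚ) ^ (depB u + dep r) • relSum N (c :: r)) _ ?_
      (partialAt_mem c hu)
    rintro v ⟨hv, hvr, hd⟩
    have h1 := ih (c :: r) hvr (by have := hv.2; omega)
    have h2 := depB_add_dep_le r hv hd
    obtain ⟨i, hi⟩ := Nat.exists_eq_add_of_le h2
    rw [LinearMap.smul_apply, hi, add_comm _ i, pow_add, mul_smul]
    refine natPow_smul_mem _ _ ?_
    rw [List.length_cons, ← add_assoc, add_right_comm] at h1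
    exact lattice_mono (by omega) le_rfl h1

/-- Words without the letter `-1` are related, modulo twice the lattice, to integral combinations
of normalized words in `e_0, e_{-1}` only. -/
theorem relSum_mem_of_neg_notMem {n k : ℕ} {T : AddSubgroup A3} (hT : lattice k (n + 1) 1 ≤ T)
    (hT' : ∀ w : List L3, L3.one ∉ w → w.length = k → dep w ≤ n →
      (2 : ℚ) ^ dep w • word w ∈ T)
    (N : ℕ) (r : List L3) {u : List LB} (hu : u ∈ regularB)
    (hN : u.length = N) (hneg : LB.neg ∉ u) (hr : L3.one ∉ r) (hk : N + r.length = k)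
    (hn : depB u + dep r ≤ n) :
    (2 : ℚ) ^ (depB u + dep r) • relSum N r (word u) ∈ T := by
  have hbase : ∀ (r : List L3) (u : List LB), u ∈ regularB → L3.one ∉ r →
      u.length + r.length = k → depB u + dep r ≤ n → (2 : ℚ) ^ (depB u + dep r) •
        sh (regZero (word u)) (shReg L3.zero L3.one (word r)) ∈ T := by
    intro r u hu hr hk hn
    by_cases h0 : u = []
    · subst h0
      rw [relSum_nil]
      refine map_mem_of_wordSpan ((2 : ℚ) ^ (depB [] + dep r) • LinearMap.id) _ (fun w hw => ?_)
        (shReg_word_mem L3.zero L3.one r)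
      have hw : w.Perm r := hw
      have h1 : dep w = dep r := hw.countP_eq _
      have := hT' w (fun h => hr (hw.subset h)) (by rw [hw.length_eq]; simpa using hk)
        (by rw [h1]; simpa using hn)
      simpa [h1] using this
    · refine hT ?_
      have := relSum_base_mem r hu h0
      rw [hk] at this
      exact lattice_mono (by omega) le_rfl this
  induction N generalizing r u with
  | zero => exact hbase r u hu hr (by rw [hN, hk]) hn
  | succ N ih =>
    rw [relSum_succ, smul_add, Finset.smul_sum]
    refine add_mem (hbase r u hu hr (by rw [hN, hk]) hn) (sum_mem fun c _ => ?_)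
    by_cases hc : c = L3.one
    · have : partialAt c (word u) = 0 := by
        rw [partialAt_word, hc]
        refine partialAux_eq_zero_of_isChain _ _ _ ?_
        refine List.Pairwise.isChain ?_
        rw [List.pairwise_iff_forall_sublist]
        intro a b hab
        have hx : ∀ x ∈ LB.zero :: (u ++ [LB.z]), x ≠ LB.neg := by
          rintro x hx rfl
          simp at hx
          exact hneg hx
        have ha := hx a (hab.subset (by simp))
        have hb := hx b (hab.subset (by simp))
        cases a <;> cases b <;> simp_all [ordTable]
      rw [this, map_zero, smul_zero]
      exact zero_mem _
    refine map_mem_of_wordSpan ((2 : ℚ) ^ (depB u + dep r) • relSum N (c :: r)) _ ?_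
      (partialAt_mem c hu)
    rintro v ⟨hv, hvr, hd⟩
    have h2 := depB_add_dep_le r hv hd
    have hlen : v.length = N := by have := hv.2; omega
    have hvneg : LB.neg ∉ v := fun h => hneg (hv.1.subset h)
    have hcr : L3.one ∉ c :: r := by simp [hr, Ne.symm hc]
    have h1 := ih (c :: r) hvr hlen hvneg hcr (by simp; omega) (by omega)
    obtain ⟨i, hi⟩ := Nat.exists_eq_add_of_le h2
    rw [LinearMap.smul_apply, hi, add_comm _ i, pow_add, mul_smul]
    exact natPow_smul_mem _ _ h1

end Recursion

/-! ### Confluence relations for words without the letter `z` -/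

section Congruences

/-- The words obtained from `w` by removing one letter different from `e_0`. -/
def drops (w : List LB) : Set (List LB) := {v | v ∈ deletions w ∧ depB v + 1 = depB w}

theorem cons_mem_drops {a : LB} {u v : List LB} (h : v ∈ drops u) : a :: v ∈ drops (a :: u) := by
  obtain ⟨⟨h1, h2⟩, h3⟩ := h
  refine ⟨⟨h1.cons_cons a, by simp [h2]⟩, ?_⟩
  simp only [depB, List.countP_cons] at h3 ⊢
  omega

theorem tail_mem_drops {a : LB} (ha : a ≠ LB.zero) (u : List LB) : u ∈ drops (a :: u) :=
  ⟨⟨List.sublist_cons_self a u, rfl⟩, by simp [depB, ha]⟩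

/-- The integral combinations of the words obtained from `w` by removing a letter different from
`e_0`, and of twice the words obtained by removing any letter. -/
def evenDeletions (w : List LB) : AddSubgroup AB :=
  AddSubgroup.closure {x | ∃ v ∈ deletions w,
    (depB v + 1 = depB w ∧ x = word v) ∨ x = (2 : ℚ) • word v}

theorem ι_mul_mem_evenDeletions (a : LB) {w : List LB} {x : AB} (hx : x ∈ evenDeletions w) :
    FreeAlgebra.ι ℚ a * x ∈ evenDeletions (a :: w) := by
  have : evenDeletions w ≤ (evenDeletions (a :: w)).comap
      (LinearMap.mulLeft ℚ (FreeAlgebra.ι ℚ a)).toAddMonoidHom := by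
    rw [evenDeletions, AddSubgroup.closure_le]
    rintro _ ⟨v, hv, ⟨hd, rfl⟩ | rfl⟩
    · refine AddSubgroup.subset_closure ⟨a :: v, ⟨hv.1.cons_cons a, by simp [hv.2]⟩,
        Or.inl ⟨(cons_mem_drops (a := a) ⟨hv, hd⟩).2, ?_⟩⟩
      simp
    · refine AddSubgroup.subset_closure ⟨a :: v, ⟨hv.1.cons_cons a, by simp [hv.2]⟩, Or.inr ?_⟩
      simp
  exact this hx

/-- `ord_{z=0}` is even on all pairs of letters other than `z`; therefore, modulo `2` and up to
words of smaller depth, `∂_0` only removes a final letter `e_0`. -/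
theorem partialAux_zero_mem_evenDeletions (prev : LB) (hprev : prev ≠ LB.z) (u : List LB) (a : LB)
    (hu : LB.z ∉ u ++ [a]) : partialAux L3.zero prev (u ++ [a]) -
      (if a = LB.zero then word u else 0) ∈ evenDeletions (u ++ [a]) := by
  induction u generalizing prev with
  | nil =>
    rw [List.nil_append, partialAux_cons]
    by_cases ha : a = LB.zero
    · subst ha
      have h : ∃ j : ℤ, ordTable L3.zero LB.zero LB.z - ordTable L3.zero LB.zero prev =
          1 + 2 * j := by
        cases prev
        · exact ⟨0, rfl⟩
        · exact ⟨0, rfl⟩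
        · exact absurd rfl hprev
        · exact ⟨-1, rfl⟩
      obtain ⟨j, hj⟩ := h
      have := intCast_smul_mem (evenDeletions [LB.zero]) j (AddSubgroup.subset_closure
        ⟨[], ⟨by simp, rfl⟩, Or.inr rfl⟩)
      convert this using 1
      simp only [List.headD_nil, hj, partialAux]
      push_cast
      rw [mul_zero, add_zero]
      module
    · rw [if_neg ha, partialAux, mul_zero, add_zero, sub_zero]
      exact intCast_smul_mem _ _ (AddSubgroup.subset_closure
        ⟨[], (tail_mem_drops ha []).1, Or.inl ⟨(tail_mem_drops ha []).2, rfl⟩⟩)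
  | cons b u ih =>
    have hbz : b ≠ LB.z := fun h => hu (by simp [h])
    have hu' : LB.z ∉ u ++ [a] := fun h => hu (by simp at h ⊢; tauto)
    have h1 := ι_mul_mem_evenDeletions b (ih b hbz hu')
    rw [List.cons_append, partialAux_cons, add_sub_assoc]
    refine add_mem ?_ (by
      convert h1 using 1
      rw [mul_sub]
      split_ifs <;> simp)
    by_cases hb : b = LB.zero
    · subst hb
      obtain ⟨d, t, hd⟩ : ∃ d t, u ++ [a] = d :: t := by
        cases u with
        | nil => exact ⟨a, [], rfl⟩
        | cons d u => exact ⟨d, u ++ [a], rfl⟩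
      have hdz : d ≠ LB.z := fun h => hu' (by simp [hd, h])
      have h : ∃ j : ℤ, ordTable L3.zero LB.zero ((u ++ [a]).headD LB.z) -
          ordTable L3.zero LB.zero prev = 2 * j := by
        rw [hd, List.headD_cons]
        cases d <;> cases prev <;> simp_all [ordTable] <;> first
          | exact ⟨0, rfl⟩ | exact ⟨1, rfl⟩ | exact ⟨-1, rfl⟩
      obtain ⟨j, hj⟩ := h
      have := intCast_smul_mem (evenDeletions (LB.zero :: (u ++ [a]))) j
        (AddSubgroup.subset_closure ⟨u ++ [a], ⟨List.sublist_cons_self _ _, rfl⟩, Or.inr rfl⟩)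
      convert this using 1
      rw [hj, smul_smul]
      push_cast
      rw [mul_comm]
    · exact intCast_smul_mem _ _ (AddSubgroup.subset_closure
        ⟨_, (tail_mem_drops hb _).1, Or.inl ⟨(tail_mem_drops hb _).2, rfl⟩⟩)

/-- For words without the letter `z`, `φ` agrees with the evaluation at `z = 1` modulo twice the
lattice of normalized words. -/
theorem relSum_sub_mem (N : ℕ) (r : List L3) {u : List LB} (hu : u ∈ regularB)
    (hN : u.length = N) (hz : LB.z ∉ u) : (2 : ℚ) ^ (depB u + dep r) •
      (relSum N r (word u) - shReg L3.zero L3.one (word (u.map LB.atOne ++ r))) ∈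
        lattice (N + r.length) (depB u + dep r + 1) 1 := by
  induction N generalizing r u with
  | zero =>
    obtain rfl := List.length_eq_zero_iff.1 hN
    rw [relSum_zero, relSum_nil, List.map_nil, List.nil_append, sub_self, smul_zero]
    exact zero_mem _
  | succ N ih =>
    obtain ⟨u', a, rfl⟩ := (List.eq_nil_or_concat u).resolve_left (by rintro rfl; simp at hN)
    rw [List.concat_eq_append] at *
    set u := u' ++ [a] with hu'
    set n := depB u + dep r with hn
    -- the error made by replacing `φ` by evaluation at `z = 1` after one application of `∂_c`
    let E : L3 → AB →ₗ[ℚ] A3 := fun c => (2 : ℚ) ^ n • (relSum N (c :: r) -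
      shReg L3.zero L3.one ∘ₗ LinearMap.mulRight ℚ (word (c :: r)) ∘ₗ evalOne.toLinearMap)
    have hE : ∀ c, E c (partialAt c (word u)) ∈ lattice (N + 1 + r.length) (n + 1) 1 := by
      intro c
      refine map_mem_of_wordSpan (E c) _ ?_ (partialAt_mem c hu)
      rintro v ⟨hv, hvr, hd⟩
      have h1 := ih (c :: r) hvr (by have := hv.2; omega) (fun h => hz (hv.1.subset h))
      have h2 := depB_add_dep_le r hv hd
      obtain ⟨i, hi⟩ := Nat.exists_eq_add_of_le h2
      have h3 := natPow_smul_mem _ i h1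
      rw [smul_smul, ← pow_add, add_comm i, ← hi, List.length_cons, ← add_assoc,
        add_right_comm] at h3
      have h4 : E c (word v) = (2 : ℚ) ^ n • (relSum N (c :: r) (word v) -
          shReg L3.zero L3.one (word (v.map LB.atOne ++ c :: r))) := by
        rw [word_append, ← evalOne_word]; rfl
      rw [h4]
      exact lattice_mono (by omega) le_rfl h3
    have hneg : evalOne (partialAt L3.neg (word u)) =
        if a = LB.zero then 0 else word (u'.map LB.atOne) := by
      have h := evalOne_partialAux L3.neg (by decide) LB.zero u' a hz
      have haz : a ≠ LB.z := fun h => hz (by simp [hu', h])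
      have h0 : ordTable L3.neg ((u' ++ [a]).headD LB.z) LB.zero = 0 := by
        cases (u' ++ [a]).headD LB.z <;> rfl
      rw [h0, Int.cast_zero, zero_smul, add_zero, ← partialAt_word] at h
      rw [h]
      cases a <;> simp_all [ordTable]
    have hone : evalOne (partialAt L3.one (word u)) = 0 := by
      have h := evalOne_partialAux L3.one (by decide) LB.zero u' a hz
      have h0 : ordTable L3.one ((u' ++ [a]).headD LB.z) LB.zero = 0 := by
        cases (u' ++ [a]).headD LB.z <;> rfl
      rw [h0, Int.cast_zero, zero_smul, add_zero, ← partialAt_word] at h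
      rw [h]
      cases a <;> simp [ordTable]
    let F : AB →ₗ[ℚ] A3 := (2 : ℚ) ^ n •
      (shReg L3.zero L3.one ∘ₗ LinearMap.mulRight ℚ (word (L3.zero :: r)) ∘ₗ evalOne.toLinearMap)
    have hFw : ∀ v, F (word v) = (2 : ℚ) ^ n •
        shReg L3.zero L3.one (word (v.map LB.atOne ++ L3.zero :: r)) := fun v => by
      rw [word_append, ← evalOne_word]; rfl
    have hF : F (partialAt L3.zero (word u) - if a = LB.zero then word u' else 0) ∈
        lattice (N + 1 + r.length) (n + 1) 1 := by
      have h : evenDeletions u ≤ (lattice (N + 1 + r.length) (n + 1) 1).comap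
          F.toAddMonoidHom := by
        rw [evenDeletions, AddSubgroup.closure_le]
        rintro y ⟨v, hv, hd⟩
        suffices F y ∈ lattice (N + 1 + r.length) (n + 1) 1 from this
        have hdep : dep (v.map LB.atOne ++ L3.zero :: r) = depB v + dep r := by
          rw [dep, List.countP_append, ← dep, dep_map_atOne]; simp [dep]
        have hlen : (v.map LB.atOne ++ L3.zero :: r).length = N + 1 + r.length := by
          have := hv.2
          simp only [List.length_append, List.length_map, List.length_cons]
          omega
        have hle := depB_le_of_sublist hv.1
        rcases hd with ⟨hd, rfl⟩ | rfl
        · rw [hFw, ← hlen]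
          exact shReg_mem_lattice (by omega) (by omega)
        · rw [map_smul, hFw, smul_smul, ← pow_succ', ← hlen]
          exact shReg_mem_lattice (by omega) (by omega)
      refine h ?_
      rw [partialAt_word]
      exact partialAux_zero_mem_evenDeletions _ (by decide) u' a hz
    have hbase := relSum_base_mem r hu (by simp [hu'])
    rw [hN, ← hn] at hbase
    have hsum := add_mem (add_mem hbase (sum_mem (t := Finset.univ) fun c _ => hE c)) hF
    convert hsum using 1
    rw [relSum_succ, sum_letters, sum_letters]
    have hword : word (u.map LB.atOne ++ r) =
        word (u'.map LB.atOne) * word (a.atOne :: r) := by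
      rw [← word_append, hu']; simp
    have hEc : ∀ c, E c (partialAt c (word u)) = (2 : ℚ) ^ n • (relSum N (c :: r)
      (partialAt c (word u)) - shReg L3.zero L3.one (evalOne (partialAt c (word u)) *
        word (c :: r))) := fun c => rfl
    have hFx : ∀ x, F x = (2 : ℚ) ^ n •
      shReg L3.zero L3.one (evalOne x * word (L3.zero :: r)) := fun x => rfl
    rw [hEc, hEc, hEc, hFx, hneg, hone, hword, map_sub, sub_mul, map_sub, zero_mul, map_zero]
    have haz : a ≠ LB.z := fun h => hz (by simp [hu', h])
    by_cases ha : a = LB.zero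
    · subst ha
      rw [if_pos rfl, if_pos rfl, evalOne_word, zero_mul, map_zero]
      simp only [LB.atOne]
      module
    · have : a.atOne = L3.neg := by cases a <;> simp_all [LB.atOne]
      rw [if_neg ha, if_neg ha, map_zero, zero_mul, map_zero, this]
      module

theorem mem_regularB_of_z_notMem {u : List LB} (h : u.head? ≠ some LB.zero) (hz : LB.z ∉ u) :
    u ∈ regularB :=
  ⟨h, fun h' => hz (List.mem_of_getLast? h')⟩

/-- For words in `0, -1` the sum `φ` consists of a single term. -/
theorem relSum_of_letters (N : ℕ) (r : List L3) {u : List LB} (hN : u.length = N)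
    (hh : u.head? ≠ some LB.zero) (hu : ∀ x ∈ u, x = LB.zero ∨ x = LB.neg) :
    relSum N r (word u) = shReg L3.zero L3.one (word (u.map LB.atOne ++ r)) := by
  induction N generalizing r u with
  | zero =>
    obtain rfl := List.length_eq_zero_iff.1 hN
    rw [relSum_zero, relSum_nil, List.map_nil, List.nil_append]
  | succ N ih =>
    have hneg : LB.neg ∈ u := by
      match u with
      | [] => simp at hN
      | b :: t =>
        have := hu b (by simp)
        simp_all
    obtain ⟨u', a, rfl⟩ := (List.eq_nil_or_concat u).resolve_left (by rintro rfl; simp at hN)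
    rw [List.concat_eq_append] at *
    have hpart : ∀ c, partialAt c (word (u' ++ [a])) = (ordTable c a LB.z : ℚ) • word u' := by
      intro c
      rw [partialAt_word]
      refine partialAux_of_isChain _ _ _ _ (List.Pairwise.isChain ?_)
      rw [List.pairwise_iff_forall_sublist]
      intro x y hxy
      have h : ∀ x ∈ LB.zero :: (u' ++ [a]), x = LB.zero ∨ x = LB.neg := by
        intro x hx
        rcases List.mem_cons.1 hx with rfl | hx
        · exact Or.inl rfl
        · exact hu x hx
      rcases h x (hxy.subset (by simp)) with rfl | rfl <;>
        rcases h y (hxy.subset (by simp)) with rfl | rfl <;> cases c <;> simp [ordTable]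
    have hu'h : u'.head? ≠ some LB.zero := by
      intro h
      apply hh
      rw [List.head?_append, h]; rfl
    have ih' := fun r => ih r (by simpa using hN) hu'h (fun x hx => hu x (by simp [hx]))
    rw [relSum_succ, regZero_of_mem hneg, map_zero, LinearMap.zero_apply, zero_add, sum_letters]
    simp only [hpart, map_smul, ih']
    rcases hu a (by simp) with rfl | rfl <;> simp [ordTable, LB.atOne]

/-- Minus the word without its final letter, if that letter is `e_0`. -/
noncomputable def negDropZero (x : List LB) : AB :=
  if x.getLast? = some LB.zero then -word x.dropLast else 0

theorem negDropZero_cons (a b : LB) (t : List LB) :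
    negDropZero (a :: b :: t) = FreeAlgebra.ι ℚ a * negDropZero (b :: t) := by
  rw [negDropZero, negDropZero, List.getLast?_cons_cons, List.dropLast_cons_cons, word_cons]
  split_ifs <;> simp

/-- In a run of letters `e_0` between two letters `-z²` the first and the last deletion cancel. -/
theorem partialAux_zero_letters (prev : LB) (hprev : prev = LB.zero ∨ prev = LB.negSq)
    (x : List LB) (hx : ∀ a ∈ x, a = LB.zero ∨ a = LB.negSq) :
    partialAux L3.zero prev x - negDropZero x -
      (if prev = LB.zero ∧ x.head? = some LB.zero then (2 : ℚ) • word x.tail else 0) ∈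
        wordSpan (drops x) := by
  induction x generalizing prev with
  | nil => simp [partialAux, negDropZero]
  | cons a y ih =>
    have hy : ∀ a ∈ y, a = LB.zero ∨ a = LB.negSq := fun b hb => hx b (by simp [hb])
    have hmul : ∀ {d}, d ∈ wordSpan (drops y) → FreeAlgebra.ι ℚ a * d ∈
        wordSpan (drops (a :: y)) := fun h => ι_mul_mem_wordSpan a (fun u hu => cons_mem_drops hu) h
    rw [partialAux_cons]
    rcases hx a (by simp) with rfl | rfl
    · have h1 := hmul (ih LB.zero (Or.inl rfl) hy)
      convert h1 using 1
      match y with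
      | [] =>
        rcases hprev with rfl | rfl
        · simp [partialAux, negDropZero, ordTable, two_smul]
        · simp [partialAux, negDropZero, ordTable]
      | b :: t =>
        rw [negDropZero_cons]
        rcases hprev with rfl | rfl <;> rcases hy b (by simp) with rfl | rfl <;>
          simp [ordTable, mul_sub] <;> abel
    · have h1 := hmul (ih LB.negSq (Or.inr rfl) hy)
      rw [if_neg (by simp), sub_zero, mul_sub] at h1
      rw [if_neg (by simp), sub_zero, add_sub_assoc]
      refine add_mem (intCast_smul_mem _ _ (word_mem_wordSpan (tail_mem_drops (by decide) y))) ?_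
      convert h1 using 2
      match y with
      | [] => simp [negDropZero]
      | b :: t => exact negDropZero_cons _ _ _

theorem partialAux_zero_append (prev : LB) (hprev : prev = LB.zero ∨ prev = LB.neg)
    (p y : List LB) (hp : ∀ a ∈ p, a = LB.zero ∨ a = LB.neg)
    (hy : ∀ a ∈ y, a = LB.zero ∨ a = LB.negSq) :
    partialAux L3.zero prev (p ++ LB.negSq :: y) - word p * negDropZero (LB.negSq :: y) -
      (if p.getLast? = some LB.zero then (2 : ℚ) • (word (p.dropLast ++ LB.negSq :: y)) else 0) ∈
        wordSpan (drops (p ++ LB.negSq :: y)) := by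
  induction p generalizing prev with
  | nil =>
    have h1 := ι_mul_mem_wordSpan LB.negSq (fun u hu => cons_mem_drops hu)
      (partialAux_zero_letters LB.negSq (Or.inr rfl) y hy)
    rw [if_neg (by simp), sub_zero, mul_sub] at h1
    rw [List.nil_append, partialAux_cons, word_nil, one_mul, if_neg (by simp), sub_zero,
      add_sub_assoc]
    refine add_mem (intCast_smul_mem _ _ (word_mem_wordSpan (tail_mem_drops (by decide) y))) ?_
    convert h1 using 2
    match y with
    | [] => simp [negDropZero]
    | b :: t => exact negDropZero_cons _ _ _
  | cons a p ih =>
    have hp' : ∀ a ∈ p, a = LB.zero ∨ a = LB.neg := fun b hb => hp b (by simp [hb])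
    have ha := hp a (by simp)
    have h1 := ι_mul_mem_wordSpan a (fun u hu => cons_mem_drops hu) (ih a ha hp')
    rw [List.cons_append, partialAux_cons]
    convert h1 using 1
    match p with
    | [] =>
      rcases ha with rfl | rfl <;> rcases hprev with rfl | rfl <;>
        simp [ordTable, mul_sub] <;> abel
    | b :: t =>
      have hc : ordTable L3.zero a (((b :: t) ++ LB.negSq :: y).headD LB.z) -
          ordTable L3.zero a prev = 0 := by
        rcases ha with rfl | rfl <;> rcases hprev with rfl | rfl <;>
          rcases hp' b (by simp) with rfl | rfl <;> rfl
      rw [hc, List.getLast?_cons_cons, List.dropLast_cons_cons, word_cons, mul_sub, mul_sub,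
        mul_assoc]
      split_ifs <;> simp

end Congruences

/-! ### Confluence relations for words with a splitting into `0, -1` and `0, -z²` -/

section Splitting

theorem partialAt_append_of_ne_zero {c : L3} (hc : c ≠ L3.zero) {p q : List LB} (a : LB)
    (hp : ∀ x ∈ p, x = LB.zero ∨ x = LB.neg) (hp' : p = [] ∨ p.getLast? = some LB.zero)
    (hq : ∀ x ∈ q ++ [a], x = LB.zero ∨ x = LB.negSq) :
    partialAt c (word (p ++ (q ++ [a]))) = (ordTable c a LB.z : ℚ) • word (p ++ q) := by
  rw [partialAt_word, ← List.append_assoc]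
  refine partialAux_of_isChain _ _ _ _ ?_
  rw [List.append_assoc, ← List.cons_append, List.isChain_append]
  refine ⟨List.Pairwise.isChain ?_, List.Pairwise.isChain ?_, ?_⟩
  · rw [List.pairwise_iff_forall_sublist]
    intro x y hxy
    have h : ∀ x ∈ LB.zero :: p, x = LB.zero ∨ x = LB.neg := by
      intro x hx
      rcases List.mem_cons.1 hx with rfl | hx
      · exact Or.inl rfl
      · exact hp x hx
    rcases h x (hxy.subset (by simp)) with rfl | rfl <;>
      rcases h y (hxy.subset (by simp)) with rfl | rfl <;> cases c <;> simp [ordTable]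
  · rw [List.pairwise_iff_forall_sublist]
    intro x y hxy
    rcases hq x (hxy.subset (by simp)) with rfl | rfl <;>
      rcases hq y (hxy.subset (by simp)) with rfl | rfl <;> cases c <;> simp_all [ordTable]
  · intro x hx y _
    have hx0 : x = LB.zero := by
      rcases hp' with rfl | h
      · simpa using hx.symm
      · rw [List.getLast?_cons, h] at hx
        simpa using hx.symm
    subst hx0
    cases c
    · exact absurd rfl hc
    · cases y <;> exact ⟨rfl, rfl⟩
    · cases y <;> exact ⟨rfl, rfl⟩

/-- `∂_0`, applied to a word `p` in `0, -1` followed by a word `q` in `0, -z²`: up to words of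
smaller depth, a final `e_0` of `q` is removed with coefficient `-1`, and a final `e_0` of `p` with
coefficient `2`. -/
theorem partialAt_zero_append {p q : List LB} (a : LB)
    (hp : ∀ x ∈ p, x = LB.zero ∨ x = LB.neg)
    (hp' : p = [] ∨ p.head? = some LB.neg ∧ p.getLast? = some LB.zero)
    (hq : ∀ x ∈ q ++ [a], x = LB.zero ∨ x = LB.negSq)
    (hq' : (q ++ [a]).head? = some LB.negSq) :
    partialAt L3.zero (word (p ++ (q ++ [a]))) +
      (if a = LB.zero then word (p ++ q) else 0) -
      (if p = [] then 0 else (2 : ℚ) • word (p.dropLast ++ (q ++ [a]))) ∈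
      wordSpan (drops (p ++ (q ++ [a])) ∩ regularB) := by
  have hzp : LB.z ∉ p := fun h => by simpa using hp _ h
  have hzq : LB.z ∉ q ++ [a] := fun h => by simpa using hq _ h
  obtain ⟨y, hy⟩ : ∃ y, q ++ [a] = LB.negSq :: y := by
    match h : q ++ [a] with
    | [] => simp at h
    | b :: y =>
      rw [h] at hq'
      exact ⟨y, by simpa using hq'⟩
  have h1 := partialAux_zero_append LB.zero (Or.inl rfl) p y hp
    (fun b hb => hq b (by rw [hy]; simp [hb]))
  rw [← hy, ← partialAt_word] at h1
  have e1 : word p * negDropZero (q ++ [a]) = -(if a = LB.zero then word (p ++ q) else 0) := by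
    rw [negDropZero, List.getLast?_concat, List.dropLast_concat]
    by_cases ha : a = LB.zero <;> simp [ha, word_append]
  have e2 : (if p.getLast? = some LB.zero then
      (2 : ℚ) • (word (p.dropLast ++ (q ++ [a]))) else 0) =
      (if p = [] then 0 else (2 : ℚ) • word (p.dropLast ++ (q ++ [a]))) := by
    rcases hp' with rfl | ⟨-, h⟩
    · simp
    · have : p ≠ [] := by rintro rfl; simp at h
      rw [if_pos h, if_neg this]
  rw [e1, e2, sub_neg_eq_add] at h1
  set x := partialAt L3.zero (word (p ++ (q ++ [a]))) +
      (if a = LB.zero then word (p ++ q) else 0) -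
      (if p = [] then 0 else (2 : ℚ) • word (p.dropLast ++ (q ++ [a])))
  have hu : p ++ (q ++ [a]) ∈ regularB := by
    refine mem_regularB_of_z_notMem ?_ (by simp at hzq ⊢; tauto)
    rcases hp' with rfl | ⟨h, -⟩
    · rw [List.nil_append, hq']; simp
    · rw [List.head?_append, h]; simp
  have hreg : x ∈ regularSub LB.zero LB.z := by
    refine sub_mem (add_mem ?_ ?_) ?_
    · exact map_mem_of_wordSpan LinearMap.id (regularSub LB.zero LB.z).toAddSubgroup
        (fun v hv => word_mem_regularSub hv.2.1.1 hv.2.1.2) (partialAt_mem L3.zero hu)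
    · split_ifs
      · have : p ++ q ∈ regularB := by
          refine mem_regularB_of_z_notMem (fun h => hu.1 ?_) (by simp at hzq ⊢; tauto)
          rw [← List.append_assoc, List.head?_append, h]; rfl
        exact word_mem_regularSub this.1 this.2
      · exact zero_mem _
    · split_ifs with hp0
      · exact zero_mem _
      · have : p.dropLast ++ (q ++ [a]) ∈ regularB := by
          refine mem_regularB_of_z_notMem (fun h => ?_) (fun h => ?_)
          · obtain ⟨h2, h3⟩ := hp'.resolve_left hp0
            match p with
            | [] => exact hp0 rfl
            | [b] => simp_all
            | b :: b' :: p =>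
              simp at h h2
              simp [h] at h2
          · rcases List.mem_append.1 h with h | h
            · exact hzp (List.mem_of_mem_dropLast h)
            · exact hzq h
        exact Submodule.smul_mem _ _ (word_mem_regularSub this.1 this.2)
  rw [← truncate_of_mem_regularSub hreg]
  refine map_mem_of_wordSpan (truncate LB.zero LB.z) _ (fun v hv => ?_) h1
  rw [truncate, onWords_word]
  split_ifs with h
  · exact word_mem_wordSpan ⟨hv, h⟩
  · exact zero_mem _

/-- Substituting `-1` for the letters `e_{-1}` in the first part `p` of a word, and `-z²` in the
second part `q`, changes the sign of the leading term of `φ` by the parity of the number of letters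
`e_0` in `q`. The errors are four times the lattice, twice the lattice of smaller depth, and twice
words in which a letter `e_0` is replaced by `e_{-1}` at the first place where they differ. -/
theorem relSum_split_mem {T : AddSubgroup A3} (w : List L3)
    (h2 : lattice w.length (dep w + 1) 2 ≤ T) (h1 : lattice w.length (dep w) 1 ≤ T)
    (hlex : ∀ s t t' : List L3, w = s ++ L3.zero :: t → t'.length = t.length →
      dep (s ++ L3.neg :: t') = dep w → L3.one ∉ s ++ L3.neg :: t' →
      (s ++ L3.neg :: t').head? ≠ some L3.zero →
      (2 : ℚ) ^ (dep w + 1) • word (s ++ L3.neg :: t') ∈ T)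
    (p : List LB) (hp : ∀ x ∈ p, x = LB.zero ∨ x = LB.neg)
    (hp' : p = [] ∨ p.head? = some LB.neg ∧ p.getLast? = some LB.zero)
    (N : ℕ) (r : List L3) (q : List LB)
    (hq : ∀ x ∈ q, x = LB.zero ∨ x = LB.negSq) (hq' : q = [] ∨ q.head? = some LB.negSq)
    (hpq : p = [] → q.length ≤ 1 ∨ ∃ t, q = LB.negSq :: LB.negSq :: t)
    (hN : (p ++ q).length = N) (hw : (p ++ q).map LB.atOne ++ r = w) (hr : L3.one ∉ r) :
    (2 : ℚ) ^ dep w • (relSum N r (word (p ++ q)) -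
      (-1 : ℚ) ^ q.count LB.zero • shReg L3.zero L3.one (word w)) ∈ T := by
  -- when no letter of `q` is left, only the term of `relSum_of_letters` remains
  have hnil : ∀ (N : ℕ) (r : List L3) (q : List LB), (p ++ q).length = N →
      (p ++ q).map LB.atOne ++ r = w → q = [] → (2 : ℚ) ^ dep w • (relSum N r (word (p ++ q)) -
        (-1 : ℚ) ^ q.count LB.zero • shReg L3.zero L3.one (word w)) ∈ T := by
    rintro N r q hN hw rfl
    rw [List.append_nil] at *
    rw [relSum_of_letters N r hN (by rcases hp' with rfl | ⟨h, -⟩ <;> simp_all) hp, hw]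
    simp
  induction N generalizing r q with
  | zero =>
    exact hnil _ r q hN hw (List.append_eq_nil_iff.1 (List.length_eq_zero_iff.1 hN)).2
  | succ M ih =>
    by_cases hq0 : q = []
    · exact hnil _ r q hN hw hq0
    have hqh := hq'.resolve_left hq0
    obtain ⟨q', a, rfl⟩ := (List.eq_nil_or_concat q).resolve_left hq0
    rw [List.concat_eq_append] at *
    have ha := hq a (by simp)
    have hlen : M + 1 + r.length = w.length := by
      rw [← hw, List.length_append, List.length_map, hN]
    have hdep : depB (p ++ (q' ++ [a])) + dep r = dep w := by
      rw [← hw, dep, dep, List.countP_append, ← dep, ← dep, dep_map_atOne]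
    have hreg : p ++ (q' ++ [a]) ∈ regularB := by
      refine mem_regularB_of_z_notMem ?_ (fun h => ?_)
      · rcases hp' with rfl | ⟨h, -⟩
        · rw [List.nil_append, hqh]; simp
        · rw [List.head?_append, h]; simp
      · rcases List.mem_append.1 h with h | h
        · simpa using hp _ h
        · simpa using hq _ h
    -- the term without operators `∂_c`
    have hbase : (2 : ℚ) ^ dep w • sh (regZero (word (p ++ (q' ++ [a]))))
        (shReg L3.zero L3.one (word r)) ∈ T := by
      rcases hp' with rfl | ⟨h, -⟩
      · refine h2 ?_
        rw [List.nil_append] at *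
        have hcase : 2 ≤ depB (q' ++ [a]) ∨ (q' ++ [a]).length = 1 := by
          rcases hpq rfl with h | ⟨t, ht⟩
          · right; simp at h ⊢; exact h
          · left; rw [ht]; simp [depB]
        have h3 := (wp_scale_mem _ hqh).2 hcase
        have h4 : (2 : ℚ) ^ dep r • shReg L3.zero L3.one (word r) ∈
            lattice r.length (dep r + 1) 0 := shReg_mem_lattice (by omega) (by omega)
        have h5 := sh_mem_lattice h3 h4
        rw [map_smul, map_smul, LinearMap.smul_apply, smul_smul, ← pow_add, add_comm (dep r),
          hdep, hN, hlen] at h5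
        rw [regZero_of_letters hq]
        exact h5
      · rw [regZero_of_mem (List.mem_append_left _ (List.mem_of_mem_head? h)), map_zero,
          LinearMap.zero_apply, smul_zero]
        exact zero_mem _
    -- the words of smaller depth in `∂_0`
    set d := partialAt L3.zero (word (p ++ (q' ++ [a]))) +
      (if a = LB.zero then word (p ++ q') else 0) -
      (if p = [] then 0 else (2 : ℚ) • word (p.dropLast ++ (q' ++ [a]))) with hd
    have hdT : (2 : ℚ) ^ dep w • relSum M (L3.zero :: r) d ∈ T := by
      refine map_mem_of_wordSpan ((2 : ℚ) ^ dep w • relSum M (L3.zero :: r)) T ?_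
        (partialAt_zero_append a hp hp' hq hqh)
      rintro v ⟨⟨hv, hvd⟩, hvr⟩
      have hr0 : dep (L3.zero :: r) = dep r := by simp [dep]
      have h3 := relSum_mem_lattice M (L3.zero :: r) hvr (by have := hv.2; omega)
      have h4 := two_pow_smul_mem_lattice (n := 1) (e' := 1) (D' := dep w) (by omega) (by omega) h3
      rw [smul_smul, ← pow_add, hr0, show 1 + (depB v + dep r) = dep w by omega,
        List.length_cons, ← add_assoc, add_right_comm, hlen] at h4
      exact h1 h4
    -- the word obtained by removing a final `e_0` of `p`
    have hlower : (2 : ℚ) ^ dep w • relSum M (L3.zero :: r)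
        (if p = [] then 0 else (2 : ℚ) • word (p.dropLast ++ (q' ++ [a]))) ∈ T := by
      split_ifs with hp0
      · rw [map_zero, smul_zero]; exact zero_mem _
      obtain ⟨hph, hpl⟩ := hp'.resolve_left hp0
      obtain ⟨s, b, rfl⟩ := (List.eq_nil_or_concat p).resolve_left hp0
      rw [List.concat_eq_append] at *
      obtain rfl : b = LB.zero := by simpa using hpl
      rw [List.dropLast_concat]
      obtain ⟨y, hy⟩ : ∃ y, q' ++ [a] = LB.negSq :: y := by
        match h : q' ++ [a] with
        | [] => simp at h
        | b :: y =>
          rw [h] at hqh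
          exact ⟨y, by simpa using hqh⟩
      have hsh : s.head? = some LB.neg := by
        match s with
        | [] => simp at hph
        | b :: s => simpa using hph
      have hzs : LB.z ∉ s ++ (q' ++ [a]) := fun h => by
        rcases List.mem_append.1 h with h | h
        · simpa using hp _ (List.mem_append_left _ h)
        · simpa using hq _ h
      have hsr : s ++ (q' ++ [a]) ∈ regularB := by
        refine mem_regularB_of_z_notMem ?_ hzs
        rw [List.head?_append, hsh]; simp
      have hsd : depB (s ++ (q' ++ [a])) + dep (L3.zero :: r) = dep w := by
        rw [← hdep]; simp [depB, dep, List.countP_append]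
      have h3 := relSum_sub_mem M (L3.zero :: r) hsr (by simp at hN ⊢; omega) hzs
      rw [hsd, List.length_cons, ← add_assoc, add_right_comm, hlen] at h3
      have h4 := two_pow_smul_mem_lattice (n := 1) (e' := 2) le_rfl le_rfl h3
      set w' := s.map LB.atOne ++ L3.neg :: (y.map LB.atOne ++ L3.zero :: r) with hw'
      have hww : (s ++ (q' ++ [a])).map LB.atOne ++ L3.zero :: r = w' := by
        rw [hw', hy]; simp [LB.atOne]
      have hone : L3.one ∉ w' := by
        rw [← hww]
        intro h
        rcases List.mem_append.1 h with h | h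
        · obtain ⟨x, hx, hx'⟩ := List.mem_map.1 h
          cases x <;> simp_all [LB.atOne]
        · simp [hr] at h
      have hhead : w'.head? ≠ some L3.zero := by
        rw [← hww, List.map_append, List.append_assoc, List.head?_append, List.head?_map, hsh]
        simp [LB.atOne]
      have h5 := hlex (s.map LB.atOne) (L3.neg :: (y.map LB.atOne ++ r))
        (y.map LB.atOne ++ L3.zero :: r) (by rw [← hw, hy]; simp [LB.atOne])
        (by simp; omega) (by rw [← hw', ← hww, ← hsd, dep, List.countP_append, ← dep,
          dep_map_atOne]) hone hhead
      have hfix : shReg L3.zero L3.one (word w') = word w' :=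
        shReg_of_mem_regularSub (word_mem_regularSub hhead
          (fun h => hone (List.mem_of_getLast? h)))
      rw [hww, hfix] at h4
      have h6 := add_mem (h2 h4) h5
      convert h6 using 1
      rw [map_smul]
      module
    have hone : partialAt L3.one (word (p ++ (q' ++ [a]))) = 0 := by
      rw [partialAt_append_of_ne_zero (by decide) a hp (hp'.imp_right And.right) hq]
      rcases ha with rfl | rfl <;> simp [ordTable]
    have hneg : partialAt L3.neg (word (p ++ (q' ++ [a]))) =
        if a = LB.zero then 0 else word (p ++ q') := by
      rw [partialAt_append_of_ne_zero (by decide) a hp (hp'.imp_right And.right) hq]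
      rcases ha with rfl | rfl <;> simp [ordTable]
    have hzero : partialAt L3.zero (word (p ++ (q' ++ [a]))) =
        d - (if a = LB.zero then word (p ++ q') else 0) +
        (if p = [] then 0 else (2 : ℚ) • word (p.dropLast ++ (q' ++ [a]))) := by
      rw [hd]; abel
    have hih := ih (a.atOne :: r) q' (fun x hx => hq x (by simp [hx]))
      (by
        match q' with
        | [] => exact Or.inl rfl
        | b :: t => right; simpa using hqh)
      (fun h => by
        rcases hpq h with h | ⟨t, ht⟩
        · left; rw [List.length_append, List.length_singleton] at h; omega
        · match q' with
          | [] => left; simp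
          | [b] => left; simp
          | b :: b' :: t' => right; simp at ht; exact ⟨t', by rw [ht.1, ht.2.1]⟩)
      (by simp at hN ⊢; omega) (by rw [← hw]; simp)
      (by rcases ha with rfl | rfl <;> simp [LB.atOne, hr])
    rw [relSum_succ, sum_letters, hone, hneg, hzero, map_zero, zero_add, map_add, map_sub]
    rcases ha with rfl | rfl
    · have := add_mem (sub_mem (add_mem hbase hdT) hih) hlower
      convert this using 1
      rw [if_pos rfl, if_pos rfl, map_zero, List.count_append, List.count_singleton_self, pow_succ]
      simp only [LB.atOne]
      module
    · have := add_mem (add_mem (add_mem hbase hdT) hih) hlower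
      convert this using 1
      have hne : ¬ LB.negSq = LB.zero := by decide
      have hcount : (q' ++ [LB.negSq]).count LB.zero = q'.count LB.zero := by simp
      simp only [if_neg hne, hcount, map_zero, LB.atOne]
      module

end Splitting

/-! ### Words in `e_0, e_{-1}` as sequences of blocks -/

section Blocks

/-- The word `ℓ z^{a₁} ℓ z^{a₂} ⋯`. -/
def blocks {X : Type} (z l : X) (as : List ℕ) : List X :=
  as.flatMap fun a => l :: List.replicate a z

theorem blocks_cons {X : Type} (z l : X) (a : ℕ) (as : List ℕ) :
    blocks z l (a :: as) = l :: (List.replicate a z ++ blocks z l as) := rfl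

theorem blocks_append {X : Type} (z l : X) (as bs : List ℕ) :
    blocks z l (as ++ bs) = blocks z l as ++ blocks z l bs := by
  simp [blocks]

theorem map_blocks {X Y : Type} (f : X → Y) (z l : X) (as : List ℕ) :
    (blocks z l as).map f = blocks (f z) (f l) as := by
  induction as with
  | nil => rfl
  | cons a as ih => rw [blocks_cons, blocks_cons, List.map_cons, List.map_append, ih,
      List.map_replicate]

theorem mem_blocks {X : Type} {z l x : X} {as : List ℕ} (h : x ∈ blocks z l as) :
    x = z ∨ x = l := by
  obtain ⟨a, -, h⟩ := List.mem_flatMap.1 h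
  rcases List.mem_cons.1 h with h | h
  · exact Or.inr h
  · exact Or.inl (List.eq_of_mem_replicate h)

theorem dep_blocks (as : List ℕ) : dep (blocks L3.zero L3.neg as) = as.length := by
  induction as with
  | nil => rfl
  | cons a as ih =>
    rw [dep] at ih
    rw [blocks_cons, dep, List.countP_cons, List.countP_append, ih, List.countP_replicate]
    simp

theorem count_blocks {X : Type} [DecidableEq X] {z l : X} (h : l ≠ z) (as : List ℕ) :
    (blocks z l as).count z = as.sum := by
  induction as with
  | nil => rfl
  | cons a as ih =>
    rw [blocks_cons, List.count_cons_of_ne h, List.count_append, ih, List.count_replicate_self,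
      List.sum_cons]

theorem exists_eq_blocks (w : List L3) (h : L3.one ∉ w) (h0 : w.head? ≠ some L3.zero) :
    ∃ as, w = blocks L3.zero L3.neg as := by
  have key : ∀ w : List L3, L3.one ∉ w →
      ∃ m as, w = List.replicate m L3.zero ++ blocks L3.zero L3.neg as := by
    intro w
    induction w with
    | nil => exact fun _ => ⟨0, [], rfl⟩
    | cons x w ih =>
      intro h
      obtain ⟨m, as, hw⟩ := ih (fun h' => h (by simp [h']))
      cases x with
      | zero => exact ⟨m + 1, as, by rw [hw]; rfl⟩
      | one => simp at h
      | neg => exact ⟨0, m :: as, by rw [hw]; rfl⟩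
  obtain ⟨m, as, hw⟩ := key w h
  cases m with
  | zero => exact ⟨as, by simpa using hw⟩
  | succ m => rw [hw] at h0; simp [List.replicate_succ] at h0

/-- A list with an odd member has a final segment with odd sum before which there is nothing or a
positive number. -/
theorem exists_odd_suffix (bs : List ℕ) (h : ∃ b ∈ bs, Odd b) : ∃ l₁ l₂, bs = l₁ ++ l₂ ∧
    Odd l₂.sum ∧ (l₁ = [] ∨ ∃ l m, l₁ = l ++ [m + 1]) := by
  induction bs with
  | nil => simp at h
  | cons a bs ih =>
    by_cases hb : ∃ b ∈ bs, Odd b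
    · obtain ⟨l₁, l₂, rfl, ho, hl⟩ := ih hb
      rcases hl with rfl | ⟨l, m, rfl⟩
      · rcases Nat.eq_zero_or_eq_succ_pred a with rfl | ha
        · exact ⟨[], 0 :: l₂, rfl, by simpa using ho, Or.inl rfl⟩
        · exact ⟨[a], l₂, rfl, ho, Or.inr ⟨[], a.pred, by
            rw [List.nil_append, ← Nat.succ_eq_add_one,
            ← ha]⟩⟩
      · exact ⟨a :: (l ++ [m + 1]), l₂, rfl, ho, Or.inr ⟨a :: l, m, rfl⟩⟩
    · have ha : Odd a := by
        obtain ⟨b, hb', ho⟩ := h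
        rcases List.mem_cons.1 hb' with rfl | hb'
        · exact ho
        · exact absurd ⟨b, hb', ho⟩ hb
      have hs : Even bs.sum := by
        have : ∀ b ∈ bs, Even b := fun b hb' => Nat.not_odd_iff_even.1 fun ho => hb ⟨b, hb', ho⟩
        clear hb ih h
        induction bs with
        | nil => simp
        | cons b bs ih =>
          rw [List.sum_cons]
          exact (this b (by simp)).add (ih fun x hx => this x (by simp [hx]))
      exact ⟨[], a :: bs, rfl, by rw [List.sum_cons]; exact ha.add_even hs, Or.inl rfl⟩

/-- If some exponent after the first one is odd, then the word has a splitting to which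
`relSum_split_mem` applies with sign `-1`. -/
theorem exists_split (as : List ℕ) (h : ∃ a ∈ as.tail, Odd a) : ∃ p q : List LB,
    (∀ x ∈ p, x = LB.zero ∨ x = LB.neg) ∧
    (p = [] ∨ p.head? = some LB.neg ∧ p.getLast? = some LB.zero) ∧
    (∀ x ∈ q, x = LB.zero ∨ x = LB.negSq) ∧ q.head? = some LB.negSq ∧
    (p = [] → ∃ t, q = LB.negSq :: LB.negSq :: t) ∧ Odd (q.count LB.zero) ∧
    (p ++ q).map LB.atOne = blocks L3.zero L3.neg as := by
  match as with
  | [] => simp at h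
  | a :: bs =>
    obtain ⟨l₁, l₂, hbs, ho, hl⟩ := exists_odd_suffix bs h
    rw [List.tail_cons] at h
    have hl2 : ∃ b l, l₂ = b :: l := by
      cases l₂ with
      | nil => simp at ho
      | cons b l => exact ⟨b, l, rfl⟩
    obtain ⟨b, l₂', hl2⟩ := hl2
    by_cases h0 : l₁ = [] ∧ a = 0
    · obtain ⟨rfl, rfl⟩ := h0
      refine ⟨[], blocks LB.zero LB.negSq (0 :: l₂), by simp, Or.inl rfl,
        fun x hx => mem_blocks hx, rfl, fun _ => ⟨List.replicate b LB.zero ++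
          blocks LB.zero LB.negSq l₂', by rw [hl2]; rfl⟩, ?_, ?_⟩
      · rw [count_blocks (by decide)]
        simpa using ho
      · rw [List.nil_append, map_blocks, hbs]; rfl
    · have hm : ∃ l m, a :: l₁ = l ++ [m + 1] := by
        rcases hl with rfl | ⟨l, m, rfl⟩
        · refine ⟨[], a - 1, ?_⟩
          have : a ≠ 0 := fun h => h0 ⟨rfl, h⟩
          rw [List.nil_append, Nat.sub_add_cancel (by omega)]
        · exact ⟨a :: l, m, rfl⟩
      obtain ⟨l, m, hlm⟩ := hm
      refine ⟨blocks LB.zero LB.neg (a :: l₁), blocks LB.zero LB.negSq l₂,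
        fun x hx => mem_blocks hx, Or.inr ⟨rfl, ?_⟩, fun x hx => mem_blocks hx,
        by rw [hl2]; rfl, fun h => by simp [blocks_cons] at h, ?_, ?_⟩
      · rw [hlm, blocks_append, List.getLast?_append, blocks_cons, List.replicate_succ']
        have h : blocks LB.zero LB.neg [] = [] := rfl
        rw [h, List.append_nil, ← List.cons_append, List.getLast?_concat]
        rfl
      · rwa [count_blocks (by decide)]
      · rw [List.map_append, map_blocks, map_blocks, hbs, ← List.cons_append, blocks_append]; rfl

/-- The position of a word in the lexicographic order with `e_{-1} < e_0` among the words of its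
length. -/
def rank : List L3 → ℕ
  | [] => 0
  | a :: w => (if a = L3.zero then 2 ^ w.length else 0) + rank w

theorem rank_lt (w : List L3) : rank w < 2 ^ w.length := by
  induction w with
  | nil => simp [rank]
  | cons a w ih =>
    rw [rank, List.length_cons, pow_succ]
    split_ifs <;> omega

theorem rank_lt_rank (s t t' : List L3) (h : t'.length = t.length) :
    rank (s ++ L3.neg :: t') < rank (s ++ L3.zero :: t) := by
  induction s with
  | nil =>
    have := rank_lt t'
    rw [h] at this
    simp only [List.nil_append, rank, reduceCtorEq, if_false, if_true]
    omega
  | cons a s ih =>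
    simp only [List.cons_append, rank, List.length_append, List.length_cons, h]
    omega

/-- The index `(a₁ + 1, …, a_{r-1} + 1, -(a_r + 1))` of the word `blocks 0 (-1) (a₁, …, a_r)`. -/
def blockIndex : List ℕ → List ℤ
  | [] => []
  | [a] => [-(a + 1)]
  | a :: b :: as => (a + 1) :: blockIndex (b :: as)

theorem length_blockIndex (as : List ℕ) : (blockIndex as).length = as.length := by
  match as with
  | [] => rfl
  | [a] => rfl
  | a :: b :: as => rw [blockIndex, List.length_cons, length_blockIndex (b :: as)]; rfl

theorem blockIndex_cons_ne_nil (a : ℕ) (as : List ℕ) : blockIndex (a :: as) ≠ [] := by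
  intro h
  have := length_blockIndex (a :: as)
  simp [h] at this

theorem eps_blockIndex (a : ℕ) (as : List ℕ) : eps (blockIndex (a :: as)) = -1 := by
  induction as generalizing a with
  | nil =>
    have : (-((a : ℤ) + 1)).sign = -1 := Int.sign_eq_neg_one_of_neg (by omega)
    rw [blockIndex, eps, eps, this]; rfl
  | cons b as ih =>
    have : ((a : ℤ) + 1).sign = 1 := Int.sign_eq_one_of_pos (by omega)
    rw [blockIndex, eps, ih, this]; rfl

theorem eulerWord_blockIndex (as : List ℕ) :
    eulerWord (blockIndex as) = blocks L3.zero L3.neg as := by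
  match as with
  | [] => rfl
  | [a] =>
    have h := eps_blockIndex a []
    have ha : (-((a : ℤ) + 1)).natAbs - 1 = a := by omega
    rw [blockIndex] at h ⊢
    rw [eulerWord, h, eulerWord, ha]
    rfl
  | a :: b :: as =>
    have h := eps_blockIndex a (b :: as)
    have ha : ((a : ℤ) + 1).natAbs - 1 = a := by omega
    rw [blockIndex] at h ⊢
    rw [eulerWord, h, eulerWord_blockIndex (b :: as), ha]
    rfl

theorem blockIndex_mem (as : List ℕ) : (∀ k ∈ blockIndex as, k ≠ 0) ∧
    (∀ k ∈ (blockIndex as).dropLast, 0 < k) ∧ ∀ k ∈ (blockIndex as).getLast?, k < 0 := by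
  match as with
  | [] => simp [blockIndex]
  | [a] =>
    simp only [blockIndex, List.mem_singleton, forall_eq, List.dropLast_singleton,
      List.not_mem_nil, List.getLast?_singleton, Option.mem_some_iff, forall_eq']
    exact ⟨by omega, by simp, by omega⟩
  | a :: b :: as =>
    obtain ⟨h1, h2, h3⟩ := blockIndex_mem (b :: as)
    rw [blockIndex]
    obtain ⟨k, ks, hk⟩ := List.exists_cons_of_ne_nil (blockIndex_cons_ne_nil b as)
    rw [hk] at h1 h2 h3 ⊢
    rw [List.dropLast_cons_cons, List.getLast?_cons_cons]
    refine ⟨fun x hx => ?_, fun x hx => ?_, h3⟩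
    · rcases List.mem_cons.1 hx with rfl | hx
      · omega
      · exact h1 x hx
    · rcases List.mem_cons.1 hx with rfl | hx
      · omega
      · exact h2 x hx

theorem odd_of_mem_blockIndex (as : List ℕ) (h : ∀ a ∈ as, Even a) :
    ∀ k ∈ blockIndex as, Odd k := by
  match as with
  | [] => simp [blockIndex]
  | [a] =>
    obtain ⟨j, hj⟩ := h a (by simp)
    intro k hk
    rw [blockIndex, List.mem_singleton] at hk
    exact ⟨-j - 1, by rw [hk, hj]; push_cast; ring⟩
  | a :: b :: as =>
    obtain ⟨j, hj⟩ := h a (by simp)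
    intro k hk
    rw [blockIndex] at hk
    rcases List.mem_cons.1 hk with rfl | hk
    · exact ⟨j, by rw [hj]; push_cast; ring⟩
    · exact odd_of_mem_blockIndex (b :: as) (fun x hx => h x (by simp [hx])) k hk

theorem odd_of_mem_tail_blockIndex (as : List ℕ) (h : ∀ a ∈ as.tail, Even a) :
    ∀ k ∈ (blockIndex as).tail, Odd k := by
  match as with
  | [] => simp [blockIndex]
  | [a] => simp [blockIndex]
  | a :: b :: as => exact odd_of_mem_blockIndex (b :: as) h

/-- Every block word with even exponents after the first one belongs to an index in
`indexSetD`. -/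
theorem exists_index_of_blocks {k d : ℕ} (as : List ℕ) (h : ∀ a ∈ as.tail, Even a)
    (hk : (blocks L3.zero L3.neg as).length = k) (hd : as.length ≤ d) :
    ∃ ks ∈ indexSetD k d, eulerWord ks.1 = blocks L3.zero L3.neg as ∧ ks.1.length = as.length := by
  obtain ⟨h1, h2, h3⟩ := blockIndex_mem as
  have h4 : (blockIndex as).getLast? ≠ some 1 := fun h => by
    have := h3 1 h
    omega
  refine ⟨⟨blockIndex as, h1, h4⟩, ⟨⟨?_, ?_⟩, h2, h3, odd_of_mem_tail_blockIndex as h⟩,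
    eulerWord_blockIndex as, length_blockIndex as⟩
  · rw [← eulerWord_length _ h1, eulerWord_blockIndex, hk]
  · rwa [length_blockIndex]

end Blocks

/-! ### Generation of the lattice of normalized words -/

section Generation

/-- The class modulo `ℐ_CF`, after the words that begin with `e_0` or end with `e_1` have been
replaced by `0`. -/
noncomputable def toQuotient : A3 →ₗ[ℚ] A3 ⧸ ICF := ICF.mkQ ∘ₗ truncate L3.zero L3.one

theorem toQuotient_word_atOne {u : List LB} (hu : u ∈ regularB) :
    toQuotient (word (u.map LB.atOne)) = toQuotient (relSum u.length [] (word u)) := by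
  have h1 : word (u.map LB.atOne) ∈ regularSub L3.zero L3.one := by
    refine word_mem_regularSub ?_ ?_
    · rw [List.head?_map]
      intro h
      obtain ⟨x, hx, hx'⟩ := Option.map_eq_some_iff.1 h
      have := hu.1
      cases x <;> simp_all [LB.atOne]
    · rw [List.getLast?_map]
      intro h
      obtain ⟨x, hx, hx'⟩ := Option.map_eq_some_iff.1 h
      have := hu.2
      cases x <;> simp_all [LB.atOne]
  have h2 := relSum_mem_regularSub u.length [] hu
  rw [toQuotient, LinearMap.comp_apply, LinearMap.comp_apply, truncate_of_mem_regularSub h1,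
    truncate_of_mem_regularSub h2, Submodule.mkQ_apply, Submodule.mkQ_apply,
    Submodule.Quotient.eq, ← phi_word, ← evalOne_word]
  exact ⟨word u, Submodule.subset_span ⟨u, hu, rfl⟩, rfl⟩

/-- The `ℤ_(2)`-span of the classes of the normalized words of length `k` and depth less
than `D`. -/
noncomputable def normSpan (k D : ℕ) : Submodule Z2 (A3 ⧸ ICF) :=
  Submodule.span Z2 {x | ∃ w : List L3, w.length = k ∧ dep w < D ∧
    x = (2 : ℚ) ^ dep w • toQuotient (word w)}

/-- The `ℤ_(2)`-span of the classes of the normalized words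
`e_{-1} e_0^{a₁} ⋯ e_{-1} e_0^{a_r}` of length `k` with `r < D` and `a₂, …, a_r` even. -/
noncomputable def blockSpan (k D : ℕ) : Submodule Z2 (A3 ⧸ ICF) :=
  Submodule.span Z2 {x | ∃ as : List ℕ, (∀ a ∈ as.tail, Even a) ∧
    (blocks L3.zero L3.neg as).length = k ∧ as.length < D ∧
    x = (2 : ℚ) ^ as.length • toQuotient (word (blocks L3.zero L3.neg as))}

theorem word_mem_normSpan {k D : ℕ} {w : List L3} (hk : w.length = k) (hD : dep w < D) :
    (2 : ℚ) ^ dep w • toQuotient (word w) ∈ normSpan k D :=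
  Submodule.subset_span ⟨w, hk, hD, rfl⟩

theorem blockSpan_mono {k D D' : ℕ} (h : D ≤ D') : blockSpan k D ≤ blockSpan k D' :=
  Submodule.span_mono (by
    rintro x ⟨as, h1, h2, h3, h4⟩
    exact ⟨as, h1, h2, by omega, h4⟩)

theorem normSpan_fg (k D : ℕ) : (normSpan k D).FG := by
  refine Submodule.fg_span (((List.finite_length_eq L3 k).image fun w =>
    (2 : ℚ) ^ dep w • toQuotient (word w)).subset ?_)
  rintro x ⟨w, hk, -, rfl⟩
  exact ⟨w, hk, rfl⟩

theorem two_mem_jacobson : Ideal.span {(2 : Z2)} ≤ Ideal.jacobson ⊥ := by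
  rw [Ideal.span_le, Set.singleton_subset_iff, SetLike.mem_coe, Ideal.mem_jacobson_bot]
  rintro ⟨y, p, q, hq, rfl⟩
  have hq0 : (q : ℚ) ≠ 0 := by
    have : q ≠ 0 := by rintro rfl; simp at hq
    exact_mod_cast this
  have hr : Odd (2 * p + q) := (even_two_mul p).add_odd hq
  have hr0 : (2 * p + q : ℚ) ≠ 0 := by
    have : 2 * p + q ≠ 0 := by intro h; rw [h] at hr; simp at hr
    exact_mod_cast this
  refine IsUnit.of_mul_eq_one ⟨(q : ℚ) / ((2 * p + q : ℤ) : ℚ), q, 2 * p + q, hr, rfl⟩ ?_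
  apply Subtype.ext
  change ((2 : ℚ) * (p / q) + 1) * (q / ((2 * p + q : ℤ) : ℚ)) = 1
  push_cast
  field_simp

/-- A word in `e_0, e_{-1}` with an odd exponent `a_j`, `j ≥ 2`, is expressed by lexicographically
smaller words, words of smaller depth, and twice the lattice: the relation of `relSum_split_mem`
with sign `-1` is twice such an expression. -/
theorem word_mem_of_one_notMem {k D : ℕ} {S : Submodule Z2 (A3 ⧸ ICF)}
    (htwo : ∀ x ∈ normSpan k D, (2 : ℚ) • x ∈ S) (hblock : blockSpan k D ≤ S)
    (hlower : ∀ D' < D, normSpan k D' ≤ S) (w : List L3) (hone : L3.one ∉ w)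
    (hk : w.length = k) (hD : dep w < D) : (2 : ℚ) ^ dep w • toQuotient (word w) ∈ S := by
  induction hm : rank w using Nat.strong_induction_on generalizing w with
  | _ m ihm =>
  by_cases hh : w.head? = some L3.zero
  · rw [toQuotient, LinearMap.comp_apply, truncate, onWords_word, if_neg (by simp [hh]), map_zero,
      smul_zero]
    exact zero_mem _
  by_cases hdD : dep w + 1 < D
  · exact hlower _ hdD (word_mem_normSpan hk (by omega))
  obtain ⟨as, rfl⟩ := exists_eq_blocks w hone hh
  by_cases hev : ∀ a ∈ as.tail, Even a
  · rw [dep_blocks] at hD ⊢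
    exact hblock (Submodule.subset_span ⟨as, hev, hk, hD, rfl⟩)
  obtain ⟨p, q, hp, hp', hq, hq', hpq, hodd, hmap⟩ := exists_split as (by
    push Not at hev
    obtain ⟨a, ha, h⟩ := hev
    exact ⟨a, ha, Nat.not_even_iff_odd.1 h⟩)
  set w := blocks L3.zero L3.neg as with hw
  -- the elements whose halves have their class in `S`
  let T : AddSubgroup A3 := S.toAddSubgroup.comap ((2 : ℚ)⁻¹ • toQuotient).toAddMonoidHom
  have hT : ∀ x, x ∈ T ↔ (2 : ℚ)⁻¹ • toQuotient x ∈ S := fun x => Iff.rfl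
  have hT2 : ∀ (n : ℕ) (v : List L3), (2 : ℚ) ^ (n + 1) • word v ∈ T ↔
      (2 : ℚ) ^ n • toQuotient (word v) ∈ S := fun n v => by
    rw [hT, map_smul, smul_smul, pow_succ, mul_comm, mul_assoc, mul_inv_cancel₀ (by norm_num),
      mul_one]
  have h2 : lattice w.length (dep w + 1) 2 ≤ T := fun x hx => by
    refine map_mem_of_lattice LinearMap.id T (fun v hv hd => ?_) hx
    rw [LinearMap.id_apply, hT2, pow_succ', mul_smul]
    exact htwo _ (word_mem_normSpan (hv.trans hk) (by omega))
  have h1 : lattice w.length (dep w) 1 ≤ T := fun x hx => by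
    refine map_mem_of_lattice LinearMap.id T (fun v hv hd => ?_) hx
    rw [LinearMap.id_apply, hT2]
    exact hlower (dep w) hD (word_mem_normSpan (hv.trans hk) hd)
  have hrel := relSum_split_mem w h2 h1 (fun s t t' hst ht hdep hone' _ => by
      rw [hT2, ← hdep]
      refine ihm _ ?_ (s ++ L3.neg :: t') hone' ?_ (by rw [hdep]; exact hD) rfl
      · rw [← hm, hst]; exact rank_lt_rank s t t' ht
      · rw [← hk, hst]; simp [ht])
    p hp hp' (p ++ q).length [] q hq (Or.inr hq') (fun h => Or.inr (hpq h)) rfl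
    (by rw [List.append_nil, hmap]) (by simp)
  have hreg : p ++ q ∈ regularB := by
    refine mem_regularB_of_z_notMem ?_ (fun h => ?_)
    · rcases hp' with rfl | ⟨h, -⟩
      · rw [List.nil_append, hq']; simp
      · rw [List.head?_append, h]; simp
    · rcases List.mem_append.1 h with h | h
      · simpa using hp _ h
      · simpa using hq _ h
  have hfix : shReg L3.zero L3.one (word w) = word w :=
    shReg_of_mem_regularSub (word_mem_regularSub hh fun h => hone (List.mem_of_getLast? h))
  rw [hT, map_smul, map_sub, ← toQuotient_word_atOne hreg, hmap, hodd.neg_one_pow, map_smul,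
    hfix] at hrel
  convert hrel using 1
  module

/-- Lift of a word along `z → 1` that avoids the letter `-1`. -/
theorem exists_lift {w : List L3} (h : w.head? ≠ some L3.zero) (h' : w.getLast? ≠ some L3.one) :
    ∃ u ∈ regularB, LB.neg ∉ u ∧ u.map LB.atOne = w := by
  let g : L3 → LB := fun | .zero => .zero | .one => .z | .neg => .negSq
  refine ⟨w.map g, ⟨?_, ?_⟩, ?_, ?_⟩
  · rw [List.head?_map]
    intro h
    obtain ⟨x, hx, hx'⟩ := Option.map_eq_some_iff.1 h
    cases x <;> simp_all [g]
  · rw [List.getLast?_map]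
    intro h
    obtain ⟨x, hx, hx'⟩ := Option.map_eq_some_iff.1 h
    cases x <;> simp_all [g]
  · intro h
    obtain ⟨x, -, hx⟩ := List.mem_map.1 h
    cases x <;> simp [g] at hx
  · rw [List.map_map]
    conv_rhs => rw [← List.map_id w]
    refine List.map_congr_left fun x _ => ?_
    cases x <;> rfl

/-- By Nakayama's lemma it suffices to express the normalized words modulo twice the lattice. The
relations for words without the letter `-1` reduce them to words in `e_0, e_{-1}`. -/
theorem normSpan_le_blockSpan (k D : ℕ) : normSpan k D ≤ blockSpan k D := by
  induction D using Nat.strong_induction_on with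
  | _ D ihD =>
  refine Submodule.le_of_le_smul_of_le_jacobson_bot (normSpan_fg k D) two_mem_jacobson ?_
  set S := blockSpan k D ⊔ Ideal.span {(2 : Z2)} • normSpan k D with hS
  have htwo : ∀ x ∈ normSpan k D, (2 : ℚ) • x ∈ S := by
    intro x hx
    have : (2 : ℚ) • x = (2 : Z2) • x := by rw [two_smul, two_smul]
    rw [this]
    exact Submodule.mem_sup_right (Submodule.smul_mem_smul
      (Ideal.subset_span (Set.mem_singleton _)) hx)
  have hblock : blockSpan k D ≤ S := le_sup_left
  have hlower : ∀ D' < D, normSpan k D' ≤ S := fun D' hD' =>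
    (ihD D' hD').trans ((blockSpan_mono hD'.le).trans hblock)
  clear_value S
  conv_lhs => rw [normSpan]
  rw [Submodule.span_le]
  rintro x ⟨w, hk, hD, rfl⟩
  rw [SetLike.mem_coe]
  by_cases hadm : w.head? ≠ some L3.zero ∧ w.getLast? ≠ some L3.one
  · obtain ⟨u, hreg, hneg, rfl⟩ := exists_lift hadm.1 hadm.2
    rw [dep_map_atOne] at hD ⊢
    rw [List.length_map] at hk
    let T : AddSubgroup A3 := S.toAddSubgroup.comap toQuotient.toAddMonoidHom
    have hT : ∀ x, x ∈ T ↔ toQuotient x ∈ S := fun x => Iff.rfl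
    have hrel := relSum_mem_of_neg_notMem (n := depB u) (k := k) (T := T) (fun x hx => by
        refine map_mem_of_lattice LinearMap.id T (fun v hv hd => ?_) hx
        rw [LinearMap.id_apply, hT, map_smul, pow_succ', mul_smul]
        exact htwo _ (word_mem_normSpan hv (by omega)))
      (fun v hv hvk hvd => by
        rw [hT, map_smul]
        exact word_mem_of_one_notMem htwo hblock hlower v hv hvk (by omega))
      u.length [] hreg rfl hneg (by simp) (by simpa using hk) (by simp)
    rw [hT, map_smul, ← toQuotient_word_atOne hreg] at hrel
    exact hrel
  · rw [toQuotient, LinearMap.comp_apply, truncate, onWords_word, if_neg hadm, map_zero, smul_zero]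
    exact zero_mem _

/-- `ℋ_CF` as a subspace of the quotient of the full algebra by `ℐ_CF`. -/
noncomputable def embedHCF : HCF →ₗ[ℚ] A3 ⧸ ICF :=
  Submodule.mapQ (ICF.submoduleOf A0) ICF A0.subtype le_rfl

theorem embedHCF_injective : Function.Injective embedHCF := by
  rw [injective_iff_map_eq_zero]
  intro x
  induction x using Submodule.Quotient.induction_on with
  | H y =>
    intro h
    exact (Submodule.Quotient.mk_eq_zero (ICF.submoduleOf A0)).2
      ((Submodule.Quotient.mk_eq_zero ICF).1 h)

theorem embedHCF_modClass (ks : Index) : embedHCF (modClass ks) =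
    (2 : ℚ) ^ ks.1.length • toQuotient (word (eulerWord ks.1)) := by
  rw [toQuotient, LinearMap.comp_apply, truncate_word_of_regular (eulerWord_head _)
    (eulerWord_getLast _ ks.2.2), ← map_smul]
  rfl

theorem modX_eq_modXD (k d : ℕ) : modX k d = modXD k d := by
  refine le_antisymm ?_ (Submodule.span_mono (Set.image_mono fun ks h => h.1))
  let f : HCF →ₗ[Z2] A3 ⧸ ICF := embedHCF.restrictScalars Z2
  have hf : Function.Injective f := embedHCF_injective
  rw [← Submodule.map_le_map_iff_of_injective hf]
  have h1 : (modX k d).map f ≤ normSpan k (d + 1) := by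
    rw [modX, Submodule.map_span, Submodule.span_le]
    rintro _ ⟨_, ⟨ks, hks, rfl⟩, rfl⟩
    have hd := eulerWord_countP ks.1
    have := word_mem_normSpan (D := d + 1) ((eulerWord_length ks.1 ks.2.1).trans hks.1)
      (by rw [dep, hd]; have := hks.2; omega)
    rw [dep, hd] at this
    change embedHCF (modClass ks) ∈ _
    rw [embedHCF_modClass]
    exact this
  have h2 : blockSpan k (d + 1) ≤ (modXD k d).map f := by
    rw [modXD, Submodule.map_span]
    refine Submodule.span_mono ?_
    rintro _ ⟨as, hev, hk, hd, rfl⟩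
    obtain ⟨ks, hks, hw, hl⟩ := exists_index_of_blocks as hev hk (Nat.lt_succ_iff.1 hd)
    refine ⟨modClass ks, ⟨ks, hks, rfl⟩, ?_⟩
    change embedHCF (modClass ks) = _
    rw [embedHCF_modClass, hw, hl]
  exact h1.trans ((normSpan_le_blockSpan k (d + 1)).trans h2)

theorem A0kd_le_A0 (k d : ℕ) : A0kd k d ≤ A0 :=
  Submodule.span_mono (Set.image_mono fun _ h => h.1)

end Generation

end Confluence

theorem mainTheorem7 {R : Type*} [AddCommGroup R] [Module ℚ R] (k d : ℕ) :
    Confluence.modX k d = Confluence.modXD k d ∧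
      ∀ Z : Confluence.A0kd k d →ₗ[ℚ] R,
        (∀ x : Confluence.A0kd k d, (x : Confluence.A3) ∈ Confluence.ICF → Z x = 0) →
        ∀ ks : Confluence.indexSet k d,
          Z (Confluence.modWordKD ks) ∈ Submodule.span Confluence.Z2
            ((fun ks' : Confluence.indexSet k d => Z (Confluence.modWordKD ks')) ''
              {ks' | (ks' : Confluence.Index) ∈ Confluence.indexSetD k d}) := by
  open Confluence in
  refine ⟨modX_eq_modXD k d, fun Z hZ ks => ?_⟩
  let f : A0kd k d →ₗ[Z2] HCF := ((ICF.submoduleOf A0).mkQ ∘ₗ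
    Submodule.inclusion (A0kd_le_A0 k d)).restrictScalars Z2
  have hf : ∀ ks' : indexSet k d, f (modWordKD ks') = modClass ks' := fun _ => rfl
  have hker : ∀ x, f x = 0 → Z x = 0 := fun x hx =>
    hZ x ((Submodule.Quotient.mk_eq_zero (ICF.submoduleOf A0)).1 hx)
  have h1 : modClass ks ∈ modXD k d := by
    rw [← modX_eq_modXD]
    exact Submodule.subset_span ⟨ks, ks.2, rfl⟩
  have h2 : modXD k d = (Submodule.span Z2 (modWordKD '' {ks' : indexSet k d |
      (ks' : Index) ∈ indexSetD k d})).map f := by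
    rw [modXD, Submodule.map_span, Set.image_image]
    congr 1
    ext x
    constructor
    · rintro ⟨ks', h, rfl⟩
      exact ⟨⟨ks', h.1⟩, h, rfl⟩
    · rintro ⟨ks', h, rfl⟩
      exact ⟨ks', h, rfl⟩
  rw [h2, ← hf] at h1
  obtain ⟨y, hy, hyx⟩ := h1
  have h3 : Z (modWordKD ks) = Z y := by
    have := hker (y - modWordKD ks) (by rw [map_sub, hyx, sub_self])
    rw [map_sub, sub_eq_zero] at this
    exact this.symm
  rw [h3]
  have h4 := Submodule.mem_map_of_mem (f := Z.restrictScalars Z2) hy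
  rw [Submodule.map_span, Set.image_image] at h4
  exact h4
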